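/- Let $O(3)$ be the orthogonal group of $\mathbb R^3$, and let a point group be a finite subgroup $S\le O(3)$. Groups are named in Schoenflies notation, up to conjugacy in $O(3)$; $1$ is the trivial group, $C_i=\{\pm1\}$, $C_s$ is generated by one reflection, $K=SO(3)$, $K_h=O(3)$. Write $N(S)=\{g\in O(3): gSg^{-1}=S\}$. A complement of $S$ in $N(S)$ is a subgroup $H\le N(S)$ with $SH=N(S)$ and $S\cap H=1$. An $O(3)$-equivariant symmetry breaking set (SBS) for $S$ is a subset $B$ of a set with an $O(3)$-action such that $S$ maps $B$ to itself and acts freely on it and $gB=B$ for all $g\in N(S)$; it is ideal if it is nonempty and $S$ acts transitively on it. For $n\ge1$, $D_{(2n)h}$ is generated by the rotation $a$ by $2\pi/(2n)$ about an axis $\ell$, the rotation $b$ by $\pi$ about an axis $\ell'\perp\ell$, and the reflection $m$ across the plane spanned by $\ell$ and $\ell'$. $O_h$ is generated by two rotations $a,b$ by $\pi/2$ about perpendicular axes and the inversion $i$. (1) Each of the following groups has the indicated normalizer in $O(3)$, and the listed subgroup, which has the indicated name, is a complement of it in this normalizer. Normalizer $K_h=O(3)$: the group $1$ has complement $K_h$;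 $C_i$ has complement $K$. Normalizer $D_{(2n)h}$: $$\begin{array}{l|l|l|l|l} \text{group}&\text{generators}&\text{range}&\text{complement}&\text{generators}\\\hline C_{nv}&a^2,\,m&n\ge2&C_{2v}&am,\,bm\\ D_{nd}&a^2,\,abm,\,m&n\ge2&C_s&bm\\ D_{nh}&a^2,\,b,\,m&n\ge3&C_s&am\\ D_n&a^2,\,b&n\ge3&C_{2v}&am,\,bm \end{array}$$ Normalizer $I_h$: $I$ has complement $C_i$; $I_h$ has complement $1$. Normalizer $O_h$: $$\begin{array}{l|l|l|l} \text{group}&\text{generators}&\text{complement}&\text{generators}\\\hline D_2&a^2,\,b^2&D_{3d}&ab,\,ba^2,\,i\\ D_{2h}&a^2,\,b^2,\,i&D_3&ab,\,ba^2\\ T&ab,\,ba&C_{2h}&a^2b,\,i\\ T_d&ab,\,ba,\,ai&C_2&a^2b\\ T_h&ab,\,ba,\,i&C_2&a^2b\\ O&a,\,b&C_i&i\\ O_h&a,\,b,\,i&1&\varnothing \end{array}$$ (2) These tables are exhaustive: if $S$ is a point group and $N(S)$ is conjugate to $N\in\{K_h,I_h,O_h\}\cup\{D_{(2n)h}:n\ge1\}$,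 then some $g\in O(3)$ conjugates $N$ to $N(S)$, a group listed under $N$ to $S$, and hence its listed complement to a complement of $S$ in $N(S)$. (3) The normalizer of every point group is conjugate to $K_h$, $I_h$, $O_h$, some $D_{(2n)h}$ with $n\ge2$, or $D_{\infty h}$. The point groups with normalizer conjugate to $D_{\infty h}$ are, up to conjugacy, $C_s$ and $C_n,S_{2n},C_{nh}$ for $n\ge2$. When these are placed along the axis of $D_{\infty h}$, their normalizer is $D_{\infty h}$; there $C_s$ has the complements $C_{\infty v}$ and $D_\infty$, whereas $C_n,S_{2n},C_{nh}$ $(n\ge2)$ have no complement. (4) Consequently, a point group $S$ admits an ideal $O(3)$-equivariant SBS if and only if $S$ is not conjugate to any of $C_n$, $S_{2n}$, $C_{nh}$ with $n\ge2$. -/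

import Mathlib

namespace PointGroup

/-! ### Group theory: complements, conjugate subgroups, symmetry breaking sets -/

/-- `H` is a complement of `S` in the subgroup `N`: both are contained in `N` and every element of
`N` is `s * h` for exactly one pair `s ∈ S`, `h ∈ H`. -/
def IsComplementIn {G : Type*} [Group G] (N S H : Subgroup G) : Prop :=
  S ≤ N ∧ H ≤ N ∧ Subgroup.IsComplement' (S.subgroupOf N) (H.subgroupOf N)

/-- The subgroup `g S g⁻¹`. -/
def conj {G : Type*} [Group G] (g : G) (S : Subgroup G) : Subgroup G :=
  S.map (MulAut.conj g).toMonoidHom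

/-- `S` and `T` are conjugate, i.e. they have the same name as point groups. -/
def AreConj {G : Type*} [Group G] (S T : Subgroup G) : Prop :=
  ∃ g : G, T = conj g S

/-- The set `B` is a symmetry breaking set for `S`: `S` acts on `B`, and the action is free. -/
def IsSBS {G X : Type*} [Group G] [MulAction G X] (S : Subgroup G) (B : Set X) : Prop :=
  (∀ s ∈ S, ∀ x ∈ B, s • x ∈ B) ∧ ∀ s ∈ S, ∀ x ∈ B, s • x = x → s = 1

/-- A symmetry breaking set for `S` is `G`-equivariant if `g B = B` for all `g ∈ N_G(S)`. -/
def IsEquivariantSBS {G X : Type*} [Group G] [MulAction G X] (S : Subgroup G) (B : Set X) : Prop :=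
  IsSBS S B ∧ ∀ g ∈ Subgroup.normalizer (S : Set G), (fun x => g • x) '' B = B

/-- An equivariant symmetry breaking set is ideal if `S` acts transitively on it
(a single, nonempty orbit). -/
def IsIdealEquivariantSBS {G X : Type*} [Group G] [MulAction G X]
    (S : Subgroup G) (B : Set X) : Prop :=
  IsEquivariantSBS S B ∧ B.Nonempty ∧ ∀ x ∈ B, ∀ y ∈ B, ∃ s ∈ S, s • x = y

/-- Some `G`-set contains an ideal `G`-equivariant symmetry breaking set for `S`. -/
def AdmitsIdealSBS.{u} {G : Type u} [Group G] (S : Subgroup G) : Prop :=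
  ∃ (X : Type u) (_ : MulAction G X) (B : Set X), IsIdealEquivariantSBS (G := G) S B

/-! ### The orthogonal group and some of its elements -/

/-- The orthogonal group `O(3)`. -/
abbrev O3 : Type := Matrix.orthogonalGroup (Fin 3) ℝ

/-- Rotation by the angle `θ` about the `z`-axis. -/
noncomputable def rotZ (θ : ℝ) : O3 :=
  ⟨!![Real.cos θ, -Real.sin θ, 0; Real.sin θ, Real.cos θ, 0; 0, 0, 1], by
    have h := Real.sin_sq_add_cos_sq θ
    rw [Matrix.mem_orthogonalGroup_iff]
    ext i j
    fin_cases i <;> fin_cases j <;> simp [Matrix.mul_apply, Fin.sum_univ_three] <;>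
      linarith⟩

/-- Rotation by the angle `θ` about the `x`-axis. -/
noncomputable def rotX (θ : ℝ) : O3 :=
  ⟨!![1, 0, 0; 0, Real.cos θ, -Real.sin θ; 0, Real.sin θ, Real.cos θ], by
    have h := Real.sin_sq_add_cos_sq θ
    rw [Matrix.mem_orthogonalGroup_iff]
    ext i j
    fin_cases i <;> fin_cases j <;> simp [Matrix.mul_apply, Fin.sum_univ_three] <;>
      linarith⟩

/-- Reflection across the `xy`-plane. -/
noncomputable def reflXY : O3 :=
  ⟨!![1, 0, 0; 0, 1, 0; 0, 0, -1], by
    rw [Matrix.mem_orthogonalGroup_iff]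
    ext i j
    fin_cases i <;> fin_cases j <;> simp [Matrix.mul_apply, Fin.sum_univ_three]⟩

/-- Reflection across the `xz`-plane. -/
noncomputable def reflXZ : O3 :=
  ⟨!![1, 0, 0; 0, -1, 0; 0, 0, 1], by
    rw [Matrix.mem_orthogonalGroup_iff]
    ext i j
    fin_cases i <;> fin_cases j <;> simp [Matrix.mul_apply, Fin.sum_univ_three]⟩

/-- Reflection across the `yz`-plane. -/
noncomputable def reflYZ : O3 :=
  ⟨!![-1, 0, 0; 0, 1, 0; 0, 0, 1], by
    rw [Matrix.mem_orthogonalGroup_iff]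
    ext i j
    fin_cases i <;> fin_cases j <;> simp [Matrix.mul_apply, Fin.sum_univ_three]⟩

/-- Inversion `v ↦ -v`. -/
noncomputable def inversion : O3 :=
  ⟨-1, by rw [Matrix.mem_orthogonalGroup_iff]; simp⟩

/-! ### The closed subgroups of `O(3)` by Schoenflies name, in a canonical orientation

The main axis is the `z`-axis, and there is a two-fold axis along `x` if there are two-fold axes
perpendicular to the main one. -/

open Subgroup (closure)

/-- `C_n`. -/
noncomputable def Cn (n : ℕ) : Subgroup O3 := closure {rotZ (2 * Real.pi / n)}

/-- `S_{2n}`, generated by a rotation by `2π/(2n)` followed by a reflection across the plane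
perpendicular to the axis. -/
noncomputable def S2n (n : ℕ) : Subgroup O3 := closure {rotZ (Real.pi / n) * reflXY}

/-- `C_{nh}`. -/
noncomputable def Cnh (n : ℕ) : Subgroup O3 := closure {rotZ (2 * Real.pi / n), reflXY}

/-- `C_{nv}`. -/
noncomputable def Cnv (n : ℕ) : Subgroup O3 := closure {rotZ (2 * Real.pi / n), reflYZ}

/-- `D_n`. -/
noncomputable def Dn (n : ℕ) : Subgroup O3 := closure {rotZ (2 * Real.pi / n), rotX Real.pi}

/-- `D_{nd}`. -/
noncomputable def Dnd (n : ℕ) : Subgroup O3 :=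
  closure {rotZ (Real.pi / n) * reflXY, rotX Real.pi}

/-- `D_{nh}`. -/
noncomputable def Dnh (n : ℕ) : Subgroup O3 :=
  closure {rotZ (2 * Real.pi / n), rotX Real.pi, reflXY}

/-- `C_s`. -/
noncomputable def Cs : Subgroup O3 := closure {reflXY}

/-- `C_i`. -/
noncomputable def Ci : Subgroup O3 := closure {inversion}

/-- `K = SO(3)`. -/
noncomputable def SO3 : Subgroup O3 :=
  (Matrix.detMonoidHom.comp (Matrix.orthogonalGroup (Fin 3) ℝ).subtype).ker

/-- `C_{∞v}`. -/
noncomputable def Cinfv : Subgroup O3 := closure (Set.range rotZ ∪ {reflYZ})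

/-- `D_∞`. -/
noncomputable def Dinf : Subgroup O3 := closure (Set.range rotZ ∪ {rotX Real.pi})

/-- `D_{∞h}`. -/
noncomputable def Dinfh : Subgroup O3 := closure (Set.range rotZ ∪ {rotX Real.pi, reflXY})

/-- The group of all `g ∈ O(3)` with `g V = V`. -/
noncomputable def symmetryGroup (V : Set (Fin 3 → ℝ)) : Subgroup O3 where
  carrier := {g | ∀ v, g.1.mulVec v ∈ V ↔ v ∈ V}
  one_mem' := by intro v; simp
  mul_mem' := by
    intro g h hg hh v
    have := hg (h.1.mulVec v)
    rw [Matrix.mulVec_mulVec] at this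
    exact this.trans (hh v)
  inv_mem' := by
    intro g hg v
    have h1 := hg ((g⁻¹).1.mulVec v)
    have h2 : g.1 * (g⁻¹).1 = 1 := congrArg Subtype.val (mul_inv_cancel g)
    rw [Matrix.mulVec_mulVec, h2, Matrix.one_mulVec] at h1
    exact h1.symm

/-- The eight vertices `(±1, ±1, ±1)` of a cube. -/
def cube : Set (Fin 3 → ℝ) := {v | ∀ i, v i = 1 ∨ v i = -1}

/-- Four alternating vertices of the cube; they form a regular tetrahedron. -/
def tetrahedron : Set (Fin 3 → ℝ) := {v | v ∈ cube ∧ v 0 * v 1 * v 2 = 1}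

/-- The twelve vertices of a regular icosahedron: the cyclic permutations of `(0, ±1, ±φ)`. -/
noncomputable def icosahedron : Set (Fin 3 → ℝ) :=
  {v | ∃ i : Fin 3, v i = 0 ∧ (v (i + 1) = 1 ∨ v (i + 1) = -1) ∧
    (v (i + 2) = Real.goldenRatio ∨ v (i + 2) = -Real.goldenRatio)}

/-- `T_d`. -/
noncomputable def Td : Subgroup O3 := symmetryGroup tetrahedron

/-- `T`. -/
noncomputable def T : Subgroup O3 := Td ⊓ SO3

/-- `T_h`, generated by `T` and the inversion. -/
noncomputable def Th : Subgroup O3 := T ⊔ Ci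

/-- `O_h`. -/
noncomputable def Oh : Subgroup O3 := symmetryGroup cube

/-- `O`. -/
noncomputable def O : Subgroup O3 := Oh ⊓ SO3

/-- `I_h`. -/
noncomputable def Ih : Subgroup O3 := symmetryGroup icosahedron

/-- `I`. -/
noncomputable def I : Subgroup O3 := Ih ⊓ SO3

/-! ### The tables of complements -/

/-- The generator `a` of `D_{(2n)h}`: rotation by `2π/(2n)` about the main axis. -/
noncomputable def aD (n : ℕ) : O3 := rotZ (Real.pi / n)

/-- The generator `b` of `D_{(2n)h}`: rotation by `π` about a perpendicular axis. -/
noncomputable def bD : O3 := rotX Real.pi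

/-- The generator `m` of `D_{(2n)h}`: reflection across the plane of the axes of `a` and `b`. -/
noncomputable def mD : O3 := reflXZ

/-- The generator `a` of `O_h`: rotation by `π/2` about a four-fold axis. -/
noncomputable def aO : O3 := rotZ (Real.pi / 2)

/-- The generator `b` of `O_h`: rotation by `π/2` about a perpendicular four-fold axis. -/
noncomputable def bO : O3 := rotX (Real.pi / 2)

/-- The rows of the tables of complements. In `ComplementTable N S₀ S H₀ H`, the subgroup `N` is
the normalizer, `S` is the group as a subgroup of `N`, and `H` is the listed complement; `S₀` and
`H₀` are the groups of the same Schoenflies name in canonical orientation. -/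
inductive ComplementTable :
    Subgroup O3 → Subgroup O3 → Subgroup O3 → Subgroup O3 → Subgroup O3 → Prop
  -- normalizer `K_h = O(3)`
  | row_one : ComplementTable ⊤ (Cn 1) ⊥ ⊤ ⊤
  | row_Ci : ComplementTable ⊤ Ci Ci SO3 SO3
  -- normalizer `D_{(2n)h}`
  | row_Cnv (n : ℕ) (hn : 2 ≤ n) :
      ComplementTable (Dnh (2 * n)) (Cnv n) (closure {aD n ^ 2, mD})
        (Cnv 2) (closure {aD n * mD, bD * mD})
  | row_Dnd (n : ℕ) (hn : 2 ≤ n) :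
      ComplementTable (Dnh (2 * n)) (Dnd n) (closure {aD n ^ 2, aD n * bD * mD, mD})
        Cs (closure {bD * mD})
  | row_Dnh (n : ℕ) (hn : 3 ≤ n) :
      ComplementTable (Dnh (2 * n)) (Dnh n) (closure {aD n ^ 2, bD, mD})
        Cs (closure {aD n * mD})
  | row_Dn (n : ℕ) (hn : 3 ≤ n) :
      ComplementTable (Dnh (2 * n)) (Dn n) (closure {aD n ^ 2, bD})
        (Cnv 2) (closure {aD n * mD, bD * mD})
  -- normalizer `I_h`
  | row_I : ComplementTable Ih I I Ci Ci
  | row_Ih : ComplementTable Ih Ih Ih (Cn 1) ⊥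
  -- normalizer `O_h`
  | row_D2 :
      ComplementTable Oh (Dn 2) (closure {aO ^ 2, bO ^ 2})
        (Dnd 3) (closure {aO * bO, bO * aO ^ 2, inversion})
  | row_D2h :
      ComplementTable Oh (Dnh 2) (closure {aO ^ 2, bO ^ 2, inversion})
        (Dn 3) (closure {aO * bO, bO * aO ^ 2})
  | row_T :
      ComplementTable Oh T (closure {aO * bO, bO * aO})
        (Cnh 2) (closure {aO ^ 2 * bO, inversion})
  | row_Td :
      ComplementTable Oh Td (closure {aO * bO, bO * aO, aO * inversion})
        (Cn 2) (closure {aO ^ 2 * bO})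
  | row_Th :
      ComplementTable Oh Th (closure {aO * bO, bO * aO, inversion})
        (Cn 2) (closure {aO ^ 2 * bO})
  | row_O :
      ComplementTable Oh O (closure {aO, bO}) Ci (closure {inversion})
  | row_Oh :
      ComplementTable Oh Oh (closure {aO, bO, inversion}) (Cn 1) (closure ∅)

end PointGroup

open PointGroup

namespace PointGroup

/-! ### Conjugation, normalizers and complements in an abstract group. -/

section GroupTheory

variable {G : Type*} [Group G]

/-! The stabilizer in N(S) of a point of an ideal symmetry breaking set is a complement of S, and a
complement H conversely gives the coset space N(S)/H inside O(3)/H (`admitsIdealSBS_iff`). So part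
(4) is a question about complements, and what is needed is the list of point groups together with
their normalizers.

Groups preserving a line. The stabilizer of the z-axis is D_{∞h}, an extension of the circle by two
signs. Its elements are written `dih z s t` and multiply by `dih_mul`. A finite subgroup is
determined by the order n of its group of rotations about the axis, the group Q of sign pairs (s, t)
that occur, and the value of z ^ n on each pair. Up to conjugacy this value is a sign character χ,
which gives the groups `axial n Q χ` (`exists_conj_eq_axial`). If the group singles out its axis,
then the normalizer lies in D_{∞h}. Conjugation in these coordinates shows that the normalizer is
all of D_{∞h} if no element has s = -1, and is cut out by z ^ (2n) = 1 otherwise, so that it is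
D_{(2n)h}. The groups C_n, S_{2n}, C_{nh} have no complement H: a 2n-th root of their generating
rotation exists in D_{∞h}, and its H-component has that rotation as its 2n-th power, so H meets S
(`not_isComplementIn_axial_Qh`).

Groups preserving no line. For rotation groups, Burnside's count of poles leaves the orders 12, 24
and 60 (`exists_axis_or_pole`). The orbit of a pole of order 3, 4 or 5 respectively is then forced
to be an explicit set of points, and this set determines the group (`IsStandard.eq`). So T, O and I
are the only ones up to conjugacy. A general S is compared with the rotation group (S ⊔ C_i) ∩
SO(3), in which S ∩ SO(3) has index at most two. Elements of odd order belong to every subgroup of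
index two, which leaves few cases (`listed_of_eq_T`, `listed_of_eq_O`, `listed_of_eq_I`).

The normalizers come from intrinsic configurations. The elements of order three generate T. The
involutions of T together with 1 form D_2, and the normalizer of D_2 permutes the coordinate axes.
The five-fold axes of I are the lines through the vertices of the icosahedron.

Every finite S is therefore listed (`listed_of_finite`) and every row is right
(`ComplementTable.correct`). The possible normalizers are pairwise not conjugate
(`eq_of_areConj_normalizers`), so the normalizer of S tells under which heading S stands. -/

theorem mem_conj {g x : G} {S : Subgroup G} : x ∈ conj g S ↔ g⁻¹ * x * g ∈ S := by
  constructor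
  · rintro ⟨y, hy, rfl⟩
    simpa [mul_assoc] using hy
  · intro h
    exact ⟨_, h, by simp [mul_assoc]⟩

theorem conj_mem_conj {g x : G} {S : Subgroup G} (hx : x ∈ S) : g * x * g⁻¹ ∈ conj g S := by
  rw [mem_conj]
  simpa [mul_assoc] using hx

theorem conj_conj (g h : G) (S : Subgroup G) : conj g (conj h S) = conj (g * h) S := by
  ext x
  simp [mem_conj, mul_assoc]

theorem conj_one (S : Subgroup G) : conj 1 S = S := by
  ext x
  simp [mem_conj]

theorem conj_inv_conj (g : G) (S : Subgroup G) : conj g⁻¹ (conj g S) = S := by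
  simp [conj_conj, conj_one]

theorem conj_mono {g : G} {S T : Subgroup G} (h : S ≤ T) : conj g S ≤ conj g T :=
  Subgroup.map_mono h

theorem conj_closure (g : G) (X : Set G) :
    conj g (Subgroup.closure X) = Subgroup.closure ((fun x => g * x * g⁻¹) '' X) := by
  rw [conj, MonoidHom.map_closure]
  rfl

theorem conj_top (g : G) : conj g (⊤ : Subgroup G) = ⊤ := by
  ext x
  simp [mem_conj]

theorem mem_normalizer_iff_conj {g : G} {S : Subgroup G} :
    g ∈ Subgroup.normalizer (S : Set G) ↔ conj g S = S := by
  rw [Subgroup.mem_normalizer_iff]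
  constructor
  · intro h
    ext x
    rw [mem_conj, h (g⁻¹ * x * g)]
    simp [mul_assoc]
  · intro h x
    constructor
    · intro hx
      rw [← h]
      exact conj_mem_conj hx
    · intro hx
      have : g * x * g⁻¹ ∈ conj g S := by rw [h]; exact hx
      rw [mem_conj] at this
      simpa [mul_assoc] using this

theorem normalizer_conj (g : G) (S : Subgroup G) :
    Subgroup.normalizer (conj g S : Set G) = conj g (Subgroup.normalizer (S : Set G)) := by
  ext x
  rw [mem_conj, mem_normalizer_iff_conj, mem_normalizer_iff_conj, conj_conj, mul_assoc,
    ← conj_conj g⁻¹, ← conj_conj x g]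
  constructor
  · intro h
    rw [h, conj_inv_conj]
  · intro h
    have := congrArg (conj g) h
    rwa [conj_conj, mul_inv_cancel, conj_one] at this

theorem AreConj.refl (S : Subgroup G) : AreConj S S := ⟨1, (conj_one S).symm⟩

theorem AreConj.symm {S T : Subgroup G} : AreConj S T → AreConj T S := by
  rintro ⟨g, rfl⟩
  exact ⟨g⁻¹, (conj_inv_conj g S).symm⟩

theorem AreConj.trans {S T U : Subgroup G} : AreConj S T → AreConj T U → AreConj S U := by
  rintro ⟨g, rfl⟩ ⟨h, rfl⟩
  exact ⟨h * g, conj_conj h g S⟩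

theorem AreConj.finite {S T : Subgroup G} (h : AreConj S T) [Finite S] : Finite T := by
  obtain ⟨g, rfl⟩ := h
  exact Set.Finite.image _ (Set.toFinite (S : Set G))

theorem AreConj.card_eq {S T : Subgroup G} (h : AreConj S T) : Nat.card T = Nat.card S := by
  obtain ⟨g, rfl⟩ := h
  exact Nat.card_congr ((S.equivMapOfInjective _ (MulAut.conj g).injective).symm.toEquiv)

theorem AreConj.normalizer {S T : Subgroup G} (h : AreConj S T) :
    AreConj (Subgroup.normalizer (S : Set G)) (Subgroup.normalizer (T : Set G)) := by
  obtain ⟨g, rfl⟩ := h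
  exact ⟨g, normalizer_conj g S⟩

theorem le_normalizer_of_conj_mem {N S : Subgroup G}
    (h : ∀ g ∈ N, ∀ x ∈ S, g * x * g⁻¹ ∈ S) : N ≤ Subgroup.normalizer (S : Set G) := by
  intro g hg
  rw [Subgroup.mem_normalizer_iff]
  refine fun x => ⟨fun hx => h g hg x hx, fun hx => ?_⟩
  have := h g⁻¹ (N.inv_mem hg) _ hx
  simpa [mul_assoc] using this

theorem conj_mem_of_mem_normalizer {S : Subgroup G} {g x : G}
    (hg : g ∈ Subgroup.normalizer (S : Set G)) (hx : x ∈ S) : g * x * g⁻¹ ∈ S :=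
  (Subgroup.mem_normalizer_iff.1 hg x).1 hx

/-- Unique factorization amounts to a trivial intersection plus existence of factorizations. All
complements below are checked in this elementwise form. -/
theorem isComplementIn_iff {N S H : Subgroup G} :
    IsComplementIn N S H ↔ S ≤ N ∧ H ≤ N ∧ (∀ x ∈ S, x ∈ H → x = 1) ∧
      ∀ n ∈ N, ∃ s ∈ S, ∃ h ∈ H, s * h = n := by
  refine and_congr_right fun hS => and_congr_right fun hH => ?_
  constructor
  · intro h
    constructor
    · intro x hxS hxH
      have := Subgroup.disjoint_def.1 h.disjoint (x := ⟨x, hS hxS⟩)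
        (Subgroup.mem_subgroupOf.2 hxS) (Subgroup.mem_subgroupOf.2 hxH)
      exact congrArg Subtype.val this
    · intro n hn
      obtain ⟨⟨s, t⟩, hst⟩ := h.2 ⟨n, hn⟩
      exact ⟨_, Subgroup.mem_subgroupOf.1 s.2, _, Subgroup.mem_subgroupOf.1 t.2,
        congrArg Subtype.val hst⟩
  · rintro ⟨h1, h2⟩
    refine Subgroup.isComplement'_of_disjoint_and_mul_eq_univ ?_ ?_
    · rw [Subgroup.disjoint_def]
      intro x hx hx'
      exact Subtype.ext (h1 _ (Subgroup.mem_subgroupOf.1 hx) (Subgroup.mem_subgroupOf.1 hx'))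
    · ext ⟨n, hn⟩
      simp only [Set.mem_univ, iff_true]
      obtain ⟨s, hs, t, ht, rfl⟩ := h2 n hn
      exact ⟨⟨s, hS hs⟩, Subgroup.mem_subgroupOf.2 hs, ⟨t, hH ht⟩, Subgroup.mem_subgroupOf.2 ht, rfl⟩

theorem IsComplementIn.conj {N S H : Subgroup G} (h : IsComplementIn N S H) (g : G) :
    IsComplementIn (conj g N) (conj g S) (conj g H) := by
  rw [isComplementIn_iff] at h ⊢
  obtain ⟨h1, h2, h3, h4⟩ := h
  refine ⟨conj_mono h1, conj_mono h2, ?_, ?_⟩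
  · intro x hx hx'
    have := h3 _ (mem_conj.1 hx) (mem_conj.1 hx')
    rw [mul_assoc, inv_mul_eq_one] at this
    exact mul_eq_right.1 this.symm
  · intro n hn
    obtain ⟨s, hs, t, ht, hst⟩ := h4 _ (mem_conj.1 hn)
    refine ⟨_, conj_mem_conj hs, _, conj_mem_conj ht, ?_⟩
    have : g * s * g⁻¹ * (g * t * g⁻¹) = g * (s * t) * g⁻¹ := by group
    rw [this, hst]
    group

end GroupTheory

/-- Take the stabilizer in N(S) of a point of B: freeness makes it meet S trivially, and
transitivity of S lets every n ∈ N(S) be corrected by an element of S so as to fix the point.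
Conversely the cosets nH with n ∈ N(S) form an ideal symmetry breaking set in G/H. -/
theorem admitsIdealSBS_iff.{u} {G : Type u} [Group G] (S : Subgroup G) :
    AdmitsIdealSBS S ↔ ∃ H, IsComplementIn (Subgroup.normalizer (S : Set G)) S H := by
  constructor
  · rintro ⟨X, _, B, ⟨⟨-, hfree⟩, heq⟩, ⟨x, hx⟩, htrans⟩
    refine ⟨MulAction.stabilizer G x ⊓ Subgroup.normalizer (S : Set G), ?_⟩
    rw [isComplementIn_iff]
    refine ⟨Subgroup.le_normalizer, inf_le_right, ?_, ?_⟩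
    · intro s hs hs'
      exact hfree s hs x hx hs'.1
    · intro n hn
      have hnx : n • x ∈ B := by
        rw [← heq n hn]
        exact ⟨x, hx, rfl⟩
      obtain ⟨s, hs, hsx⟩ := htrans x hx _ hnx
      refine ⟨s, hs, s⁻¹ * n, ⟨?_, ?_⟩, by group⟩
      · change (s⁻¹ * n) • x = x
        rw [mul_smul, ← hsx, inv_smul_smul]
      · exact Subgroup.mul_mem _ (Subgroup.inv_mem _ (Subgroup.le_normalizer hs)) hn
  · rintro ⟨H, hH⟩
    rw [isComplementIn_iff] at hH
    obtain ⟨h1, h2, h3, h4⟩ := hH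
    set N := Subgroup.normalizer (S : Set G) with hN
    refine ⟨G ⧸ H, inferInstance, {q | ∃ n ∈ N, q = (n : G ⧸ H)}, ⟨⟨?_, ?_⟩, ?_⟩, ?_, ?_⟩
    · rintro s hs _ ⟨n, hn, rfl⟩
      exact ⟨s * n, N.mul_mem (h1 hs) hn, rfl⟩
    · rintro s hs _ ⟨n, hn, rfl⟩ h
      have h' : ((s * n : G) : G ⧸ H) = (n : G ⧸ H) := h
      -- `s n H = n H` puts `n⁻¹ s n` in `H`. It also lies in `S`, because `n` normalizes `S`.
      rw [eq_comm, QuotientGroup.eq] at h'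
      have h5 : n⁻¹ * s * (n⁻¹)⁻¹ ∈ S := conj_mem_of_mem_normalizer (N.inv_mem hn) hs
      rw [inv_inv] at h5
      rw [← mul_assoc] at h'
      have := h3 _ h5 h'
      rw [mul_assoc, inv_mul_eq_one] at this
      exact mul_eq_right.1 this.symm
    · intro g hg
      ext q
      constructor
      · rintro ⟨_, ⟨n, hn, rfl⟩, rfl⟩
        exact ⟨g * n, N.mul_mem hg hn, rfl⟩
      · rintro ⟨n, hn, rfl⟩
        refine ⟨((g⁻¹ * n : G) : G ⧸ H), ⟨_, N.mul_mem (N.inv_mem hg) hn, rfl⟩, ?_⟩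
        change ((g * (g⁻¹ * n) : G) : G ⧸ H) = _
        rw [mul_inv_cancel_left]
    · exact ⟨((1 : G) : G ⧸ H), 1, N.one_mem, rfl⟩
    · rintro _ ⟨n, hn, rfl⟩ _ ⟨n', hn', rfl⟩
      -- Writing `n⁻¹ n' = s t`, the element `n s n⁻¹` of `S` carries `n H` to `n s H = n' H`.
      obtain ⟨s, hs, t, ht, hst⟩ := h4 _ (N.mul_mem (N.inv_mem hn) hn')
      refine ⟨n * s * n⁻¹, conj_mem_of_mem_normalizer hn hs, ?_⟩
      change ((n * s * n⁻¹ * n : G) : G ⧸ H) = _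
      rw [QuotientGroup.eq]
      have : (n * s * n⁻¹ * n)⁻¹ * n' = t := by
        have : n' = n * (s * t) := by rw [hst]; group
        rw [this]
        group
      rwa [this]

end PointGroup

namespace PointGroup

open Matrix

/-! ### The action of `O(3)` on vectors -/

noncomputable instance vecMulAction : MulAction O3 (Fin 3 → ℝ) where
  smul g v := g.1 *ᵥ v
  one_smul v := Matrix.one_mulVec v
  mul_smul g h v := (Matrix.mulVec_mulVec v g.1 h.1).symm

theorem vec_smul_def (g : O3) (v : Fin 3 → ℝ) : g • v = g.1 *ᵥ v := rfl

theorem vec_smul_add (g : O3) (v w : Fin 3 → ℝ) : g • (v + w) = g • v + g • w :=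
  Matrix.mulVec_add _ _ _

theorem vec_smul_neg (g : O3) (v : Fin 3 → ℝ) : g • (-v) = -(g • v) :=
  Matrix.mulVec_neg _ _

theorem vec_smul_smul (g : O3) (c : ℝ) (v : Fin 3 → ℝ) : g • (c • v) = c • (g • v) :=
  Matrix.mulVec_smul _ _ _

theorem transpose_mul_self (g : O3) : g.1ᵀ * g.1 = 1 :=
  (Matrix.mem_orthogonalGroup_iff' (Fin 3) ℝ).1 g.2

theorem mul_transpose_self (g : O3) : g.1 * g.1ᵀ = 1 :=
  (Matrix.mem_orthogonalGroup_iff (Fin 3) ℝ).1 g.2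

theorem dot_vec_smul (g : O3) (v w : Fin 3 → ℝ) : (g • v) ⬝ᵥ (g • w) = v ⬝ᵥ w := by
  rw [vec_smul_def, vec_smul_def, Matrix.dotProduct_mulVec, Matrix.vecMul_mulVec,
    transpose_mul_self, Matrix.vecMul_one]

theorem ext_vec_smul {g h : O3} (H : ∀ v : Fin 3 → ℝ, g • v = h • v) : g = h :=
  Subtype.ext (Matrix.ext_of_mulVec_single fun _ => H _)

theorem mem_SO3 {g : O3} : g ∈ SO3 ↔ g.1.det = 1 := Iff.rfl

theorem det_eq_or (g : O3) : g.1.det = 1 ∨ g.1.det = -1 := by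
  have h := congrArg Matrix.det (transpose_mul_self g)
  rw [Matrix.det_mul, Matrix.det_transpose, Matrix.det_one] at h
  exact mul_self_eq_one_iff.1 h

theorem det_mul (g h : O3) : (g * h).1.det = g.1.det * h.1.det :=
  Matrix.det_mul _ _

theorem inversion_val : (inversion : O3).1 = -1 := rfl

theorem inversion_smul (v : Fin 3 → ℝ) : inversion • v = -v := by
  rw [vec_smul_def, inversion_val, Matrix.neg_mulVec, Matrix.one_mulVec]

theorem inversion_mul_inversion : inversion * inversion = 1 := by
  apply ext_vec_smul
  simp [mul_smul, inversion_smul]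

theorem inversion_inv : inversion⁻¹ = inversion :=
  inv_eq_of_mul_eq_one_right inversion_mul_inversion

theorem inversion_comm (g : O3) : inversion * g = g * inversion := by
  apply ext_vec_smul
  simp [mul_smul, inversion_smul]

theorem inversion_conj (g : O3) : g * inversion * g⁻¹ = inversion := by
  rw [← inversion_comm, mul_inv_cancel_right]

theorem det_inversion : inversion.1.det = -1 := by
  rw [inversion_val, Matrix.det_neg]
  simp [Odd.neg_one_pow (by decide : Odd 3)]

theorem inversion_mul_mem_SO3 {g : O3} (hg : g ∉ SO3) : inversion * g ∈ SO3 := by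
  rw [mem_SO3, det_mul, det_inversion]
  rcases det_eq_or g with h | h
  · exact absurd h hg
  · simp [h]

theorem inversion_notMem_SO3 : inversion ∉ SO3 := by
  rw [mem_SO3, det_inversion]
  norm_num

theorem conj_mem_SO3 {g x : O3} : g * x * g⁻¹ ∈ SO3 ↔ x ∈ SO3 := by
  constructor
  · intro h
    have := (inferInstance : (MonoidHom.ker
      (Matrix.detMonoidHom.comp (Matrix.orthogonalGroup (Fin 3) ℝ).subtype)).Normal).conj_mem
      _ h g⁻¹
    simpa [mul_assoc, SO3] using this
  · exact fun h => (inferInstance : (MonoidHom.ker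
      (Matrix.detMonoidHom.comp (Matrix.orthogonalGroup (Fin 3) ℝ).subtype)).Normal).conj_mem
      _ h g

theorem conj_SO3 (g : O3) : conj g SO3 = SO3 := by
  ext x
  rw [mem_conj]
  simpa using conj_mem_SO3 (g := g⁻¹) (x := x)

theorem mem_Ci {g : O3} : g ∈ Ci ↔ g = 1 ∨ g = inversion := by
  constructor
  · intro h
    induction h using Subgroup.closure_induction with
    | mem x hx => exact Or.inr hx
    | one => exact Or.inl rfl
    | mul x y _ _ hx hy =>
      rcases hx with rfl | rfl <;> rcases hy with rfl | rfl <;> simp [inversion_mul_inversion]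
    | inv x _ hx => rcases hx with rfl | rfl <;> simp [inversion_inv]
  · rintro (rfl | rfl)
    · exact one_mem _
    · exact Subgroup.subset_closure rfl

/-! ### Fixed vectors of rotations -/

theorem dot_self_eq_zero {v : Fin 3 → ℝ} : v ⬝ᵥ v = 0 ↔ v = 0 := dotProduct_self_eq_zero

theorem eq_of_dot_eq_one {u v : Fin 3 → ℝ} (hu : u ⬝ᵥ u = 1) (hv : v ⬝ᵥ v = 1)
    (h : u ⬝ᵥ v = 1) : v = u := by
  have : (v - u) ⬝ᵥ (v - u) = 0 := by
    rw [sub_dotProduct, dotProduct_sub, dotProduct_sub, hu, hv, h, dotProduct_comm v u, h]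
    norm_num
  exact sub_eq_zero.1 (dot_self_eq_zero.1 this)

theorem eq_neg_of_dot_eq_neg_one {u v : Fin 3 → ℝ} (hu : u ⬝ᵥ u = 1) (hv : v ⬝ᵥ v = 1)
    (h : u ⬝ᵥ v = -1) : v = -u := by
  have := eq_of_dot_eq_one (u := u) (v := -v) hu (by simpa using hv) (by simp [h])
  rw [← this, neg_neg]

/-- Strict Cauchy–Schwarz from Lagrange's identity |u × v|² = 1 - (u · v)² for unit vectors. -/
theorem dot_sq_lt_one {u v : Fin 3 → ℝ} (hu : u ⬝ᵥ u = 1) (hv : v ⬝ᵥ v = 1)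
    (h1 : v ≠ u) (h2 : v ≠ -u) : (u ⬝ᵥ v) ^ 2 < 1 := by
  have h := cross_dot_cross u v u v
  rw [hu, hv, dotProduct_comm v u] at h
  have h0 : 0 ≤ (u ⨯₃ v) ⬝ᵥ (u ⨯₃ v) := by
    rw [dotProduct]
    exact Finset.sum_nonneg fun i _ => mul_self_nonneg _
  have h3 : (u ⬝ᵥ v) ^ 2 ≤ 1 := by nlinarith
  refine lt_of_le_of_ne h3 fun h4 => ?_
  rw [sq] at h4
  rcases mul_self_eq_one_iff.1 h4 with h5 | h5
  · exact h1 (eq_of_dot_eq_one hu hv h5)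
  · exact h2 (eq_neg_of_dot_eq_neg_one hu hv h5)

/-- The cofactor matrix of any M satisfies cof(M)(u × v) = Mu × Mv, a polynomial identity. A
rotation equals its own cofactor matrix, since its adjugate is its inverse and hence its transpose.
-/
theorem smul_cross {g : O3} (hg : g ∈ SO3) (u v : Fin 3 → ℝ) :
    g • (u ⨯₃ v) = (g • u) ⨯₃ (g • v) := by
  have hadj : g.1.adjugate = g.1ᵀ := by
    have h := Matrix.adjugate_mul g.1
    rw [mem_SO3.1 hg, one_smul] at h
    calc g.1.adjugate = g.1.adjugate * (g.1 * g.1ᵀ) := by rw [mul_transpose_self, mul_one]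
      _ = g.1ᵀ := by rw [← mul_assoc, h, one_mul]
  have h2 : g.1 = g.1.adjugateᵀ := by rw [hadj, Matrix.transpose_transpose]
  rw [vec_smul_def, vec_smul_def, vec_smul_def]
  conv_lhs => rw [h2]
  generalize g.1 = M
  rw [Matrix.adjugate_fin_three]
  ext i
  fin_cases i <;>
    simp [cross_apply, Matrix.mulVec, dotProduct, Fin.sum_univ_three] <;> ring

/-- The rotation also fixes u × v, and u, v, u × v form a basis: their determinant is |u × v|². -/
theorem eq_one_of_fixes_two {g : O3} (hg : g ∈ SO3) {u v : Fin 3 → ℝ} (hu : g • u = u)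
    (hv : g • v = v) (h : u ⨯₃ v ≠ 0) : g = 1 := by
  have hw : g • (u ⨯₃ v) = u ⨯₃ v := by rw [smul_cross hg, hu, hv]
  set w := u ⨯₃ v with hw'
  have hdet : (Matrix.of ![u, v, w]).det ≠ 0 := by
    have : (Matrix.of ![u, v, w]).det = w ⬝ᵥ w := by
      change Matrix.det ![u, v, w] = _
      rw [← triple_product_eq_det, triple_product_permutation, triple_product_permutation]
    rw [this]
    exact fun h0 => h (dot_self_eq_zero.1 h0)
  have hmul : (Matrix.of ![u, v, w]) * g.1ᵀ = Matrix.of ![u, v, w] := by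
    have hrow : ∀ i, g.1 *ᵥ (![u, v, w] i) = ![u, v, w] i := by
      intro i
      fin_cases i
      · exact hu
      · exact hv
      · exact hw
    ext i j
    have := congrFun (hrow i) j
    rw [Matrix.mul_apply_eq_vecMul, Matrix.vecMul_transpose]
    exact this
  have hunit : IsUnit (Matrix.of ![u, v, w]) := by
    rw [Matrix.isUnit_iff_isUnit_det]
    exact isUnit_iff_ne_zero.2 hdet
  have hT : g.1ᵀ = 1 := hunit.mul_left_cancel (by rw [hmul, mul_one])
  apply Subtype.ext
  rw [← Matrix.transpose_transpose g.1, hT]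
  simp

theorem eq_or_eq_neg_of_fixed {g : O3} (hg : g ∈ SO3) (h1 : g ≠ 1) {u v : Fin 3 → ℝ}
    (hu : u ⬝ᵥ u = 1) (hv : v ⬝ᵥ v = 1) (hgu : g • u = u) (hgv : g • v = v) :
    v = u ∨ v = -u := by
  by_contra! hne
  have h := dot_sq_lt_one hu hv hne.1 hne.2
  refine h1 (eq_one_of_fixes_two hg hgu hgv fun h0 => ?_)
  have h2 := cross_dot_cross u v u v
  rw [hu, hv, dotProduct_comm v u, h0, zero_dotProduct] at h2
  nlinarith

theorem exists_unit_smul {v : Fin 3 → ℝ} (hv : v ≠ 0) :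
    ∃ c : ℝ, c ≠ 0 ∧ (c • v) ⬝ᵥ (c • v) = 1 := by
  have h0 : 0 < v ⬝ᵥ v := by
    refine lt_of_le_of_ne ?_ fun h => hv (dot_self_eq_zero.1 h.symm)
    rw [dotProduct]
    exact Finset.sum_nonneg fun i _ => mul_self_nonneg _
  refine ⟨(Real.sqrt (v ⬝ᵥ v))⁻¹, by positivity, ?_⟩
  rw [smul_dotProduct, dotProduct_smul, smul_eq_mul, smul_eq_mul]
  have := Real.mul_self_sqrt h0.le
  have h1 : Real.sqrt (v ⬝ᵥ v) ≠ 0 := by positivity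
  field_simp
  nlinarith

/-- Euler's theorem. From g - 1 = g (1 - g)ᵀ and det g = 1 one gets det (g - 1) = det (1 - g) = -det
(g - 1), the dimension being odd. -/
theorem exists_fixed {g : O3} (hg : g ∈ SO3) : ∃ u : Fin 3 → ℝ, u ⬝ᵥ u = 1 ∧ g • u = u := by
  have hdet : (g.1 - 1).det = 0 := by
    have h : g.1 - 1 = g.1 * (-(g.1 - 1))ᵀ := by
      rw [Matrix.transpose_neg, Matrix.transpose_sub, Matrix.transpose_one, mul_neg, mul_sub,
        mul_transpose_self, mul_one, neg_sub]
    have h' := congrArg Matrix.det h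
    rw [Matrix.det_mul, Matrix.det_transpose, mem_SO3.1 hg, Matrix.det_neg] at h'
    simp [Odd.neg_one_pow (by decide : Odd 3)] at h'
    linarith
  obtain ⟨v, hv, hgv⟩ := Matrix.exists_mulVec_eq_zero_iff.2 hdet
  rw [Matrix.sub_mulVec, Matrix.one_mulVec, sub_eq_zero] at hgv
  obtain ⟨c, -, hc⟩ := exists_unit_smul hv
  exact ⟨c • v, hc, by rw [vec_smul_smul]; exact congrArg (c • ·) hgv⟩

/-! ### Orthonormal frames -/

theorem exists_unit_perp (u : Fin 3 → ℝ) :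
    ∃ f : Fin 3 → ℝ, f ⬝ᵥ f = 1 ∧ u ⬝ᵥ f = 0 := by
  by_cases h : u 0 = 0 ∧ u 1 = 0
  · refine ⟨![1, 0, 0], by simp [dotProduct, Fin.sum_univ_three], ?_⟩
    simp [dotProduct, Fin.sum_univ_three, h.1]
  · have h0 : (![-u 1, u 0, 0] : Fin 3 → ℝ) ≠ 0 := by
      intro h0
      have a := congrFun h0 0
      have b := congrFun h0 1
      simp at a b
      exact h ⟨b, a⟩
    obtain ⟨c, -, hc⟩ := exists_unit_smul h0
    refine ⟨_, hc, ?_⟩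
    simp [dotProduct, Fin.sum_univ_three]
    ring

/-- The third basis vector. -/
def e3 : Fin 3 → ℝ := ![0, 0, 1]

/-- The first basis vector. -/
def e1 : Fin 3 → ℝ := ![1, 0, 0]

theorem exists_frame {u f : Fin 3 → ℝ} (hu : u ⬝ᵥ u = 1) (hf : f ⬝ᵥ f = 1) (huf : u ⬝ᵥ f = 0) :
    ∃ k : O3, k • u = e3 ∧ k • f = e1 := by
  set w := u ⨯₃ f with hw
  have h1 : w ⬝ᵥ w = 1 := by
    rw [hw, cross_dot_cross, hu, hf, huf]
    simp
  have h2 : u ⬝ᵥ w = 0 := dot_self_cross _ _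
  have h3 : f ⬝ᵥ w = 0 := dot_cross_self _ _
  have hmem : Matrix.of ![f, w, u] ∈ Matrix.orthogonalGroup (Fin 3) ℝ := by
    rw [Matrix.mem_orthogonalGroup_iff]
    have : ∀ i j, (Matrix.of ![f, w, u] * (Matrix.of ![f, w, u])ᵀ) i j
        = (![f, w, u] i) ⬝ᵥ (![f, w, u] j) := fun i j => rfl
    ext i j
    rw [this]
    fin_cases i <;> fin_cases j <;> simp [hu, hf, huf, h1, h2, h3, dotProduct_comm f u,
      dotProduct_comm w u, dotProduct_comm w f]
  refine ⟨⟨_, hmem⟩, ?_, ?_⟩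
  · have : ∀ i, (Matrix.of ![f, w, u] *ᵥ u) i = (![f, w, u] i) ⬝ᵥ u := fun i => rfl
    rw [vec_smul_def]
    ext i
    rw [this]
    fin_cases i <;> simp [hu, huf, h2, dotProduct_comm f u, dotProduct_comm w u, e3]
  · have : ∀ i, (Matrix.of ![f, w, u] *ᵥ f) i = (![f, w, u] i) ⬝ᵥ f := fun i => rfl
    rw [vec_smul_def]
    ext i
    rw [this]
    fin_cases i <;> simp [hf, huf, h3, dotProduct_comm w f, e1]

/-- Two unit vectors can be moved into the `xz`-plane, the first one to the `z`-axis. -/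
theorem exists_frame_pair {u v : Fin 3 → ℝ} (hu : u ⬝ᵥ u = 1) (hv : v ⬝ᵥ v = 1)
    (h1 : v ≠ u) (h2 : v ≠ -u) : ∃ k : O3, k • u = e3 ∧
      k • v = ![Real.sqrt (1 - (u ⬝ᵥ v) ^ 2), 0, u ⬝ᵥ v] := by
  have hlt := dot_sq_lt_one hu hv h1 h2
  set c := u ⬝ᵥ v with hc
  set s := Real.sqrt (1 - c ^ 2) with hs
  have hs0 : 0 < s := Real.sqrt_pos.2 (by linarith)
  have hss : s * s = 1 - c ^ 2 := Real.mul_self_sqrt (by linarith)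
  obtain ⟨k, hk1, hk2⟩ := exists_frame (u := u) (f := s⁻¹ • (v - c • u)) hu
    (by
      simp only [smul_dotProduct, dotProduct_smul, sub_dotProduct, dotProduct_sub, hu, hv,
        smul_eq_mul, dotProduct_comm v u, ← hc]
      field_simp
      nlinarith)
    (by
      simp only [dotProduct_smul, dotProduct_sub, hu, smul_eq_mul, ← hc]
      ring)
  refine ⟨k, hk1, ?_⟩
  have hv' : v = s • (s⁻¹ • (v - c • u)) + c • u := by
    rw [smul_smul, mul_inv_cancel₀ hs0.ne', one_smul, sub_add_cancel]
  rw [hv', vec_smul_add, vec_smul_smul, hk2, vec_smul_smul, hk1]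
  ext i
  fin_cases i <;> simp [e1, e3]

end PointGroup

namespace PointGroup

open Matrix

/-! ### The elements of `D_{∞h}` -/

/-- The real number `±1` attached to a sign. -/
def sgnR (s : ℤˣ) : ℝ := ((s : ℤ) : ℝ)

@[simp] theorem sgnR_one : sgnR 1 = 1 := by simp [sgnR]

@[simp] theorem sgnR_neg_one : sgnR (-1) = -1 := by simp [sgnR]

theorem sgnR_mul (s t : ℤˣ) : sgnR (s * t) = sgnR s * sgnR t := by simp [sgnR]

theorem sgnR_mul_self (s : ℤˣ) : sgnR s * sgnR s = 1 := by
  rcases Int.units_eq_one_or s with rfl | rfl <;> simp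

theorem sgnR_injective : Function.Injective sgnR := by
  intro s t h
  exact Units.ext (Int.cast_injective (α := ℝ) h)

theorem re_sq_add_im_sq (z : Circle) :
    (z : ℂ).re * (z : ℂ).re + (z : ℂ).im * (z : ℂ).im = 1 := by
  rw [← Complex.normSq_apply, Circle.normSq_coe]

/-- The reflection `diag(1, s, t)` followed by the rotation `z` about the `z`-axis. -/
noncomputable def dih (z : Circle) (s t : ℤˣ) : O3 :=
  ⟨!![(z : ℂ).re, -(sgnR s * (z : ℂ).im), 0; (z : ℂ).im, sgnR s * (z : ℂ).re, 0;
    0, 0, sgnR t], by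
    have h := re_sq_add_im_sq z
    have hs := sgnR_mul_self s
    have ht := sgnR_mul_self t
    rw [Matrix.mem_orthogonalGroup_iff]
    ext i j
    fin_cases i <;> fin_cases j <;> simp [Matrix.mul_apply, Fin.sum_univ_three] <;> grind⟩

theorem dih_val (z : Circle) (s t : ℤˣ) : (dih z s t).1 =
    !![(z : ℂ).re, -(sgnR s * (z : ℂ).im), 0; (z : ℂ).im, sgnR s * (z : ℂ).re, 0;
      0, 0, sgnR t] := rfl

/-- The sign `s` acts on the circle by inversion, while `t` acts trivially. All computations with
axial groups reduce to this rule. -/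
theorem dih_mul (z w : Circle) (s t s' t' : ℤˣ) :
    dih z s t * dih w s' t' = dih (z * w ^ (s : ℤ)) (s * s') (t * t') := by
  apply Subtype.ext
  rw [Submonoid.coe_mul, dih_val, dih_val, dih_val, sgnR_mul, sgnR_mul]
  rcases Int.units_eq_one_or s with rfl | rfl
  · ext i j
    fin_cases i <;> fin_cases j <;> simp [Matrix.mul_apply, Fin.sum_univ_three] <;> ring
  · have h1 : ((w⁻¹ : Circle) : ℂ).re = (w : ℂ).re := by
      rw [Circle.coe_inv_eq_conj, Complex.conj_re]
    have h2 : ((w⁻¹ : Circle) : ℂ).im = -(w : ℂ).im := by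
      rw [Circle.coe_inv_eq_conj, Complex.conj_im]
    have h3 : w ^ (((-1 : ℤˣ) : ℤ)) = w⁻¹ := by simp
    rw [h3, Circle.coe_mul]
    ext i j
    fin_cases i <;> fin_cases j <;>
      simp [Matrix.mul_apply, Fin.sum_univ_three, h1, h2, -Circle.coe_inv] <;> ring

theorem dih_mul_rot (z w : Circle) (s t : ℤˣ) : dih z 1 1 * dih w s t = dih (z * w) s t := by
  simp [dih_mul]

theorem dih_one : dih 1 1 1 = 1 := by
  apply Subtype.ext
  rw [dih_val]
  ext i j
  fin_cases i <;> fin_cases j <;> simp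

theorem dih_inv (z : Circle) (s t : ℤˣ) : (dih z s t)⁻¹ = dih (z ^ (-(s : ℤ))) s t := by
  refine inv_eq_of_mul_eq_one_right ?_
  rw [dih_mul, ← _root_.zpow_mul, ← dih_one]
  rcases Int.units_eq_one_or s with rfl | rfl <;> rcases Int.units_eq_one_or t with rfl | rfl <;>
    simp

theorem dih_inj {z w : Circle} {s t s' t' : ℤˣ} (h : dih z s t = dih w s' t') :
    z = w ∧ s = s' ∧ t = t' := by
  have h' := congrArg Subtype.val h
  rw [dih_val, dih_val] at h'
  have h00 := congrFun (congrFun h' 0) 0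
  have h10 := congrFun (congrFun h' 1) 0
  have h01 := congrFun (congrFun h' 0) 1
  have h11 := congrFun (congrFun h' 1) 1
  have h22 := congrFun (congrFun h' 2) 2
  simp only [Matrix.of_apply, Matrix.cons_val', Matrix.cons_val_zero, Matrix.cons_val_one,
    Matrix.cons_val] at h00 h10 h01 h11 h22
  have hz : z = w := Circle.ext (Complex.ext h00 h10)
  subst hz
  refine ⟨rfl, sgnR_injective ?_, sgnR_injective h22⟩
  linear_combination (sgnR s' - sgnR s) * re_sq_add_im_sq z + (z : ℂ).re * h11
    - (z : ℂ).im * h01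

/-- The signs of the conjugated element are unchanged. If `s' = 1` the factor `w` cancels, and if
`s' = -1` it enters as `w ^ 2`. This is why normalizers of groups with reflections or two-fold axes
have twice as many rotations. -/
theorem dih_conj (z w : Circle) (s t s' t' : ℤˣ) :
    dih w s t * dih z s' t' * (dih w s t)⁻¹ =
      dih (w * z ^ (s : ℤ) * w ^ (-(s' : ℤ))) s' t' := by
  rw [dih_inv, dih_mul, dih_mul]
  rcases Int.units_eq_one_or s with rfl | rfl <;> rcases Int.units_eq_one_or t with rfl | rfl <;>
    rcases Int.units_eq_one_or s' with rfl | rfl <;>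
    simp

theorem dih_rot_pow (z : Circle) (k : ℕ) : dih z 1 1 ^ k = dih (z ^ k) 1 1 := by
  induction k with
  | zero => simp [dih_one]
  | succ k ih => rw [pow_succ, ih, dih_mul_rot, pow_succ]

theorem dih_refl_mul_self (z : Circle) (t : ℤˣ) : dih z (-1) t * dih z (-1) t = 1 := by
  rw [dih_mul, ← dih_one]
  simp

theorem dih_rot_mul_self (z : Circle) (t : ℤˣ) :
    dih z 1 t * dih z 1 t = dih (z ^ 2) 1 1 := by
  rw [dih_mul]
  simp [sq]

theorem det_dih (z : Circle) (s t : ℤˣ) : (dih z s t).1.det = sgnR s * sgnR t := by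
  rw [dih_val, Matrix.det_fin_three]
  simp
  linear_combination sgnR s * sgnR t * re_sq_add_im_sq z

theorem dih_mem_SO3 {z : Circle} {s t : ℤˣ} : dih z s t ∈ SO3 ↔ s = t := by
  rw [mem_SO3, det_dih]
  rcases Int.units_eq_one_or s with rfl | rfl <;> rcases Int.units_eq_one_or t with rfl | rfl <;>
    norm_num

theorem dih_smul_e3 (z : Circle) (s t : ℤˣ) : dih z s t • e3 = sgnR t • e3 := by
  rw [vec_smul_def, dih_val, e3]
  ext i
  fin_cases i <;> simp [Matrix.mulVec, dotProduct, Fin.sum_univ_three]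

theorem e3_dot_e3 : e3 ⬝ᵥ e3 = 1 := by simp [e3, dotProduct, Fin.sum_univ_three]

/-- The third column is ±e₃, and orthogonality to the other columns clears the third row. The
remaining 2 × 2 block is orthogonal: its first column is the point z of the circle and its
determinant is s. -/
theorem exists_dih {g : O3} (h : g • e3 = e3 ∨ g • e3 = -e3) : ∃ z s t, g = dih z s t := by
  obtain ⟨t, ht⟩ : ∃ t : ℤˣ, g • e3 = sgnR t • e3 := by
    rcases h with h | h
    · exact ⟨1, by simp [h]⟩
    · exact ⟨-1, by simp [h]⟩
  have hcol : ∀ i, g.1 i 2 = (sgnR t • e3) i := by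
    intro i
    rw [← ht, vec_smul_def]
    simp [Matrix.mulVec, dotProduct, Fin.sum_univ_three, e3]
  have h02 : g.1 0 2 = 0 := by simpa [e3] using hcol 0
  have h12 : g.1 1 2 = 0 := by simpa [e3] using hcol 1
  have h22 : g.1 2 2 = sgnR t := by simpa [e3] using hcol 2
  have hT := transpose_mul_self g
  have hc : ∀ i j, g.1 0 i * g.1 0 j + g.1 1 i * g.1 1 j + g.1 2 i * g.1 2 j
      = (1 : Matrix (Fin 3) (Fin 3) ℝ) i j := by
    intro i j
    rw [← hT]
    simp [Matrix.mul_apply, Fin.sum_univ_three]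
  have ht1 := sgnR_mul_self t
  have h20 : g.1 2 0 = 0 := by
    have := hc 0 2
    simp [h02, h12, h22] at this
    rcases this with h | h
    · exact h
    · rw [h] at ht1; norm_num at ht1
  have h21 : g.1 2 1 = 0 := by
    have := hc 1 2
    simp [h02, h12, h22] at this
    rcases this with h | h
    · exact h
    · rw [h] at ht1; norm_num at ht1
  have c00 := hc 0 0
  have c01 := hc 0 1
  have c11 := hc 1 1
  simp [h20, h21] at c00 c01 c11
  set a := g.1 0 0
  set b := g.1 1 0
  set c := g.1 0 1
  set d := g.1 1 1
  have hdet : (a * d - b * c) * (a * d - b * c) = 1 := by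
    linear_combination c11 * (a * a + b * b) + c00 - c01 * (a * c + b * d)
  obtain ⟨s, hs⟩ : ∃ s : ℤˣ, sgnR s = a * d - b * c := by
    rcases mul_self_eq_one_iff.1 hdet with h | h
    · exact ⟨1, by simp [h]⟩
    · exact ⟨-1, by simp [h]⟩
  have hd : d = sgnR s * a := by
    rw [hs]
    linear_combination (-d) * c00 + b * c01
  have hcc : c = -(sgnR s * b) := by
    rw [hs]
    linear_combination (-c) * c00 + a * c01
  obtain ⟨z, hz⟩ : ∃ z : Circle, (z : ℂ) = ⟨a, b⟩ := by
    refine ⟨Circle.exp (Complex.arg ⟨a, b⟩), ?_⟩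
    have hn : ‖(⟨a, b⟩ : ℂ)‖ = 1 := by
      rw [← sq_eq_sq₀ (norm_nonneg _) zero_le_one, ← Complex.normSq_eq_norm_sq,
        Complex.normSq_apply]
      simpa using c00
    have := Complex.norm_mul_exp_arg_mul_I ⟨a, b⟩
    rwa [hn, Complex.ofReal_one, one_mul] at this
  refine ⟨z, s, t, Subtype.ext ?_⟩
  rw [dih_val, hz]
  ext i j
  fin_cases i <;> fin_cases j <;> simp [h02, h12, h22, h20, h21]
  · rfl
  · exact hcc
  · rfl
  · exact hd

theorem rotZ_eq (θ : ℝ) : rotZ θ = dih (Circle.exp θ) 1 1 := by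
  apply Subtype.ext
  rw [dih_val, Circle.coe_exp, Complex.exp_ofReal_mul_I_re, Complex.exp_ofReal_mul_I_im]
  simp [rotZ]

theorem rotX_pi_eq : rotX Real.pi = dih 1 (-1) (-1) := by
  apply Subtype.ext
  rw [dih_val]
  simp [rotX]

theorem reflXY_eq : reflXY = dih 1 1 (-1) := by
  apply Subtype.ext
  rw [dih_val]
  simp [reflXY]

theorem reflXZ_eq : reflXZ = dih 1 (-1) 1 := by
  apply Subtype.ext
  rw [dih_val]
  simp [reflXZ]

theorem reflYZ_eq : reflYZ = dih (-1) (-1) 1 := by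
  apply Subtype.ext
  rw [dih_val]
  simp [reflYZ]

theorem inversion_eq : inversion = dih (-1) 1 (-1) := by
  apply Subtype.ext
  rw [dih_val, inversion_val]
  ext i j
  fin_cases i <;> fin_cases j <;> simp

theorem mem_Dinfh {g : O3} : g ∈ Dinfh ↔ ∃ z s t, g = dih z s t := by
  constructor
  · intro h
    induction h using Subgroup.closure_induction with
    | mem x hx =>
      rcases hx with ⟨θ, rfl⟩ | rfl | rfl
      · exact ⟨_, _, _, rotZ_eq θ⟩
      · exact ⟨_, _, _, rotX_pi_eq⟩
      · exact ⟨_, _, _, reflXY_eq⟩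
    | one => exact ⟨_, _, _, dih_one.symm⟩
    | mul x y _ _ hx hy =>
      obtain ⟨z, s, t, rfl⟩ := hx
      obtain ⟨w, s', t', rfl⟩ := hy
      exact ⟨_, _, _, dih_mul _ _ _ _ _ _⟩
    | inv x _ hx =>
      obtain ⟨z, s, t, rfl⟩ := hx
      exact ⟨_, _, _, dih_inv _ _ _⟩
  · rintro ⟨z, s, t, rfl⟩
    have hz : dih z 1 1 ∈ Dinfh := by
      rw [← Circle.exp_arg z, ← rotZ_eq]
      exact Subgroup.subset_closure (Or.inl ⟨_, rfl⟩)
    have hb : dih 1 (-1) (-1) ∈ Dinfh := by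
      rw [← rotX_pi_eq]
      exact Subgroup.subset_closure (Or.inr (Or.inl rfl))
    have hm : dih 1 1 (-1) ∈ Dinfh := by
      rw [← reflXY_eq]
      exact Subgroup.subset_closure (Or.inr (Or.inr rfl))
    rcases Int.units_eq_one_or s with rfl | rfl <;> rcases Int.units_eq_one_or t with rfl | rfl
    · exact hz
    · simpa [dih_mul] using mul_mem hz hm
    · simpa [dih_mul] using mul_mem hz (mul_mem hb hm)
    · simpa [dih_mul] using mul_mem hz hb

theorem mem_Dinfh_iff_smul {g : O3} : g ∈ Dinfh ↔ g • e3 = e3 ∨ g • e3 = -e3 := by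
  rw [mem_Dinfh]
  refine ⟨?_, exists_dih⟩
  rintro ⟨z, s, t, rfl⟩
  rw [dih_smul_e3]
  rcases Int.units_eq_one_or t with rfl | rfl <;> simp

/-- The vector g e₃ is fixed by the nontrivial rotation `dih w 1 1`, so it lies on the axis of that
rotation, which is the z-axis. -/
theorem mem_Dinfh_of_conj {g : O3} {z w : Circle} (hw : w ≠ 1)
    (h : g * dih z 1 1 * g⁻¹ = dih w 1 1) : g ∈ Dinfh := by
  rw [mem_Dinfh_iff_smul]
  refine eq_or_eq_neg_of_fixed (g := dih w 1 1) (dih_mem_SO3.2 rfl) ?_ e3_dot_e3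
    (by rw [dot_vec_smul, e3_dot_e3]) (by rw [dih_smul_e3]; simp) ?_
  · rw [← dih_one]
    exact fun h => hw (dih_inj h).1
  · rw [← h, mul_smul, mul_smul, inv_smul_smul, dih_smul_e3]
    simp

end PointGroup

namespace PointGroup

/-! ### Axial groups -/

/-- A sign as an element of the unit circle. -/
noncomputable def sgnC : ℤˣ →* Circle where
  toFun s := if s = 1 then 1 else -1
  map_one' := by simp
  map_mul' s t := by
    rcases Int.units_eq_one_or s with rfl | rfl <;> rcases Int.units_eq_one_or t with rfl | rfl <;>
      simp

@[simp] theorem sgnC_neg_one : sgnC (-1) = -1 := by simp [sgnC]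

theorem sgnC_mul_self (s : ℤˣ) : sgnC s * sgnC s = 1 := by
  rcases Int.units_eq_one_or s with rfl | rfl <;> simp

theorem sgnC_inv (s : ℤˣ) : (sgnC s)⁻¹ = sgnC s :=
  inv_eq_of_mul_eq_one_left (sgnC_mul_self s)

theorem sgnC_zpow (s u : ℤˣ) : sgnC s ^ (u : ℤ) = sgnC s := by
  rcases Int.units_eq_one_or u with rfl | rfl <;> simp [sgnC_inv]

theorem circle_neg_one_ne_one : (-1 : Circle) ≠ 1 := Circle.neg_ne_self 1

theorem zpow_pow_comm (z : Circle) (k : ℤ) (n : ℕ) : (z ^ k) ^ n = (z ^ n) ^ k := by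
  rw [← zpow_natCast, ← zpow_natCast, zpow_comm]

/-- The group of all `dih z s t` with `(s, t) ∈ Q` and `z ^ n = χ (s, t)`. -/
noncomputable def axial (n : ℕ) (Q : Subgroup (ℤˣ × ℤˣ)) (χ : ℤˣ × ℤˣ →* ℤˣ) : Subgroup O3 where
  carrier := {g | ∃ z s t, g = dih z s t ∧ (s, t) ∈ Q ∧ z ^ n = sgnC (χ (s, t))}
  one_mem' := ⟨1, 1, 1, dih_one.symm, Q.one_mem, by
    rw [show ((1 : ℤˣ), (1 : ℤˣ)) = 1 from rfl, map_one, map_one, one_pow]⟩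
  mul_mem' := by
    rintro _ _ ⟨z, s, t, rfl, hQ, hz⟩ ⟨w, s', t', rfl, hQ', hw⟩
    refine ⟨_, _, _, dih_mul _ _ _ _ _ _, Q.mul_mem hQ hQ', ?_⟩
    rw [mul_pow, zpow_pow_comm, hz, hw, sgnC_zpow, ← map_mul, ← map_mul]
    rfl
  inv_mem' := by
    rintro _ ⟨z, s, t, rfl, hQ, hz⟩
    refine ⟨_, _, _, dih_inv _ _ _, hQ, ?_⟩
    rw [zpow_pow_comm, hz, zpow_neg, sgnC_zpow, sgnC_inv]

theorem dih_mem_axial {n : ℕ} {Q : Subgroup (ℤˣ × ℤˣ)} {χ : ℤˣ × ℤˣ →* ℤˣ} {z : Circle}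
    {s t : ℤˣ} : dih z s t ∈ axial n Q χ ↔ (s, t) ∈ Q ∧ z ^ n = sgnC (χ (s, t)) := by
  constructor
  · rintro ⟨w, s', t', h, hQ, hw⟩
    obtain ⟨rfl, rfl, rfl⟩ := dih_inj h
    exact ⟨hQ, hw⟩
  · exact fun h => ⟨z, s, t, rfl, h.1, h.2⟩

theorem axial_le_Dinfh (n : ℕ) (Q : Subgroup (ℤˣ × ℤˣ)) (χ : ℤˣ × ℤˣ →* ℤˣ) :
    axial n Q χ ≤ Dinfh := by
  rintro _ ⟨z, s, t, rfl, -⟩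
  exact mem_Dinfh.2 ⟨z, s, t, rfl⟩

theorem exp_primitive (n : ℕ) (hn : n ≠ 0) (z : Circle) (hz : z ^ n = 1) :
    ∃ k : ℕ, z = Circle.exp (2 * Real.pi / n) ^ k := by
  have : NeZero n := ⟨hn⟩
  obtain ⟨k, -, hk⟩ := (Complex.isPrimitiveRoot_exp n hn).eq_pow_of_pow_eq_one
    (ξ := (z : ℂ)) (by rw [← Circle.coe_pow, hz, Circle.coe_one])
  refine ⟨k, Circle.ext ?_⟩
  rw [← hk, Circle.coe_pow, Circle.coe_exp]
  congr 2
  push_cast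
  ring

theorem exp_pow_eq_one (n : ℕ) (hn : n ≠ 0) : Circle.exp (2 * Real.pi / n) ^ n = 1 := by
  rw [← Circle.exp_natCast_mul, mul_div_cancel₀ _ (by exact_mod_cast hn), Circle.exp_two_pi]

theorem exp_pi : Circle.exp Real.pi = -1 := by
  apply Circle.ext
  rw [Circle.coe_exp, Complex.exp_pi_mul_I]
  simp

theorem exp_half_pow (n : ℕ) (hn : n ≠ 0) : Circle.exp (Real.pi / n) ^ n = -1 := by
  rw [← Circle.exp_natCast_mul, mul_div_cancel₀ _ (by exact_mod_cast hn), exp_pi]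

theorem exp_half_sq (n : ℕ) : Circle.exp (Real.pi / n) ^ 2 = Circle.exp (2 * Real.pi / n) := by
  rw [← Circle.exp_natCast_mul]
  congr 1
  push_cast
  ring

theorem exp_ne_one (n : ℕ) (hn : 2 ≤ n) : Circle.exp (2 * Real.pi / n) ≠ 1 := by
  intro h
  have h' := congrArg (fun z : Circle => (z : ℂ)) h
  have hp := (Complex.isPrimitiveRoot_exp n (by omega)).ne_one (by omega)
  apply hp
  rw [← Circle.coe_one, ← h, Circle.coe_exp]
  congr 1
  push_cast
  ring

theorem exp_sq_ne_one (n : ℕ) (hn : 3 ≤ n) : Circle.exp (2 * Real.pi / n) ^ 2 ≠ 1 := by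
  intro h
  have hp := Complex.isPrimitiveRoot_exp n (by omega)
  have : Complex.exp (2 * Real.pi * Complex.I / n) ^ 2 = 1 := by
    rw [← Circle.coe_one, ← h, Circle.coe_pow, Circle.coe_exp]
    congr 2
    push_cast
    ring
  have := Nat.le_of_dvd (by norm_num) (hp.dvd_of_pow_eq_one 2 this)
  omega

/-- Two elements with the same signs differ by a rotation with z ^ n = 1. So the basic rotation and
one representative for each sign pair generate the group. -/
theorem axial_le {n : ℕ} (hn : n ≠ 0) {Q : Subgroup (ℤˣ × ℤˣ)} {χ : ℤˣ × ℤˣ →* ℤˣ}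
    {K : Subgroup O3} (h1 : rotZ (2 * Real.pi / n) ∈ K)
    (h2 : ∀ s t, (s, t) ∈ Q → ∃ z, z ^ n = sgnC (χ (s, t)) ∧ dih z s t ∈ K) :
    axial n Q χ ≤ K := by
  rintro _ ⟨z, s, t, rfl, hQ, hz⟩
  obtain ⟨w, hw, hK⟩ := h2 s t hQ
  obtain ⟨k, hk⟩ := exp_primitive n hn (z * w⁻¹) (by rw [mul_pow, inv_pow, hz, hw, mul_inv_cancel])
  have : dih z s t = rotZ (2 * Real.pi / n) ^ k * dih w s t := by
    rw [rotZ_eq, dih_rot_pow, ← hk, dih_mul_rot, inv_mul_cancel_right]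
  rw [this]
  exact mul_mem (pow_mem h1 k) hK

/-- The signs of rotations about the axis and of reflections across the horizontal plane. -/
def Qh : Subgroup (ℤˣ × ℤˣ) := (MonoidHom.fst ℤˣ ℤˣ).ker

/-- The signs of rotations. -/
def Qd : Subgroup (ℤˣ × ℤˣ) := (MonoidHom.fst ℤˣ ℤˣ).eqLocus (MonoidHom.snd ℤˣ ℤˣ)

/-- The signs of elements that fix the axis pointwise. -/
def Qv : Subgroup (ℤˣ × ℤˣ) := (MonoidHom.snd ℤˣ ℤˣ).ker

@[simp] theorem mem_Qh {s t : ℤˣ} : (s, t) ∈ Qh ↔ s = 1 := Iff.rfl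

@[simp] theorem mem_Qd {s t : ℤˣ} : (s, t) ∈ Qd ↔ s = t := Iff.rfl

@[simp] theorem mem_Qv {s t : ℤˣ} : (s, t) ∈ Qv ↔ t = 1 := Iff.rfl

theorem mem_Qbot {s t : ℤˣ} : (s, t) ∈ (⊥ : Subgroup (ℤˣ × ℤˣ)) ↔ s = 1 ∧ t = 1 := by
  rw [Subgroup.mem_bot, Prod.mk_eq_one]

/-! ### The Schoenflies groups with an axis in the form `axial n Q χ`. -/

theorem Cn_eq {n : ℕ} (hn : n ≠ 0) : Cn n = axial n ⊥ 1 := by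
  apply le_antisymm
  · rw [Cn, Subgroup.closure_le]
    rintro _ rfl
    rw [rotZ_eq, SetLike.mem_coe, dih_mem_axial]
    simpa [mem_Qbot] using exp_pow_eq_one n hn
  · refine axial_le hn (Subgroup.subset_closure rfl) ?_
    intro s t h
    obtain ⟨rfl, rfl⟩ := mem_Qbot.1 h
    exact ⟨1, by simp, by rw [dih_one]; exact one_mem _⟩

theorem Cnh_eq {n : ℕ} (hn : n ≠ 0) : Cnh n = axial n Qh 1 := by
  apply le_antisymm
  · rw [Cnh, Subgroup.closure_le]
    rintro _ (rfl | rfl)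
    · rw [rotZ_eq, SetLike.mem_coe, dih_mem_axial]
      simpa using exp_pow_eq_one n hn
    · rw [reflXY_eq, SetLike.mem_coe, dih_mem_axial]
      simp
  · refine axial_le hn (Subgroup.subset_closure (Or.inl rfl)) ?_
    rintro s t rfl
    refine ⟨1, by simp, ?_⟩
    rcases Int.units_eq_one_or t with rfl | rfl
    · rw [dih_one]; exact one_mem _
    · rw [← reflXY_eq]; exact Subgroup.subset_closure (Or.inr rfl)

theorem rotZ_half_sq (n : ℕ) : rotZ (Real.pi / n) ^ 2 = rotZ (2 * Real.pi / n) := by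
  rw [rotZ_eq, rotZ_eq, dih_rot_pow, exp_half_sq]

theorem rotZ_half_mul_reflXY (n : ℕ) :
    rotZ (Real.pi / n) * reflXY = dih (Circle.exp (Real.pi / n)) 1 (-1) := by
  rw [rotZ_eq, reflXY_eq, dih_mul_rot, mul_one]

theorem rotZ_half_mul_reflXY_sq (n : ℕ) :
    (rotZ (Real.pi / n) * reflXY) * (rotZ (Real.pi / n) * reflXY) = rotZ (2 * Real.pi / n) := by
  rw [rotZ_half_mul_reflXY, dih_rot_mul_self, exp_half_sq, rotZ_eq]

theorem S2n_eq {n : ℕ} (hn : n ≠ 0) : S2n n = axial n Qh (MonoidHom.snd ℤˣ ℤˣ) := by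
  have hg : rotZ (Real.pi / n) * reflXY ∈ S2n n := Subgroup.subset_closure rfl
  apply le_antisymm
  · rw [S2n, Subgroup.closure_le]
    rintro _ rfl
    rw [rotZ_half_mul_reflXY, SetLike.mem_coe, dih_mem_axial]
    simpa using exp_half_pow n hn
  · refine axial_le hn ?_ ?_
    · rw [← rotZ_half_mul_reflXY_sq]
      exact mul_mem hg hg
    · rintro s t rfl
      rcases Int.units_eq_one_or t with rfl | rfl
      · exact ⟨1, by simp, by rw [dih_one]; exact one_mem _⟩
      · refine ⟨_, ?_, by rw [← rotZ_half_mul_reflXY]; exact hg⟩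
        simpa using exp_half_pow n hn

theorem Dn_eq {n : ℕ} (hn : n ≠ 0) : Dn n = axial n Qd 1 := by
  apply le_antisymm
  · rw [Dn, Subgroup.closure_le]
    rintro _ (rfl | rfl)
    · rw [rotZ_eq, SetLike.mem_coe, dih_mem_axial]
      simpa using exp_pow_eq_one n hn
    · rw [rotX_pi_eq, SetLike.mem_coe, dih_mem_axial]
      simp
  · refine axial_le hn (Subgroup.subset_closure (Or.inl rfl)) ?_
    intro s t h
    obtain rfl : s = t := h
    refine ⟨1, by simp, ?_⟩
    rcases Int.units_eq_one_or s with rfl | rfl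
    · rw [dih_one]; exact one_mem _
    · rw [← rotX_pi_eq]; exact Subgroup.subset_closure (Or.inr rfl)

theorem Dnh_eq {n : ℕ} (hn : n ≠ 0) : Dnh n = axial n ⊤ 1 := by
  have hb : dih 1 (-1) (-1) ∈ Dnh n := by
    rw [← rotX_pi_eq]; exact Subgroup.subset_closure (Or.inr (Or.inl rfl))
  have hm : dih 1 1 (-1) ∈ Dnh n := by
    rw [← reflXY_eq]; exact Subgroup.subset_closure (Or.inr (Or.inr rfl))
  apply le_antisymm
  · rw [Dnh, Subgroup.closure_le]
    rintro _ (rfl | rfl | rfl)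
    · rw [rotZ_eq, SetLike.mem_coe, dih_mem_axial]
      simpa using exp_pow_eq_one n hn
    · rw [rotX_pi_eq, SetLike.mem_coe, dih_mem_axial]
      simp
    · rw [reflXY_eq, SetLike.mem_coe, dih_mem_axial]
      simp
  · refine axial_le hn (Subgroup.subset_closure (Or.inl rfl)) ?_
    intro s t _
    refine ⟨1, by simp, ?_⟩
    rcases Int.units_eq_one_or s with rfl | rfl <;> rcases Int.units_eq_one_or t with rfl | rfl
    · rw [dih_one]; exact one_mem _
    · exact hm
    · simpa [dih_mul] using mul_mem hb hm
    · exact hb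

/-! The groups of the table with normalizer `D_{(2n)h}`, generated by elements of the latter -/

theorem aD_sq (n : ℕ) : aD n ^ 2 = rotZ (2 * Real.pi / n) := rotZ_half_sq n

theorem aD_eq (n : ℕ) : aD n = dih (Circle.exp (Real.pi / n)) 1 1 := rotZ_eq _

theorem bD_eq : bD = dih 1 (-1) (-1) := rotX_pi_eq

theorem mD_eq : mD = dih 1 (-1) 1 := reflXZ_eq

theorem bD_mul_mD : bD * mD = dih 1 1 (-1) := by
  rw [bD_eq, mD_eq, dih_mul]
  simp

theorem aD_mul_mD (n : ℕ) : aD n * mD = dih (Circle.exp (Real.pi / n)) (-1) 1 := by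
  rw [aD_eq, mD_eq, dih_mul_rot, mul_one]

theorem aD_mul_bD_mul_mD (n : ℕ) : aD n * bD * mD = dih (Circle.exp (Real.pi / n)) 1 (-1) := by
  rw [mul_assoc, bD_mul_mD, aD_eq, dih_mul_rot, mul_one]

theorem closure_Cnv {n : ℕ} (hn : n ≠ 0) : Subgroup.closure {aD n ^ 2, mD} = axial n Qv 1 := by
  apply le_antisymm
  · rw [Subgroup.closure_le]
    rintro _ (rfl | rfl)
    · rw [aD_sq, rotZ_eq, SetLike.mem_coe, dih_mem_axial]
      simpa using exp_pow_eq_one n hn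
    · rw [mD_eq, SetLike.mem_coe, dih_mem_axial]
      simp
  · refine axial_le hn (Subgroup.subset_closure (Or.inl (aD_sq n).symm)) ?_
    rintro s t rfl
    refine ⟨1, by simp, ?_⟩
    rcases Int.units_eq_one_or s with rfl | rfl
    · rw [dih_one]; exact one_mem _
    · rw [← mD_eq]; exact Subgroup.subset_closure (Or.inr rfl)

theorem closure_Dnd {n : ℕ} (hn : n ≠ 0) :
    Subgroup.closure {aD n ^ 2, aD n * bD * mD, mD} = axial n ⊤ (MonoidHom.snd ℤˣ ℤˣ) := by
  apply le_antisymm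
  · rw [Subgroup.closure_le]
    rintro _ (rfl | rfl | rfl)
    · rw [aD_sq, rotZ_eq, SetLike.mem_coe, dih_mem_axial]
      simpa using exp_pow_eq_one n hn
    · rw [aD_mul_bD_mul_mD, SetLike.mem_coe, dih_mem_axial]
      simpa using exp_half_pow n hn
    · rw [mD_eq, SetLike.mem_coe, dih_mem_axial]
      simp
  · have hg : dih (Circle.exp (Real.pi / n)) 1 (-1) ∈ Subgroup.closure {aD n ^ 2, aD n * bD * mD, mD} := by
      rw [← aD_mul_bD_mul_mD]; exact Subgroup.subset_closure (Or.inr (Or.inl rfl))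
    have hm : dih 1 (-1) 1 ∈ Subgroup.closure {aD n ^ 2, aD n * bD * mD, mD} := by
      rw [← mD_eq]; exact Subgroup.subset_closure (Or.inr (Or.inr rfl))
    refine axial_le hn (Subgroup.subset_closure (Or.inl (aD_sq n).symm)) ?_
    rintro s t -
    rcases Int.units_eq_one_or t with rfl | rfl
    · refine ⟨1, by simp, ?_⟩
      rcases Int.units_eq_one_or s with rfl | rfl
      · rw [dih_one]; exact one_mem _
      · exact hm
    · refine ⟨Circle.exp (Real.pi / n), by simpa using exp_half_pow n hn, ?_⟩
      rcases Int.units_eq_one_or s with rfl | rfl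
      · exact hg
      · simpa [dih_mul] using mul_mem hg hm

theorem closure_Dnh {n : ℕ} (hn : n ≠ 0) : Subgroup.closure {aD n ^ 2, bD, mD} = axial n ⊤ 1 := by
  have hb : dih 1 (-1) (-1) ∈ Subgroup.closure {aD n ^ 2, bD, mD} := by
    rw [← bD_eq]; exact Subgroup.subset_closure (Or.inr (Or.inl rfl))
  have hm : dih 1 (-1) 1 ∈ Subgroup.closure {aD n ^ 2, bD, mD} := by
    rw [← mD_eq]; exact Subgroup.subset_closure (Or.inr (Or.inr rfl))
  apply le_antisymm
  · rw [Subgroup.closure_le]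
    rintro _ (rfl | rfl | rfl)
    · rw [aD_sq, rotZ_eq, SetLike.mem_coe, dih_mem_axial]
      simpa using exp_pow_eq_one n hn
    · rw [bD_eq, SetLike.mem_coe, dih_mem_axial]
      simp
    · rw [mD_eq, SetLike.mem_coe, dih_mem_axial]
      simp
  · refine axial_le hn (Subgroup.subset_closure (Or.inl (aD_sq n).symm)) ?_
    intro s t _
    refine ⟨1, by simp, ?_⟩
    rcases Int.units_eq_one_or s with rfl | rfl <;> rcases Int.units_eq_one_or t with rfl | rfl
    · rw [dih_one]; exact one_mem _
    · simpa [dih_mul] using mul_mem hb hm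
    · exact hm
    · exact hb

theorem closure_Dn {n : ℕ} (hn : n ≠ 0) : Subgroup.closure {aD n ^ 2, bD} = axial n Qd 1 := by
  rw [← Dn_eq hn, aD_sq]
  rfl

theorem closure_aD_bD_mD {n : ℕ} (hn : 1 ≤ n) : Subgroup.closure {aD n, bD, mD} = Dnh (2 * n) := by
  have h : aD n = rotZ (2 * Real.pi / ((2 * n : ℕ) : ℝ)) := by
    rw [aD]
    congr 1
    push_cast
    field_simp
  have h2 : Subgroup.closure {aD n, bD, mD} = Subgroup.closure {aD (2 * n) ^ 2, bD, mD} := by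
    rw [aD_sq, h]
  rw [h2, closure_Dnh (by omega), Dnh_eq (by omega)]

/-! Conjugation by rotations about the axis -/

theorem conj_dih_rot (w z : Circle) (s t : ℤˣ) :
    dih w 1 1 * dih z s t * (dih w 1 1)⁻¹ = dih (w * z * w ^ (-(s : ℤ))) s t := by
  rw [dih_conj]
  simp

theorem exists_circle_sq (z : Circle) : ∃ w : Circle, w ^ 2 = z := by
  refine ⟨Circle.exp (Complex.arg z / 2), ?_⟩
  rw [← Circle.exp_natCast_mul]
  conv_rhs => rw [← Circle.exp_arg z]
  congr 1
  push_cast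
  ring

/-- Conjugation by the rotation `w` multiplies z by `w ^ 2` on elements with `s = -1` and does
nothing on those with `s = 1`. Hence it twists the character by `u` on the former. This reconciles
the two orientations of D_{nd}. -/
theorem conj_axial {n : ℕ} {Q : Subgroup (ℤˣ × ℤˣ)} {χ χ' : ℤˣ × ℤˣ →* ℤˣ} {w : Circle} {u : ℤˣ}
    (hw : (w ^ 2) ^ n = sgnC u)
    (hχ : ∀ s t, (s, t) ∈ Q → χ' (s, t) = (if s = 1 then 1 else u) * χ (s, t)) :
    conj (dih w 1 1) (axial n Q χ) = axial n Q χ' := by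
  have key : ∀ (z : Circle) (s t : ℤˣ), (s, t) ∈ Q →
      ((w * z * w ^ (-(s : ℤ))) ^ n = sgnC (χ' (s, t)) ↔ z ^ n = sgnC (χ (s, t))) := by
    intro z s t hQ
    rw [hχ s t hQ, map_mul]
    rcases Int.units_eq_one_or s with rfl | rfl
    · simp
    · have : (w * z * w ^ (-((-1 : ℤˣ) : ℤ))) ^ n = sgnC u * z ^ n := by
        rw [← hw, ← mul_pow]
        congr 1
        simp only [Units.val_neg, Units.val_one, neg_neg, zpow_one, sq]
        exact mul_right_comm w z w
      rw [this]
      simp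
  ext g
  constructor
  · rintro ⟨_, ⟨z, s, t, rfl, hQ, hz⟩, rfl⟩
    exact ⟨_, _, _, conj_dih_rot _ _ _ _, hQ, (key z s t hQ).2 hz⟩
  · rintro ⟨z, s, t, rfl, hQ, hz⟩
    refine ⟨dih (w⁻¹ * z * w ^ (s : ℤ)) s t, ⟨_, _, _, rfl, hQ, ?_⟩, ?_⟩
    · rw [← key _ s t hQ]
      convert hz using 2
      rw [zpow_neg]
      group
    · refine (conj_dih_rot _ _ _ _).trans ?_
      congr 1
      rw [zpow_neg]
      group

end PointGroup

namespace PointGroup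

/-! ### Normalizers of axial groups -/

/-- Squares of elements of D_{∞h} are rotations about the axis. Conjugating `dih z 1 t` by `g` and
squaring gives a nontrivial such rotation, so `g` preserves the axis. -/
theorem normalizer_le_Dinfh_of_sq {S : Subgroup O3} (hS : S ≤ Dinfh) {z : Circle} {t : ℤˣ}
    (hz : z ^ 2 ≠ 1) (hw : dih z 1 t ∈ S) : Subgroup.normalizer (S : Set O3) ≤ Dinfh := by
  intro g hg
  set x := g * dih z 1 t * g⁻¹ with hx
  have hxS : x ∈ S := conj_mem_of_mem_normalizer hg hw
  have hx2 : x * x = g * dih (z ^ 2) 1 1 * g⁻¹ := by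
    rw [← dih_rot_mul_self z t, hx]
    group
  obtain ⟨w, s', t', hx'⟩ := mem_Dinfh.1 (hS hxS)
  have hne : dih (z ^ 2) 1 1 ≠ 1 := by
    rw [← dih_one]
    exact fun h => hz (dih_inj h).1
  rcases Int.units_eq_one_or s' with rfl | rfl
  · rw [hx', dih_rot_mul_self] at hx2
    refine mem_Dinfh_of_conj (w := w ^ 2) ?_ hx2.symm
    rintro h
    rw [h, dih_one, eq_comm, mul_inv_eq_one] at hx2
    exact hne (mul_eq_left.1 hx2)
  · exfalso
    rw [hx', dih_refl_mul_self, eq_comm, mul_inv_eq_one] at hx2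
    exact hne (mul_eq_left.1 hx2)

/-- Here the axis is recognised as the common axis of all rotations of the group. This covers C_{2v}
and the cyclic cases with n = 2, where the rotation by π squares to 1. -/
theorem normalizer_le_Dinfh_of_rot {S : Subgroup O3} {z : Circle} (hz : z ≠ 1)
    (hw : dih z 1 1 ∈ S) (hS : ∀ x ∈ S, x ∈ SO3 → ∃ w, x = dih w 1 1) :
    Subgroup.normalizer (S : Set O3) ≤ Dinfh := by
  intro g hg
  obtain ⟨w, hx⟩ := hS _ (conj_mem_of_mem_normalizer hg hw) (conj_mem_SO3.2 (dih_mem_SO3.2 rfl))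
  refine mem_Dinfh_of_conj (w := w) ?_ hx
  rintro rfl
  rw [dih_one, mul_inv_eq_one, mul_eq_left, ← dih_one] at hx
  exact hz (dih_inj hx).1

/-- Conjugating the element `dih z₀ (-1) t₀` by a rotation `w` multiplies its circle part by `w ^
2`. The result stays in the group exactly when `w ^ (2 * n) = 1`, the equation that defines
D_{(2n)h}. -/
theorem normalizer_axial_eq {n : ℕ} (hn : n ≠ 0) {Q : Subgroup (ℤˣ × ℤˣ)} {χ : ℤˣ × ℤˣ →* ℤˣ}
    (hle : Subgroup.normalizer (axial n Q χ : Set O3) ≤ Dinfh) {z₀ : Circle} {t₀ : ℤˣ}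
    (h₀ : dih z₀ (-1) t₀ ∈ axial n Q χ) :
    Subgroup.normalizer (axial n Q χ : Set O3) = Dnh (2 * n) := by
  rw [Dnh_eq (by omega)]
  apply le_antisymm
  · intro g hg
    obtain ⟨w, s, t, rfl⟩ := mem_Dinfh.1 (hle hg)
    have h := conj_mem_of_mem_normalizer hg h₀
    rw [dih_conj, dih_mem_axial, mul_pow, mul_pow, zpow_pow_comm z₀, (dih_mem_axial.1 h₀).2,
      sgnC_zpow] at h
    rw [dih_mem_axial]
    refine ⟨trivial, ?_⟩
    have h2 : w ^ n * w ^ n = 1 := by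
      have h3 := h.2
      simp only [Units.val_neg, Units.val_one, neg_neg, zpow_one] at h3
      rw [mul_right_comm] at h3
      exact mul_eq_right.1 h3
    rw [two_mul, pow_add, h2]
    simp
  · refine le_normalizer_of_conj_mem ?_
    rintro _ ⟨w, s, t, rfl, -, hw⟩ _ ⟨z, s', t', rfl, hQ, hz⟩
    rw [dih_conj, dih_mem_axial]
    refine ⟨hQ, ?_⟩
    rw [mul_pow, mul_pow, zpow_pow_comm z, hz, sgnC_zpow, zpow_pow_comm w]
    have hw' : w ^ n * w ^ n = 1 := by
      rw [← pow_add, ← two_mul, hw]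
      simp
    rcases Int.units_eq_one_or s' with rfl | rfl
    · simp
    · simp only [Units.val_neg, Units.val_one, neg_neg, zpow_one]
      rw [mul_right_comm, hw', one_mul]

theorem normalizer_axial_Qh {n : ℕ} (hn : 2 ≤ n) {Q : Subgroup (ℤˣ × ℤˣ)} {χ : ℤˣ × ℤˣ →* ℤˣ}
    (hQ : Q ≤ Qh) : Subgroup.normalizer (axial n Q χ : Set O3) = Dinfh := by
  apply le_antisymm
  · refine normalizer_le_Dinfh_of_rot (exp_ne_one n hn) (dih_mem_axial.2 ⟨Q.one_mem, ?_⟩) ?_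
    · rw [exp_pow_eq_one n (by omega), show ((1 : ℤˣ), (1 : ℤˣ)) = 1 from rfl]
      simp
    · rintro _ ⟨z, s, t, rfl, h, -⟩ h'
      obtain rfl : s = 1 := hQ h
      obtain rfl := dih_mem_SO3.1 h'
      exact ⟨z, rfl⟩
  · refine le_normalizer_of_conj_mem ?_
    rintro g hg _ ⟨z, s', t', rfl, h, hz⟩
    obtain ⟨w, s, t, rfl⟩ := mem_Dinfh.1 hg
    obtain rfl : s' = 1 := hQ h
    rw [dih_conj, dih_mem_axial]
    refine ⟨h, ?_⟩
    rw [mul_pow, mul_pow, zpow_pow_comm z, hz, sgnC_zpow, zpow_pow_comm w]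
    simp

/-- Let r be a 2n-th root of the generating rotation and write r = s h. All elements involved have
first sign 1 and commute, and s ^ (2n) = 1. So h ^ (2n) is the generating rotation, a nontrivial
element of S ∩ H. -/
theorem not_isComplementIn_axial_Qh {n : ℕ} (hn : 2 ≤ n) {Q : Subgroup (ℤˣ × ℤˣ)}
    {χ : ℤˣ × ℤˣ →* ℤˣ} (hQ : Q ≤ Qh) (H : Subgroup O3) :
    ¬ IsComplementIn Dinfh (axial n Q χ) H := by
  rw [isComplementIn_iff]
  rintro ⟨-, -, h3, h4⟩
  obtain ⟨r, hr⟩ : ∃ r : Circle, r ^ (2 * n) = Circle.exp (2 * Real.pi / n) := by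
    refine ⟨Circle.exp (2 * Real.pi / n / (2 * n)), ?_⟩
    rw [← Circle.exp_natCast_mul]
    congr 1
    push_cast
    field_simp
  obtain ⟨_, ⟨z, s, t, rfl, hst, hz⟩, h, hH, heq⟩ := h4 _ (mem_Dinfh.2 ⟨r, 1, 1, rfl⟩)
  obtain rfl : s = 1 := hQ hst
  have hh : h = dih (z⁻¹ * r) 1 t := by
    rw [← inv_mul_eq_iff_eq_mul.2 heq.symm, dih_inv, dih_mul]
    simp
  have hpow : h ^ (2 * n) = dih (Circle.exp (2 * Real.pi / n)) 1 1 := by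
    rw [hh, pow_mul, sq, dih_rot_mul_self, dih_rot_pow]
    congr 1
    rw [← hr, ← pow_mul, mul_pow, inv_pow, mul_comm 2 n, pow_mul z, hz, sq, sgnC_mul_self]
    simp
  have := h3 (dih (Circle.exp (2 * Real.pi / n)) 1 1)
    (dih_mem_axial.2 ⟨Q.one_mem, by
      rw [exp_pow_eq_one n (by omega), show ((1 : ℤˣ), (1 : ℤˣ)) = 1 from rfl]
      simp⟩) (hpow ▸ pow_mem hH _)
  rw [← dih_one] at this
  exact exp_ne_one n hn (dih_inj this).1

theorem cyclic_cases {n : ℕ} (hn : 2 ≤ n) {S : Subgroup O3}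
    (hS : S = Cn n ∨ S = S2n n ∨ S = Cnh n) :
    ∃ (Q : Subgroup (ℤˣ × ℤˣ)) (χ : ℤˣ × ℤˣ →* ℤˣ), Q ≤ Qh ∧ S = axial n Q χ := by
  rcases hS with rfl | rfl | rfl
  · exact ⟨⊥, 1, bot_le, Cn_eq (by omega)⟩
  · exact ⟨Qh, _, le_rfl, S2n_eq (by omega)⟩
  · exact ⟨Qh, 1, le_rfl, Cnh_eq (by omega)⟩

theorem normalizer_cyclic {n : ℕ} (hn : 2 ≤ n) {S : Subgroup O3}
    (hS : S = Cn n ∨ S = S2n n ∨ S = Cnh n) : Subgroup.normalizer (S : Set O3) = Dinfh := by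
  obtain ⟨Q, χ, hQ, rfl⟩ := cyclic_cases hn hS
  exact normalizer_axial_Qh hn hQ

theorem not_isComplementIn_cyclic {n : ℕ} (hn : 2 ≤ n) {S : Subgroup O3}
    (hS : S = Cn n ∨ S = S2n n ∨ S = Cnh n) (H : Subgroup O3) : ¬ IsComplementIn Dinfh S H := by
  obtain ⟨Q, χ, hQ, rfl⟩ := cyclic_cases hn hS
  exact not_isComplementIn_axial_Qh hn hQ H

theorem normalizer_Cnv {n : ℕ} (hn : 2 ≤ n) :
    Subgroup.normalizer (axial n Qv 1 : Set O3) = Dnh (2 * n) := by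
  refine normalizer_axial_eq (by omega) ?_ (z₀ := 1) (t₀ := 1) (dih_mem_axial.2 (by simp))
  refine normalizer_le_Dinfh_of_rot (exp_ne_one n hn)
    (dih_mem_axial.2 (by simpa using exp_pow_eq_one n (by omega))) ?_
  rintro _ ⟨z, s, t, rfl, h, -⟩ h'
  obtain rfl : t = 1 := h
  obtain rfl := dih_mem_SO3.1 h'
  exact ⟨z, rfl⟩

/-- The rotoreflection by π/n singles out the axis even for n = 2, where the rotations alone form
D_2 with three equivalent axes. -/
theorem normalizer_Dnd {n : ℕ} (hn : 2 ≤ n) :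
    Subgroup.normalizer (axial n ⊤ (MonoidHom.snd ℤˣ ℤˣ) : Set O3) = Dnh (2 * n) := by
  refine normalizer_axial_eq (by omega) ?_ (z₀ := 1) (t₀ := 1) (dih_mem_axial.2 (by simp))
  refine normalizer_le_Dinfh_of_sq (axial_le_Dinfh _ _ _) (z := Circle.exp (Real.pi / n))
    (t := -1) ?_ (dih_mem_axial.2 (by simpa using exp_half_pow n (by omega)))
  rw [exp_half_sq]
  exact exp_ne_one n hn

/-- For n = 2 all axes of the group are equivalent and the normalizer grows to O_h. The argument by
squares therefore needs a rotation of order at least 3. -/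
theorem normalizer_Dnh {n : ℕ} (hn : 3 ≤ n) :
    Subgroup.normalizer (axial n ⊤ 1 : Set O3) = Dnh (2 * n) := by
  refine normalizer_axial_eq (by omega) ?_ (z₀ := 1) (t₀ := 1) (dih_mem_axial.2 (by simp))
  exact normalizer_le_Dinfh_of_sq (axial_le_Dinfh _ _ _) (t := 1) (exp_sq_ne_one n hn)
    (dih_mem_axial.2 (by simpa using exp_pow_eq_one n (by omega)))

theorem normalizer_Dn {n : ℕ} (hn : 3 ≤ n) :
    Subgroup.normalizer (axial n Qd 1 : Set O3) = Dnh (2 * n) := by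
  refine normalizer_axial_eq (by omega) ?_ (z₀ := 1) (t₀ := -1) (dih_mem_axial.2 (by simp))
  exact normalizer_le_Dinfh_of_sq (axial_le_Dinfh _ _ _) (t := 1) (exp_sq_ne_one n hn)
    (dih_mem_axial.2 (by simpa using exp_pow_eq_one n (by omega)))

/-! ### Complements of axial groups -/

theorem axial_le_axial_two_mul (n : ℕ) (Q : Subgroup (ℤˣ × ℤˣ)) (χ : ℤˣ × ℤˣ →* ℤˣ) :
    axial n Q χ ≤ axial (2 * n) ⊤ 1 := by
  rintro _ ⟨z, s, t, rfl, -, hz⟩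
  rw [dih_mem_axial, mul_comm, pow_mul, hz, sq, sgnC_mul_self]
  simp

theorem pow_eq_sgnC {z : Circle} {n : ℕ} (hz : z ^ (2 * n) = 1) : ∃ u, z ^ n = sgnC u := by
  rw [mul_comm, pow_mul] at hz
  have h : ((z ^ n : Circle) : ℂ) * ((z ^ n : Circle) : ℂ) = 1 := by
    rw [← Circle.coe_mul, ← sq, hz, Circle.coe_one]
  rcases mul_self_eq_one_iff.1 h with h | h
  · exact ⟨1, by simpa using Circle.ext h⟩
  · refine ⟨-1, ?_⟩
    rw [sgnC_neg_one]
    apply Circle.ext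
    simpa using h

theorem mem_closure_involution {G : Type*} [Group G] {x g : G} (hx : x * x = 1) :
    g ∈ Subgroup.closure {x} ↔ g = 1 ∨ g = x := by
  constructor
  · intro h
    induction h using Subgroup.closure_induction with
    | mem y hy => exact Or.inr hy
    | one => exact Or.inl rfl
    | mul y z _ _ hy hz => rcases hy with rfl | rfl <;> rcases hz with rfl | rfl <;> simp [hx]
    | inv y _ hy => rcases hy with rfl | rfl <;> simp [inv_eq_of_mul_eq_one_right hx]
  · rintro (rfl | rfl)
    · exact one_mem _
    · exact Subgroup.subset_closure rfl

/-- The elements of `D_{∞h}` preserving the vertical plane halfway to the direction `ζ`. -/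
noncomputable def fan (ζ : Circle) : Subgroup O3 where
  carrier := {g | ∃ s t, g = dih (if s = 1 then 1 else ζ) s t}
  one_mem' := ⟨1, 1, by simp [dih_one]⟩
  mul_mem' := by
    rintro _ _ ⟨s, t, rfl⟩ ⟨s', t', rfl⟩
    refine ⟨s * s', t * t', ?_⟩
    rw [dih_mul]
    rcases Int.units_eq_one_or s with rfl | rfl <;>
      rcases Int.units_eq_one_or s' with rfl | rfl <;> simp
  inv_mem' := by
    rintro _ ⟨s, t, rfl⟩
    refine ⟨s, t, ?_⟩
    rw [dih_inv]
    rcases Int.units_eq_one_or s with rfl | rfl <;> simp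

theorem dih_mem_fan {ζ z : Circle} {s t : ℤˣ} :
    dih z s t ∈ fan ζ ↔ z = if s = 1 then 1 else ζ := by
  constructor
  · rintro ⟨s', t', h⟩
    obtain ⟨rfl, rfl, rfl⟩ := dih_inj h
    rfl
  · rintro rfl
    exact ⟨s, t, rfl⟩

theorem closure_fan (n : ℕ) :
    Subgroup.closure {aD n * mD, bD * mD} = fan (Circle.exp (Real.pi / n)) := by
  have ha : dih (Circle.exp (Real.pi / n)) (-1) 1 ∈ Subgroup.closure {aD n * mD, bD * mD} := by
    rw [← aD_mul_mD]; exact Subgroup.subset_closure (Or.inl rfl)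
  have hb : dih 1 1 (-1) ∈ Subgroup.closure {aD n * mD, bD * mD} := by
    rw [← bD_mul_mD]; exact Subgroup.subset_closure (Or.inr rfl)
  apply le_antisymm
  · rw [Subgroup.closure_le]
    rintro _ (rfl | rfl)
    · rw [aD_mul_mD, SetLike.mem_coe, dih_mem_fan]
      simp
    · rw [bD_mul_mD, SetLike.mem_coe, dih_mem_fan]
      simp
  · rintro _ ⟨s, t, rfl⟩
    rcases Int.units_eq_one_or s with rfl | rfl <;> rcases Int.units_eq_one_or t with rfl | rfl
    · simp [dih_one, one_mem]
    · simpa using hb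
    · simpa using ha
    · simpa [dih_mul] using mul_mem ha hb

/-- The invariant z ^ n is 1 on `axial n Q 1` and equals s on `fan ζ`. So the second factor of an
element with z ^ n = u must have first sign u, and `hQ` supplies signs in Q for the first factor. By
`hQ'` a common element, which has s = 1, is trivial. -/
theorem isComplementIn_fan {n : ℕ} (hn : n ≠ 0) {Q : Subgroup (ℤˣ × ℤˣ)}
    (hQ : ∀ u s : ℤˣ, ∃ s' t', (s', t') ∈ Q ∧ s * s' = u)
    (hQ' : ∀ s t : ℤˣ, (s, t) ∈ Q → s = 1 → t = 1) :
    IsComplementIn (Dnh (2 * n)) (axial n Q 1)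
      (Subgroup.closure {aD n * mD, bD * mD}) := by
  rw [Dnh_eq (by omega), closure_fan, isComplementIn_iff]
  set ζ := Circle.exp (Real.pi / n) with hζ
  have hζn : ζ ^ n = -1 := exp_half_pow n hn
  refine ⟨axial_le_axial_two_mul _ _ _, ?_, ?_, ?_⟩
  · rintro _ ⟨s, t, rfl⟩
    rw [dih_mem_axial]
    refine ⟨trivial, ?_⟩
    split_ifs
    · simp
    · rw [mul_comm, pow_mul, hζn]
      simp
  · rintro _ ⟨z, s, t, rfl, hst, hz⟩ h
    rw [dih_mem_fan] at h
    rcases Int.units_eq_one_or s with rfl | rfl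
    · rw [hQ' _ _ hst rfl, h]
      simp [dih_one]
    · exfalso
      rw [h] at hz
      simp [hζn, circle_neg_one_ne_one] at hz
  · rintro _ ⟨z, s, t, rfl, -, hz⟩
    obtain ⟨u, hu⟩ := pow_eq_sgnC (z := z) (n := n) (by simpa using hz)
    obtain ⟨s', t', hst, hs⟩ := hQ u s
    -- The first sign `u` of this factor absorbs `z ^ n`, and the second sign is chosen so that the
    -- quotient has second sign `t'`.
    have hfan : dih (if u = 1 then 1 else ζ) u (t' * t) ∈ fan ζ := dih_mem_fan.2 rfl
    refine ⟨dih z s t * (dih (if u = 1 then 1 else ζ) u (t' * t))⁻¹, ?_, _, hfan, by group⟩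
    rw [dih_inv, dih_mul, dih_mem_axial]
    have ht : t * (t' * t) = t' := by
      rcases Int.units_eq_one_or t with rfl | rfl <;> simp
    have hs' : s * u = s' := by
      rw [← hs]
      rcases Int.units_eq_one_or s with rfl | rfl <;> simp
    rw [ht, hs']
    refine ⟨hst, ?_⟩
    rw [mul_pow, zpow_pow_comm, zpow_pow_comm, hu]
    rcases Int.units_eq_one_or u with rfl | rfl
    · simp
    · rcases Int.units_eq_one_or s with rfl | rfl <;> simp [hζn]

theorem isComplementIn_Cnv {n : ℕ} (hn : n ≠ 0) :
    IsComplementIn (Dnh (2 * n)) (axial n Qv 1) (Subgroup.closure {aD n * mD, bD * mD}) := by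
  refine isComplementIn_fan hn ?_ fun _ _ h _ => h
  intro u s
  refine ⟨s * u, 1, rfl, ?_⟩
  rcases Int.units_eq_one_or s with rfl | rfl <;> simp

theorem isComplementIn_Dn {n : ℕ} (hn : n ≠ 0) :
    IsComplementIn (Dnh (2 * n)) (axial n Qd 1) (Subgroup.closure {aD n * mD, bD * mD}) := by
  refine isComplementIn_fan hn ?_ fun _ _ h hs => (mem_Qd.1 h).symm.trans hs
  intro u s
  refine ⟨s * u, s * u, rfl, ?_⟩
  rcases Int.units_eq_one_or s with rfl | rfl <;> simp

theorem isComplementIn_closure_singleton {N S : Subgroup O3} {x : O3} (hx : x * x = 1)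
    (hxN : x ∈ N) (hS : S ≤ N) (hxS : x ∉ S) (h : ∀ g ∈ N, g ∉ S → g * x ∈ S) :
    IsComplementIn N S (Subgroup.closure {x}) := by
  rw [isComplementIn_iff]
  refine ⟨hS, ?_, ?_, ?_⟩
  · rw [Subgroup.closure_le]
    rintro _ rfl
    exact hxN
  · intro g hg hg'
    rcases (mem_closure_involution hx).1 hg' with rfl | rfl
    · rfl
    · exact absurd hg hxS
  · intro g hg
    by_cases hgS : g ∈ S
    · exact ⟨g, hgS, 1, one_mem _, mul_one g⟩
    · exact ⟨g * x, h g hg hgS, x, Subgroup.subset_closure rfl, by rw [mul_assoc, hx, mul_one]⟩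

/-- D_{nd} is the index-two subgroup z ^ n = t, and the horizontal reflection `bD * mD` flips t
without changing z. -/
theorem isComplementIn_Dnd {n : ℕ} (hn : n ≠ 0) :
    IsComplementIn (Dnh (2 * n)) (axial n ⊤ (MonoidHom.snd ℤˣ ℤˣ))
      (Subgroup.closure {bD * mD}) := by
  rw [Dnh_eq (by omega), bD_mul_mD]
  refine isComplementIn_closure_singleton ?_ (dih_mem_axial.2 (by simp))
    (axial_le_axial_two_mul _ _ _) ?_ ?_
  · simp [dih_mul, dih_one]
  · rw [dih_mem_axial]
    simpa using circle_neg_one_ne_one.symm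
  · rintro _ ⟨z, s, t, rfl, -, hz⟩ h
    obtain ⟨u, hu⟩ := pow_eq_sgnC (z := z) (n := n) (by simpa using hz)
    rw [dih_mem_axial] at h
    rw [dih_mul, dih_mem_axial]
    refine ⟨trivial, ?_⟩
    have hut : u ≠ t := by
      rintro rfl
      exact h ⟨trivial, hu⟩
    simp only [one_zpow, mul_one, hu, MonoidHom.coe_snd]
    congr 1
    rcases Int.units_eq_one_or u with rfl | rfl <;> rcases Int.units_eq_one_or t with rfl | rfl <;>
      simp_all

/-- D_{nh} is the index-two subgroup z ^ n = 1, and `aD n * mD` changes the sign of z ^ n. -/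
theorem isComplementIn_Dnh {n : ℕ} (hn : n ≠ 0) :
    IsComplementIn (Dnh (2 * n)) (axial n ⊤ 1) (Subgroup.closure {aD n * mD}) := by
  rw [Dnh_eq (by omega), aD_mul_mD]
  have hζ := exp_half_pow n hn
  refine isComplementIn_closure_singleton (dih_refl_mul_self _ _) (dih_mem_axial.2 ?_)
    (axial_le_axial_two_mul _ _ _) ?_ ?_
  · refine ⟨trivial, ?_⟩
    rw [mul_comm, pow_mul, hζ]
    simp
  · rw [dih_mem_axial, hζ]
    simpa using circle_neg_one_ne_one
  · rintro _ ⟨z, s, t, rfl, -, hz⟩ h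
    obtain ⟨u, hu⟩ := pow_eq_sgnC (z := z) (n := n) (by simpa using hz)
    rw [dih_mem_axial] at h
    rw [dih_mul, dih_mem_axial]
    refine ⟨trivial, ?_⟩
    have hu1 : u = -1 := by
      rcases Int.units_eq_one_or u with rfl | rfl
      · exact absurd ⟨trivial, by simpa using hu⟩ h
      · rfl
    rw [mul_pow, zpow_pow_comm, hζ, hu, hu1]
    rcases Int.units_eq_one_or s with rfl | rfl <;> simp

/-! ### The group `C_s` -/

theorem reflXY_mul_self : reflXY * reflXY = 1 := by
  rw [reflXY_eq, dih_mul, ← dih_one]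
  simp

theorem mem_Cs {g : O3} : g ∈ Cs ↔ g = 1 ∨ g = reflXY :=
  mem_closure_involution reflXY_mul_self

theorem Cs_le_Dinfh : Cs ≤ Dinfh := by
  rw [Cs, Subgroup.closure_le]
  rintro _ rfl
  exact mem_Dinfh.2 ⟨_, _, _, reflXY_eq⟩

theorem normalizer_Cs : Subgroup.normalizer (Cs : Set O3) = Dinfh := by
  apply le_antisymm
  · intro g hg
    -- The inversion is central, so `g` commutes with the reflection times the inversion, which is
    -- the rotation by π about the z-axis.
    have h : g * (reflXY * inversion) * g⁻¹ = reflXY * inversion := by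
      have h1 : g * reflXY * g⁻¹ = reflXY := by
        rcases mem_Cs.1 (conj_mem_of_mem_normalizer hg (mem_Cs.2 (Or.inr rfl))) with h | h
        · exfalso
          rw [mul_inv_eq_one, mul_eq_left, ← dih_one, reflXY_eq] at h
          exact absurd (dih_inj h).2.2 (by decide)
        · exact h
      calc g * (reflXY * inversion) * g⁻¹ = (g * reflXY * g⁻¹) * (g * inversion * g⁻¹) := by group
        _ = _ := by rw [h1, inversion_conj]
    have h2 : reflXY * inversion = dih (-1) 1 1 := by
      rw [reflXY_eq, inversion_eq, dih_mul]
      simp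
    rw [h2] at h
    exact mem_Dinfh_of_conj circle_neg_one_ne_one h
  · refine le_normalizer_of_conj_mem ?_
    intro g hg x hx
    obtain ⟨z, s, t, rfl⟩ := mem_Dinfh.1 hg
    rcases mem_Cs.1 hx with rfl | rfl
    · simp [one_mem]
    · rw [mem_Cs, reflXY_eq, dih_conj]
      right
      simp

theorem isComplementIn_Cs_of {H : Subgroup O3} (hH : H ≤ Dinfh)
    (h1 : reflXY ∉ H) (h2 : ∀ g ∈ Dinfh, g ∈ H ∨ reflXY * g ∈ H) : IsComplementIn Dinfh Cs H := by
  rw [isComplementIn_iff]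
  refine ⟨Cs_le_Dinfh, hH, ?_, ?_⟩
  · intro x hx hx'
    rcases mem_Cs.1 hx with rfl | rfl
    · rfl
    · exact absurd hx' h1
  · intro g hg
    rcases h2 g hg with h | h
    · exact ⟨1, one_mem _, g, h, one_mul g⟩
    · exact ⟨reflXY, mem_Cs.2 (Or.inr rfl), _, h, by rw [← mul_assoc, reflXY_mul_self, one_mul]⟩

theorem isComplementIn_Cs_Cinfv : IsComplementIn Dinfh Cs Cinfv := by
  have hz : ∀ z, dih z 1 1 ∈ Cinfv := by
    intro z
    rw [← Circle.exp_arg z, ← rotZ_eq]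
    exact Subgroup.subset_closure (Or.inl ⟨_, rfl⟩)
  have hr : dih (-1) (-1) 1 ∈ Cinfv := by
    rw [← reflYZ_eq]
    exact Subgroup.subset_closure (Or.inr rfl)
  have hz' : ∀ z s, dih z s 1 ∈ Cinfv := by
    intro z s
    rcases Int.units_eq_one_or s with rfl | rfl
    · exact hz z
    · simpa [dih_mul] using mul_mem (hz (-z)) hr
  have hle : ∀ g ∈ Cinfv, ∃ z s, g = dih z s 1 := by
    intro g hg
    induction hg using Subgroup.closure_induction with
    | mem x hx =>
      rcases hx with ⟨θ, rfl⟩ | rfl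
      · exact ⟨_, _, rotZ_eq θ⟩
      · exact ⟨_, _, reflYZ_eq⟩
    | one => exact ⟨_, _, dih_one.symm⟩
    | mul x y _ _ hx hy =>
      obtain ⟨z, s, rfl⟩ := hx
      obtain ⟨w, s', rfl⟩ := hy
      exact ⟨_, _, dih_mul _ _ _ _ _ _⟩
    | inv x _ hx =>
      obtain ⟨z, s, rfl⟩ := hx
      exact ⟨_, _, dih_inv _ _ _⟩
  refine isComplementIn_Cs_of ?_ ?_ ?_
  · intro g hg
    obtain ⟨z, s, rfl⟩ := hle g hg
    exact mem_Dinfh.2 ⟨_, _, _, rfl⟩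
  · intro h
    obtain ⟨z, s, h⟩ := hle _ h
    rw [reflXY_eq] at h
    exact absurd (dih_inj h).2.2 (by decide)
  · intro g hg
    obtain ⟨z, s, t, rfl⟩ := mem_Dinfh.1 hg
    rcases Int.units_eq_one_or t with rfl | rfl
    · exact Or.inl (hz' z s)
    · right
      rw [reflXY_eq, dih_mul]
      simpa using hz' z s

theorem isComplementIn_Cs_Dinf : IsComplementIn Dinfh Cs Dinf := by
  have hz : ∀ z, dih z 1 1 ∈ Dinf := by
    intro z
    rw [← Circle.exp_arg z, ← rotZ_eq]
    exact Subgroup.subset_closure (Or.inl ⟨_, rfl⟩)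
  have hr : dih 1 (-1) (-1) ∈ Dinf := by
    rw [← rotX_pi_eq]
    exact Subgroup.subset_closure (Or.inr rfl)
  have hz' : ∀ z s, dih z s s ∈ Dinf := by
    intro z s
    rcases Int.units_eq_one_or s with rfl | rfl
    · exact hz z
    · simpa [dih_mul] using mul_mem (hz z) hr
  have hle : ∀ g ∈ Dinf, ∃ z s, g = dih z s s := by
    intro g hg
    induction hg using Subgroup.closure_induction with
    | mem x hx =>
      rcases hx with ⟨θ, rfl⟩ | rfl
      · exact ⟨_, _, rotZ_eq θ⟩
      · exact ⟨_, _, rotX_pi_eq⟩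
    | one => exact ⟨_, _, dih_one.symm⟩
    | mul x y _ _ hx hy =>
      obtain ⟨z, s, rfl⟩ := hx
      obtain ⟨w, s', rfl⟩ := hy
      exact ⟨_, _, dih_mul _ _ _ _ _ _⟩
    | inv x _ hx =>
      obtain ⟨z, s, rfl⟩ := hx
      exact ⟨_, _, dih_inv _ _ _⟩
  refine isComplementIn_Cs_of ?_ ?_ ?_
  · intro g hg
    obtain ⟨z, s, rfl⟩ := hle g hg
    exact mem_Dinfh.2 ⟨_, _, _, rfl⟩
  · intro h
    obtain ⟨z, s, h⟩ := hle _ h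
    rw [reflXY_eq] at h
    obtain ⟨-, rfl, h⟩ := dih_inj h
    exact absurd h (by decide)
  · intro g hg
    obtain ⟨z, s, t, rfl⟩ := mem_Dinfh.1 hg
    by_cases hst : s = t
    · subst hst
      exact Or.inl (hz' z s)
    · right
      rw [reflXY_eq, dih_mul]
      have : t = -s := by
        rcases Int.units_eq_one_or s with rfl | rfl <;>
          rcases Int.units_eq_one_or t with rfl | rfl <;> simp_all
      rw [this]
      simpa using hz' z s

end PointGroup

namespace PointGroup

/-! ### Finite subgroups of `D_{∞h}` -/

/-- Rotations about the `z`-axis. -/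
noncomputable def rotHom : Circle →* O3 where
  toFun z := dih z 1 1
  map_one' := dih_one
  map_mul' z w := (dih_mul_rot z w 1 1).symm

theorem finite_comap_rotHom (S : Subgroup O3) [Finite S] : Finite (S.comap rotHom) :=
  Set.Finite.preimage (f := rotHom) (fun _ _ _ _ h => (dih_inj h).1) (Set.toFinite (S : Set O3))

/-- A finite group contains exactly the `n`-th roots of unity among the rotations about an axis. -/
theorem dih_rot_mem_iff (S : Subgroup O3) [Finite S] (z : Circle) :
    dih z 1 1 ∈ S ↔ z ^ Nat.card (S.comap rotHom) = 1 := by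
  classical
  have := finite_comap_rotHom S
  have := Fintype.ofFinite (S.comap rotHom)
  rw [Nat.card_eq_fintype_card]
  set n := Fintype.card (S.comap rotHom) with hn
  have hn0 : 0 < n := Fintype.card_pos
  have h1 : ∀ z, dih z 1 1 ∈ S → z ^ n = 1 := by
    intro z hz
    have := pow_card_eq_one (x := (⟨z, hz⟩ : S.comap rotHom))
    exact congrArg Subtype.val this
  refine ⟨h1 z, fun hz => ?_⟩
  set F : Finset ℂ := Finset.univ.image (fun x : S.comap rotHom => ((x : Circle) : ℂ)) with hF
  have hFc : F.card = n := by
    rw [hF, Finset.card_image_of_injective _ (fun x y h => Subtype.ext (Circle.ext h))]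
    exact Finset.card_univ
  have hsub : F ⊆ Polynomial.nthRootsFinset n (1 : ℂ) := by
    intro x hx
    obtain ⟨y, -, rfl⟩ := Finset.mem_image.1 hx
    rw [Polynomial.mem_nthRootsFinset hn0, ← Circle.coe_pow, h1 _ y.2, Circle.coe_one]
  have hle : (Polynomial.nthRootsFinset n (1 : ℂ)).card ≤ n := by
    rw [Polynomial.nthRootsFinset_def]
    exact (Multiset.toFinset_card_le _).trans (Polynomial.card_nthRoots n 1)
  -- The polynomial X ^ n - 1 has at most n roots and the group already supplies n of them, so it
  -- contains all.
  have heq := Finset.eq_of_subset_of_card_le hsub (by rw [hFc]; exact hle)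
  have hzF : (z : ℂ) ∈ F := by
    rw [heq, Polynomial.mem_nthRootsFinset hn0, ← Circle.coe_pow, hz, Circle.coe_one]
  obtain ⟨y, -, hy⟩ := Finset.mem_image.1 hzF
  have : (y : Circle) = z := Circle.ext hy
  rw [← this]
  exact y.2

theorem exists_rot_order (S : Subgroup O3) [Finite S] :
    ∃ n : ℕ, n ≠ 0 ∧ ∀ z, dih z 1 1 ∈ S ↔ z ^ n = 1 :=
  have := finite_comap_rotHom S
  ⟨_, Nat.card_pos.ne', dih_rot_mem_iff S⟩

/-- Elements of S with equal signs differ by a rotation in S. The rotation order and one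
representative per sign pair thus determine S. -/
theorem eq_axial {S : Subgroup O3} (hS : S ≤ Dinfh) {n : ℕ} {Q : Subgroup (ℤˣ × ℤˣ)}
    {χ : ℤˣ × ℤˣ →* ℤˣ} (hA : ∀ z, dih z 1 1 ∈ S ↔ z ^ n = 1)
    (hQ : ∀ z s t, dih z s t ∈ S → (s, t) ∈ Q)
    (hχ : ∀ s t, (s, t) ∈ Q → ∃ z, z ^ n = sgnC (χ (s, t)) ∧ dih z s t ∈ S) :
    S = axial n Q χ := by
  have key : ∀ z w s t, dih w s t ∈ S → (dih z s t ∈ S ↔ z ^ n = w ^ n) := by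
    intro z w s t hw
    have : dih z s t = dih (z * w⁻¹) 1 1 * dih w s t := by
      rw [dih_mul_rot, inv_mul_cancel_right]
    rw [this, Subgroup.mul_mem_cancel_right _ hw, hA, mul_pow, inv_pow, mul_inv_eq_one]
  ext g
  constructor
  · intro hg
    obtain ⟨z, s, t, rfl⟩ := mem_Dinfh.1 (hS hg)
    obtain ⟨w, hw, hwS⟩ := hχ s t (hQ z s t hg)
    exact ⟨z, s, t, rfl, hQ z s t hg, ((key z w s t hwS).1 hg).trans hw⟩
  · rintro ⟨z, s, t, rfl, hst, hz⟩
    obtain ⟨w, hw, hwS⟩ := hχ s t hst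
    exact (key z w s t hwS).2 (hz.trans hw.symm)

theorem units_eq_or_eq_neg (s t : ℤˣ) : s = t ∨ s = -t := by
  rcases Int.units_eq_one_or s with rfl | rfl <;> rcases Int.units_eq_one_or t with rfl | rfl <;>
    simp

/-- Up to conjugation, a finite subgroup of `D_{∞h}` is one of the eight kinds of axial groups. -/
theorem exists_conj_eq_axial {S : Subgroup O3} [Finite S] (hS : S ≤ Dinfh) :
    ∃ g n, n ≠ 0 ∧ (conj g S = axial n ⊥ 1 ∨ conj g S = axial n Qh 1 ∨
      conj g S = axial n Qh (MonoidHom.snd ℤˣ ℤˣ) ∨ conj g S = axial n Qd 1 ∨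
      conj g S = axial n Qv 1 ∨ conj g S = axial n ⊤ 1 ∨
      conj g S = axial n ⊤ (MonoidHom.snd ℤˣ ℤˣ)) := by
  by_cases hrefl : ∃ z t, dih z (-1) t ∈ S
  · obtain ⟨z₁, t₀, hz₁⟩ := hrefl
    -- Turning back by a square root of `z₁` brings the element with signs `(-1, t₀)` to circle part
    -- 1.
    obtain ⟨w, hw⟩ := exists_circle_sq z₁
    have hfin : Finite (conj (dih w⁻¹ 1 1) S) := AreConj.finite ⟨_, rfl⟩
    have hle : conj (dih w⁻¹ 1 1) S ≤ Dinfh := by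
      intro x hx
      have h := hS (mem_conj.1 hx)
      have hd : dih w⁻¹ 1 1 ∈ Dinfh := mem_Dinfh.2 ⟨_, _, _, rfl⟩
      have := mul_mem (mul_mem hd h) (inv_mem hd)
      simpa [mul_assoc] using this
    have hone : dih 1 (-1) t₀ ∈ conj (dih w⁻¹ 1 1) S := by
      have := conj_mem_conj (g := dih w⁻¹ 1 1) hz₁
      rw [conj_dih_rot, ← hw] at this
      have h1 : w⁻¹ * w ^ 2 * w⁻¹ ^ (-((-1 : ℤˣ) : ℤ)) = 1 := by
        simp [sq]
      rwa [h1] at this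
    set S' := conj (dih w⁻¹ 1 1) S with hS'
    obtain ⟨n, hn, hA⟩ := exists_rot_order S'
    by_cases hh : ∃ z, dih z 1 (-1) ∈ S'
    · obtain ⟨z₀, hz₀⟩ := hh
      -- The square of `dih z₀ 1 (-1)` is a rotation in the group, so `z₀ ^ n` is a sign `u`.
      have h2 : z₀ ^ (2 * n) = 1 := by
        rw [pow_mul, ← hA, ← dih_rot_mul_self z₀ (-1)]
        exact mul_mem hz₀ hz₀
      obtain ⟨u, hu⟩ := pow_eq_sgnC h2
      have hprod : dih z₀ (-1) (-t₀) ∈ S' := by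
        simpa [dih_mul] using mul_mem hz₀ hone
      -- The pairs `(1, -1)` and `(-1, t₀)` generate all sign pairs, so a character with the right
      -- values on these two describes the group.
      have hrep : ∀ χ : ℤˣ × ℤˣ →* ℤˣ, χ (1, -1) = u → χ (-1, t₀) = 1 →
          S' = axial n ⊤ χ := by
        intro χ h1 h2
        have h3 : χ (-1, -t₀) = u := by
          have : ((-1 : ℤˣ), -t₀) = (-1, t₀) * (1, -1) := by simp
          rw [this, map_mul, h1, h2, one_mul]
        refine eq_axial hle hA (fun _ _ _ _ => trivial) fun s t _ => ?_
        rcases Int.units_eq_one_or s with rfl | rfl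
        · rcases Int.units_eq_one_or t with rfl | rfl
          · exact ⟨1, by rw [show ((1 : ℤˣ), (1 : ℤˣ)) = 1 from rfl]; simp,
              by rw [dih_one]; exact one_mem _⟩
          · exact ⟨z₀, by rw [hu, h1], hz₀⟩
        · rcases units_eq_or_eq_neg t t₀ with rfl | rfl
          · exact ⟨1, by simp [h2], hone⟩
          · exact ⟨z₀, by rw [hu, h3], hprod⟩
      rcases Int.units_eq_one_or u with rfl | rfl
      · exact ⟨dih w⁻¹ 1 1, n, hn, by rw [← hS', hrep 1 rfl rfl]; simp⟩
      · rcases Int.units_eq_one_or t₀ with rfl | rfl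
        · exact ⟨dih w⁻¹ 1 1, n, hn, by
            rw [← hS', hrep (MonoidHom.snd ℤˣ ℤˣ) rfl rfl]; simp⟩
        -- The character here is (s, t) ↦ st. A further turn through half the angle π/n twists it by
        -- s and leaves t.
        · have h3 := hrep (MonoidHom.fst ℤˣ ℤˣ * MonoidHom.snd ℤˣ ℤˣ) (by simp) (by simp)
          obtain ⟨v, hv⟩ := exists_circle_sq (Circle.exp (Real.pi / n))
          refine ⟨dih v 1 1 * dih w⁻¹ 1 1, n, hn, ?_⟩
          rw [← conj_conj, ← hS', h3, conj_axial (χ' := MonoidHom.snd ℤˣ ℤˣ) (u := -1)]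
          · simp
          · rw [hv, exp_half_pow n hn, sgnC_neg_one]
          · intro s t _
            rcases Int.units_eq_one_or s with rfl | rfl <;> simp
    -- Without the pair `(1, -1)` the sign pairs form the group of order two generated by `(-1,
    -- t₀)`.
    · have hs1 : ∀ z t, dih z 1 t ∈ S' → t = 1 := by
        intro z t hz
        rcases Int.units_eq_one_or t with rfl | rfl
        · rfl
        · exact absurd ⟨z, hz⟩ hh
      have hs2 : ∀ z t, dih z (-1) t ∈ S' → t = t₀ := by
        intro z t hz
        have := hs1 z (t * t₀) (by simpa [dih_mul] using mul_mem hz hone)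
        rcases Int.units_eq_one_or t with rfl | rfl <;>
          rcases Int.units_eq_one_or t₀ with rfl | rfl <;> simp_all
      have h11 : ∀ χ : ℤˣ × ℤˣ →* ℤˣ, ∃ z : Circle, z ^ n = sgnC (χ (1, 1)) ∧ dih z 1 1 ∈ S' :=
        fun χ => ⟨1, by rw [show ((1 : ℤˣ), (1 : ℤˣ)) = 1 from rfl]; simp,
          by rw [dih_one]; exact one_mem _⟩
      rcases Int.units_eq_one_or t₀ with rfl | rfl
      · have : S' = axial n Qv 1 := by
          refine eq_axial hle hA ?_ ?_
          · intro z s t hz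
            rcases Int.units_eq_one_or s with rfl | rfl
            · exact hs1 z t hz
            · exact hs2 z t hz
          · rintro s t rfl
            rcases Int.units_eq_one_or s with rfl | rfl
            · exact h11 1
            · exact ⟨1, by simp, hone⟩
        exact ⟨dih w⁻¹ 1 1, n, hn, by rw [← hS', this]; simp⟩
      · have : S' = axial n Qd 1 := by
          refine eq_axial hle hA ?_ ?_
          · intro z s t hz
            rcases Int.units_eq_one_or s with rfl | rfl
            · exact (hs1 z t hz).symm
            · exact (hs2 z t hz).symm
          · intro s t h
            obtain rfl : s = t := h
            rcases Int.units_eq_one_or s with rfl | rfl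
            · exact h11 1
            · exact ⟨1, by simp, hone⟩
        exact ⟨dih w⁻¹ 1 1, n, hn, by rw [← hS', this]; simp⟩
  · have hs : ∀ z s t, dih z s t ∈ S → s = 1 := by
      intro z s t hz
      rcases Int.units_eq_one_or s with rfl | rfl
      · rfl
      · exact absurd ⟨z, t, hz⟩ hrefl
    obtain ⟨n, hn, hA⟩ := exists_rot_order S
    have h11 : ∀ χ : ℤˣ × ℤˣ →* ℤˣ, ∃ z : Circle, z ^ n = sgnC (χ (1, 1)) ∧ dih z 1 1 ∈ S :=
      fun χ => ⟨1, by rw [show ((1 : ℤˣ), (1 : ℤˣ)) = 1 from rfl]; simp,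
        by rw [dih_one]; exact one_mem _⟩
    refine ⟨1, n, hn, ?_⟩
    rw [conj_one]
    by_cases hh : ∃ z, dih z 1 (-1) ∈ S
    · obtain ⟨z₀, hz₀⟩ := hh
      have h2 : z₀ ^ (2 * n) = 1 := by
        rw [pow_mul, ← hA, ← dih_rot_mul_self z₀ (-1)]
        exact mul_mem hz₀ hz₀
      obtain ⟨u, hu⟩ := pow_eq_sgnC h2
      have hrep : ∀ χ : ℤˣ × ℤˣ →* ℤˣ, χ (1, -1) = u → S = axial n Qh χ := by
        intro χ h1
        refine eq_axial hS hA (fun z s t h => hs z s t h) ?_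
        rintro s t rfl
        rcases Int.units_eq_one_or t with rfl | rfl
        · exact h11 χ
        · exact ⟨z₀, by rw [hu, h1], hz₀⟩
      rcases Int.units_eq_one_or u with rfl | rfl
      · exact Or.inr (Or.inl (hrep 1 rfl))
      · exact Or.inr (Or.inr (Or.inl (hrep _ rfl)))
    · left
      refine eq_axial hS hA ?_ ?_
      · intro z s t hz
        obtain rfl := hs z s t hz
        rcases Int.units_eq_one_or t with rfl | rfl
        · exact one_mem _
        · exact absurd ⟨z, hz⟩ hh
      · intro s t h
        obtain ⟨rfl, rfl⟩ := mem_Qbot.1 h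
        exact h11 1

/-! ### Axial groups of small order -/

/-- The diagonal matrices with entries `±1`. -/
noncomputable def diag3 (a b c : ℤˣ) : O3 := dih (sgnC a) (a * b) c

/-- The reflection that interchanges the `x`-axis and the `z`-axis. -/
noncomputable def swapXZ : O3 :=
  ⟨!![0, 0, 1; 0, 1, 0; 1, 0, 0], by
    rw [Matrix.mem_orthogonalGroup_iff]
    ext i j
    fin_cases i <;> fin_cases j <;> simp [Matrix.mul_apply, Fin.sum_univ_three]⟩

/-- The reflection that interchanges the `y`-axis and the `z`-axis. -/
noncomputable def swapYZ : O3 :=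
  ⟨!![1, 0, 0; 0, 0, 1; 0, 1, 0], by
    rw [Matrix.mem_orthogonalGroup_iff]
    ext i j
    fin_cases i <;> fin_cases j <;> simp [Matrix.mul_apply, Fin.sum_univ_three]⟩

theorem diag3_val (a b c : ℤˣ) :
    (diag3 a b c).1 = !![sgnR a, 0, 0; 0, sgnR b, 0; 0, 0, sgnR c] := by
  rw [diag3, dih_val]
  rcases Int.units_eq_one_or a with rfl | rfl <;> rcases Int.units_eq_one_or b with rfl | rfl <;>
    simp

theorem swapXZ_conj (a b c : ℤˣ) : swapXZ * diag3 a b c * swapXZ⁻¹ = diag3 c b a := by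
  rw [mul_inv_eq_iff_eq_mul]
  apply Subtype.ext
  rw [Submonoid.coe_mul, Submonoid.coe_mul, diag3_val, diag3_val]
  ext i j
  fin_cases i <;> fin_cases j <;> simp [swapXZ, Matrix.mul_apply, Fin.sum_univ_three]

theorem swapYZ_conj (a b c : ℤˣ) : swapYZ * diag3 a b c * swapYZ⁻¹ = diag3 a c b := by
  rw [mul_inv_eq_iff_eq_mul]
  apply Subtype.ext
  rw [Submonoid.coe_mul, Submonoid.coe_mul, diag3_val, diag3_val]
  ext i j
  fin_cases i <;> fin_cases j <;> simp [swapYZ, Matrix.mul_apply, Fin.sum_univ_three]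

/-- For small n the axial groups consist of diagonal sign matrices, and interchanging two
coordinates identifies different families: D_1 with C_2, C_{1v} with C_s, D_{1h} with C_{2v}, D_{1d}
with C_{2h}. -/
theorem conj_eq_of_diag {g : O3} {S T : Subgroup O3}
    (hS : ∀ x ∈ S, ∃ a b c, x = diag3 a b c ∧ g * diag3 a b c * g⁻¹ ∈ T)
    (hT : ∀ y ∈ T, ∃ a b c, diag3 a b c ∈ S ∧ y = g * diag3 a b c * g⁻¹) : AreConj S T := by
  refine ⟨g, le_antisymm ?_ ?_⟩
  · intro y hy
    obtain ⟨a, b, c, h, rfl⟩ := hT y hy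
    exact conj_mem_conj h
  · rintro _ ⟨x, hx, rfl⟩
    obtain ⟨a, b, c, rfl, h⟩ := hS x hx
    exact h

theorem sq_eq_one_iff_sgnC {z : Circle} : z ^ 2 = 1 ↔ ∃ u, z = sgnC u := by
  constructor
  · intro h
    obtain ⟨u, hu⟩ := pow_eq_sgnC (z := z) (n := 1) (by simpa using h)
    exact ⟨u, by simpa using hu⟩
  · rintro ⟨u, rfl⟩
    rw [sq, sgnC_mul_self]

theorem diag3_mem_axial {n : ℕ} {Q : Subgroup (ℤˣ × ℤˣ)} {χ : ℤˣ × ℤˣ →* ℤˣ} {a b c : ℤˣ} :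
    diag3 a b c ∈ axial n Q χ ↔ (a * b, c) ∈ Q ∧ sgnC a ^ n = sgnC (χ (a * b, c)) :=
  dih_mem_axial

theorem units_mul_self_mul (a b : ℤˣ) : a * (a * b) = b := by
  rw [← mul_assoc, Int.units_mul_self, one_mul]

theorem dih_sgnC (u s t : ℤˣ) : dih (sgnC u) s t = diag3 u (u * s) t := by
  rw [diag3, units_mul_self_mul]

theorem areConj_C2_D1 : AreConj (axial 2 ⊥ 1) (axial 1 Qd 1) := by
  refine conj_eq_of_diag (g := swapXZ) ?_ ?_
  · rintro _ ⟨z, s, t, rfl, h, hz⟩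
    obtain ⟨rfl, rfl⟩ := mem_Qbot.1 h
    obtain ⟨u, rfl⟩ := sq_eq_one_iff_sgnC.1 (by simpa using hz)
    refine ⟨_, _, _, dih_sgnC u _ _, ?_⟩
    rw [swapXZ_conj, diag3_mem_axial]
    simp
  · rintro _ ⟨z, s, t, rfl, h, hz⟩
    obtain rfl : s = t := h
    obtain rfl : z = 1 := by simpa using hz
    refine ⟨s, s, 1, ?_, ?_⟩
    · rw [diag3_mem_axial, mem_Qbot]
      simp [sq_eq_one_iff_sgnC]
    · rw [swapXZ_conj, diag3]
      simp

theorem areConj_Cs_C1v : AreConj (axial 1 Qh 1) (axial 1 Qv 1) := by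
  refine conj_eq_of_diag (g := swapYZ) ?_ ?_
  · rintro _ ⟨z, s, t, rfl, rfl, hz⟩
    obtain rfl : z = 1 := by simpa using hz
    refine ⟨1, 1, t, by simp [diag3], ?_⟩
    rw [swapYZ_conj, diag3_mem_axial]
    simp
  · rintro _ ⟨z, s, t, rfl, rfl, hz⟩
    obtain rfl : z = 1 := by simpa using hz
    refine ⟨1, 1, s, ?_, ?_⟩
    · rw [diag3_mem_axial]
      simp
    · rw [swapYZ_conj, diag3]
      simp

theorem areConj_C2v_D1h : AreConj (axial 2 Qv 1) (axial 1 ⊤ 1) := by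
  refine conj_eq_of_diag (g := swapXZ) ?_ ?_
  · rintro _ ⟨z, s, t, rfl, rfl, hz⟩
    obtain ⟨u, rfl⟩ := sq_eq_one_iff_sgnC.1 (by simpa using hz)
    refine ⟨_, _, _, dih_sgnC u _ _, ?_⟩
    rw [swapXZ_conj, diag3_mem_axial]
    simp
  · rintro _ ⟨z, s, t, rfl, -, hz⟩
    obtain rfl : z = 1 := by simpa using hz
    refine ⟨t, s, 1, ?_, ?_⟩
    · rw [diag3_mem_axial]
      simp [sq_eq_one_iff_sgnC]
    · rw [swapXZ_conj, diag3]
      simp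

theorem areConj_C2h_D1d : AreConj (axial 2 Qh 1) (axial 1 ⊤ (MonoidHom.snd ℤˣ ℤˣ)) := by
  refine conj_eq_of_diag (g := swapYZ) ?_ ?_
  · rintro _ ⟨z, s, t, rfl, rfl, hz⟩
    obtain ⟨u, rfl⟩ := sq_eq_one_iff_sgnC.1 (by simpa using hz)
    refine ⟨_, _, _, dih_sgnC u _ _, ?_⟩
    rw [swapYZ_conj, diag3_mem_axial]
    simp
  · rintro _ ⟨z, s, t, rfl, -, hz⟩
    obtain rfl : z = sgnC t := by simpa using hz
    refine ⟨t, t, t * s, ?_, ?_⟩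
    · rw [diag3_mem_axial]
      simp [sq_eq_one_iff_sgnC]
    · rw [swapYZ_conj, diag3]
      simp [units_mul_self_mul]

/-! ### The list of point groups -/

/-- `S` is conjugate to a group in the tables or to a group with normalizer `D_{∞h}`. -/
def Listed (S : Subgroup O3) : Prop :=
  (∃ (g : O3) (N S₀ S₁ H₀ H₁ : Subgroup O3), ComplementTable N S₀ S₁ H₀ H₁ ∧ S = conj g S₁) ∨
    AreConj Cs S ∨
      ∃ n : ℕ, 2 ≤ n ∧ (AreConj (Cn n) S ∨ AreConj (S2n n) S ∨ AreConj (Cnh n) S)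

theorem Listed.of_areConj {S T : Subgroup O3} (hS : Listed S) (h : AreConj S T) : Listed T := by
  rcases hS with ⟨g, N, S₀, S₁, H₀, H₁, ht, rfl⟩ | hS | ⟨n, hn, hS⟩
  · obtain ⟨k, rfl⟩ := h
    exact Or.inl ⟨k * g, N, S₀, S₁, H₀, H₁, ht, conj_conj k g S₁⟩
  · exact Or.inr (Or.inl (hS.trans h))
  · exact Or.inr (Or.inr ⟨n, hn, hS.imp (·.trans h) (Or.imp (·.trans h) (·.trans h))⟩)

theorem Listed.of_table {N S₀ S₁ H₀ H₁ : Subgroup O3} (h : ComplementTable N S₀ S₁ H₀ H₁) :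
    Listed S₁ :=
  Or.inl ⟨1, N, S₀, S₁, H₀, H₁, h, (conj_one S₁).symm⟩

theorem rotX_mul (α β : ℝ) : rotX α * rotX β = rotX (α + β) := by
  apply Subtype.ext
  rw [Submonoid.coe_mul]
  ext i j
  fin_cases i <;> fin_cases j <;>
    simp [rotX, Matrix.mul_apply, Fin.sum_univ_three, Real.cos_add, Real.sin_add] <;> ring

theorem aO_sq : aO ^ 2 = dih (-1) 1 1 := by
  rw [aO, rotZ_eq, dih_rot_pow]
  congr 1
  exact_mod_cast exp_half_pow 2 (by norm_num)

theorem bO_sq : bO ^ 2 = dih 1 (-1) (-1) := by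
  rw [bO, sq, rotX_mul, add_halves, rotX_pi_eq]

theorem closure_D2 : Subgroup.closure {aO ^ 2, bO ^ 2} = Dn 2 := by
  rw [Dn, aO_sq, bO_sq, rotX_pi_eq, rotZ_eq]
  congr 4
  rw [← exp_pi]
  congr 1
  push_cast
  ring

theorem closure_D2h : Subgroup.closure {aO ^ 2, bO ^ 2, inversion} = Dnh 2 := by
  have h1 : ∀ g ∈ Dn 2, g ∈ Subgroup.closure {aO ^ 2, bO ^ 2, inversion} := by
    rw [← closure_D2]
    intro g hg
    refine Subgroup.closure_mono ?_ hg
    rintro x (rfl | rfl)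
    · exact Or.inl rfl
    · exact Or.inr (Or.inl rfl)
  rw [Dn_eq (by norm_num)] at h1
  rw [Dnh_eq (by norm_num)]
  apply le_antisymm
  · rw [Subgroup.closure_le]
    rintro _ (rfl | rfl | rfl)
    · rw [aO_sq, SetLike.mem_coe, dih_mem_axial]; simp
    · rw [bO_sq, SetLike.mem_coe, dih_mem_axial]; simp
    · rw [inversion_eq, SetLike.mem_coe, dih_mem_axial]; simp
  · rintro _ ⟨z, s, t, rfl, -, hz⟩
    have hz' : z ^ 2 = 1 := by simpa using hz
    rcases units_eq_or_eq_neg t s with rfl | rfl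
    · exact h1 _ (dih_mem_axial.2 (by simp [hz']))
    · have h2 := h1 (dih (-z) s s) (dih_mem_axial.2 (by simp [hz']))
      have h3 : dih z s (-s) = dih (-z) s s * inversion := by
        rw [inversion_eq, dih_mul]
        rcases Int.units_eq_one_or s with rfl | rfl <;> simp
      rw [h3]
      exact mul_mem h2 (Subgroup.subset_closure (Or.inr (Or.inr rfl)))

theorem axial_one_bot : axial 1 ⊥ 1 = ⊥ := by
  rw [eq_bot_iff]
  rintro _ ⟨z, s, t, rfl, h, hz⟩
  obtain ⟨rfl, rfl⟩ := mem_Qbot.1 h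
  obtain rfl : z = 1 := by simpa using hz
  exact dih_one

theorem Cs_eq : Cs = axial 1 Qh 1 := by
  ext g
  rw [mem_Cs, ← dih_one, reflXY_eq]
  constructor
  · rintro (rfl | rfl) <;> rw [dih_mem_axial] <;> simp
  · rintro ⟨z, s, t, rfl, rfl, hz⟩
    obtain rfl : z = 1 := by simpa using hz
    rcases Int.units_eq_one_or t with rfl | rfl <;> simp

theorem Ci_eq : Ci = axial 1 Qh (MonoidHom.snd ℤˣ ℤˣ) := by
  ext g
  rw [mem_Ci, ← dih_one, inversion_eq]
  constructor
  · rintro (rfl | rfl) <;> rw [dih_mem_axial] <;> simp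
  · rintro ⟨z, s, t, rfl, rfl, hz⟩
    obtain rfl : z = sgnC t := by simpa using hz
    rcases Int.units_eq_one_or t with rfl | rfl <;> simp

/-- Each family has its own row or its own entry under D_{∞h} from n = 2 or 3 on. The smaller n give
1, C_s, C_i, D_2 and D_{2h}, or coincide with a member of another family. -/
theorem listed_of_le_Dinfh {S : Subgroup O3} [Finite S] (hS : S ≤ Dinfh) : Listed S := by
  obtain ⟨g, n, hn, h⟩ := exists_conj_eq_axial hS
  suffices Listed (conj g S) from this.of_areConj (AreConj.symm ⟨g, rfl⟩)
  have hn' : n = 1 ∨ 2 ≤ n := by omega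
  have hn'' : n = 1 ∨ n = 2 ∨ 3 ≤ n := by omega
  rcases h with h | h | h | h | h | h | h <;> rw [h]
  · rcases hn' with rfl | hn'
    · rw [axial_one_bot]
      exact Listed.of_table .row_one
    · exact Or.inr (Or.inr ⟨n, hn', Or.inl (by rw [Cn_eq hn]; exact AreConj.refl _)⟩)
  · rcases hn' with rfl | hn'
    · rw [← Cs_eq]
      exact Or.inr (Or.inl (AreConj.refl _))
    · exact Or.inr (Or.inr ⟨n, hn', Or.inr (Or.inr (by rw [Cnh_eq hn]; exact AreConj.refl _))⟩)
  · rcases hn' with rfl | hn'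
    · rw [← Ci_eq]
      exact Listed.of_table .row_Ci
    · exact Or.inr (Or.inr ⟨n, hn', Or.inr (Or.inl (by rw [S2n_eq hn]; exact AreConj.refl _))⟩)
  · rcases hn'' with rfl | rfl | hn''
    · refine Or.inr (Or.inr ⟨2, le_rfl, Or.inl ?_⟩)
      rw [Cn_eq (by norm_num)]
      exact areConj_C2_D1
    · rw [← Dn_eq hn, ← closure_D2]
      exact Listed.of_table .row_D2
    · rw [← closure_Dn hn]
      exact Listed.of_table (.row_Dn n hn'')
  · rcases hn' with rfl | hn'
    · refine Or.inr (Or.inl ?_)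
      rw [Cs_eq]
      exact areConj_Cs_C1v
    · rw [← closure_Cnv hn]
      exact Listed.of_table (.row_Cnv n hn')
  · rcases hn'' with rfl | rfl | hn''
    · refine Listed.of_areConj ?_ areConj_C2v_D1h
      rw [← closure_Cnv (by norm_num)]
      exact Listed.of_table (.row_Cnv 2 le_rfl)
    · rw [← Dnh_eq hn, ← closure_D2h]
      exact Listed.of_table .row_D2h
    · rw [← closure_Dnh hn]
      exact Listed.of_table (.row_Dnh n hn'')
  · rcases hn' with rfl | hn'
    · refine Or.inr (Or.inr ⟨2, le_rfl, Or.inr (Or.inr ?_)⟩)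
      rw [Cnh_eq (by norm_num)]
      exact areConj_C2h_D1d
    · rw [← closure_Dnd hn]
      exact Listed.of_table (.row_Dnd n hn')

end PointGroup

namespace PointGroup

/-! ### The symmetry group of the cube -/

theorem mem_symmetryGroup {V : Set (Fin 3 → ℝ)} {g : O3} :
    g ∈ symmetryGroup V ↔ ∀ v, g • v ∈ V ↔ v ∈ V := Iff.rfl

/-- `x` permutes the coordinate axes by `π`. -/
def PermutesAxes (x : O3) (π : Equiv.Perm (Fin 3)) : Prop :=
  ∀ (v : Fin 3 → ℝ) (i : Fin 3), (x • v) i ^ 2 = v (π⁻¹ i) ^ 2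

theorem PermutesAxes.mul {x y : O3} {π ρ : Equiv.Perm (Fin 3)} (hx : PermutesAxes x π)
    (hy : PermutesAxes y ρ) : PermutesAxes (x * y) (π * ρ) := by
  intro v i
  rw [mul_smul, hx, hy, mul_inv_rev]
  rfl

theorem permutesAxes_one : PermutesAxes 1 1 := by
  intro v i
  simp

theorem PermutesAxes.inv {x : O3} {π : Equiv.Perm (Fin 3)} (hx : PermutesAxes x π) :
    PermutesAxes x⁻¹ π⁻¹ := by
  intro v i
  have := hx (x⁻¹ • v) (π i)
  rw [smul_inv_smul, show π⁻¹ (π i) = i from π.symm_apply_apply i] at this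
  rw [← this, inv_inv]

theorem PermutesAxes.unique {x : O3} {π ρ : Equiv.Perm (Fin 3)} (hx : PermutesAxes x π)
    (hy : PermutesAxes x ρ) : π = ρ := by
  rw [← inv_inj]
  ext1 i
  by_contra hne
  have := (hx (Pi.single (π⁻¹ i) 1) i).symm.trans (hy (Pi.single (π⁻¹ i) 1) i)
  rw [Pi.single_eq_same, Pi.single_eq_of_ne (Ne.symm hne)] at this
  norm_num at this

theorem apply_single (x : O3) (i j : Fin 3) : (x • (Pi.single j 1 : Fin 3 → ℝ)) i = x.1 i j := by
  rw [vec_smul_def, Matrix.mulVec_single_one]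
  rfl

theorem diag3_smul (a b c : ℤˣ) (v : Fin 3 → ℝ) :
    diag3 a b c • v = ![sgnR a * v 0, sgnR b * v 1, sgnR c * v 2] := by
  rw [vec_smul_def, diag3_val]
  ext i
  fin_cases i <;> simp [Matrix.mulVec, dotProduct, Fin.sum_univ_three]

theorem permutesAxes_one_iff {x : O3} : PermutesAxes x 1 ↔ ∃ a b c, x = diag3 a b c := by
  constructor
  · intro h
    have hd : ∀ i, ∃ s : ℤˣ, x.1 i i = sgnR s := by
      intro i
      have := h (Pi.single i 1) i
      rw [apply_single] at this
      rw [show (1⁻¹ : Equiv.Perm (Fin 3)) i = i from rfl, Pi.single_eq_same, one_pow, sq] at this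
      rcases mul_self_eq_one_iff.1 this with h | h
      · exact ⟨1, by simp [h]⟩
      · exact ⟨-1, by simp [h]⟩
    have ho : ∀ i j, i ≠ j → x.1 i j = 0 := by
      intro i j hij
      have := h (Pi.single j 1) i
      rw [apply_single, show (1⁻¹ : Equiv.Perm (Fin 3)) i = i from rfl,
        Pi.single_eq_of_ne hij] at this
      simpa using this
    obtain ⟨a, ha⟩ := hd 0
    obtain ⟨b, hb⟩ := hd 1
    obtain ⟨c, hc⟩ := hd 2
    refine ⟨a, b, c, Subtype.ext ?_⟩
    rw [diag3_val]
    ext i j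
    fin_cases i <;> fin_cases j <;> simp [ha, hb, hc, ho]
  · rintro ⟨a, b, c, rfl⟩ v i
    have h : ∀ s : ℤˣ, sgnR s ^ 2 = 1 := fun s => by rw [sq, sgnR_mul_self]
    rw [diag3_smul]
    fin_cases i <;> simp [mul_pow, h]

/-- Permutation matrices. -/
noncomputable def permO (π : Equiv.Perm (Fin 3)) : O3 :=
  ⟨π⁻¹.permMatrix ℝ, by
    rw [Matrix.mem_orthogonalGroup_iff]
    change π⁻¹.permMatrix ℝ * (π⁻¹.permMatrix ℝ).transpose = 1
    rw [Matrix.transpose_permMatrix, ← Matrix.permMatrix_mul]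
    simp⟩

theorem permO_smul (π : Equiv.Perm (Fin 3)) (v : Fin 3 → ℝ) (i : Fin 3) :
    (permO π • v) i = v (π⁻¹ i) := by
  rw [vec_smul_def, permO, Matrix.permMatrix_mulVec]
  rfl

theorem permutesAxes_permO (π : Equiv.Perm (Fin 3)) : PermutesAxes (permO π) π := by
  intro v i
  rw [permO_smul]

theorem det_permO (π : Equiv.Perm (Fin 3)) : (permO π).1.det = sgnR (Equiv.Perm.sign π) := by
  rw [permO, Matrix.det_permutation, Equiv.Perm.sign_inv, sgnR]

theorem det_diag3 (a b c : ℤˣ) : (diag3 a b c).1.det = sgnR (a * b * c) := by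
  rw [diag3, det_dih, sgnR_mul (a * b)]

theorem mem_cube_iff_sq {v : Fin 3 → ℝ} : v ∈ cube ↔ ∀ i, v i ^ 2 = 1 := by
  simp only [cube, Set.mem_ofPred_eq, sq, mul_self_eq_one_iff]

theorem PermutesAxes.mem_Oh {x : O3} {π : Equiv.Perm (Fin 3)} (h : PermutesAxes x π) :
    x ∈ Oh := by
  rw [Oh, mem_symmetryGroup]
  intro v
  rw [mem_cube_iff_sq, mem_cube_iff_sq]
  simp only [h v]
  exact ⟨fun H i => by simpa using H (π i), fun H i => H _⟩

/-- Columns of unit length with at most one nonzero entry have an entry ±1, and orthogonality of the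
columns puts these entries in different rows. -/
theorem exists_permutesAxes_of_column {x : O3} (h : ∀ j, ∃ i, ∀ k, k ≠ i → x.1 k j = 0) :
    ∃ π, PermutesAxes x π := by
  choose f hf using h
  have hcol : ∀ j j', x.1 (f j) j * x.1 (f j) j' = if j = j' then 1 else 0 := by
    intro j j'
    have h1 := congrFun (congrFun (transpose_mul_self x) j) j'
    rw [Matrix.mul_apply, Finset.sum_eq_single (f j), Matrix.transpose_apply, Matrix.one_apply]
      at h1
    · exact h1
    · intro k _ hk
      rw [Matrix.transpose_apply, hf j k hk, zero_mul]
    · simp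
  have hinj : Function.Injective f := by
    intro j j' hjj
    by_contra hne
    have h1 := hcol j j'
    have h2 := hcol j j
    have h3 := hcol j' j'
    rw [← hjj] at h3
    rw [if_neg hne] at h1
    rw [if_pos rfl] at h2 h3
    rcases mul_eq_zero.1 h1 with h | h
    · rw [h] at h2; norm_num at h2
    · rw [h] at h3; norm_num at h3
  set π := Equiv.ofBijective f (Finite.injective_iff_bijective.1 hinj) with hπ
  have hπf : ∀ j, π j = f j := fun j => rfl
  refine ⟨π, fun v i => ?_⟩
  have hsum : (x • v) i = x.1 i (π⁻¹ i) * v (π⁻¹ i) := by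
    rw [vec_smul_def, Matrix.mulVec, dotProduct, Finset.sum_eq_single (π⁻¹ i)]
    · intro j _ hj
      rw [hf j i, zero_mul]
      intro hij
      apply hj
      rw [Equiv.Perm.eq_inv_iff_eq, hπf, ← hij]
    · simp
  have h1 := hcol (π⁻¹ i) (π⁻¹ i)
  rw [← hπf, show π (π⁻¹ i) = i from π.apply_symm_apply i, if_pos rfl] at h1
  rw [hsum, mul_pow, sq, h1, one_mul]

theorem mem_Oh {x : O3} : x ∈ Oh ↔ ∃ π, PermutesAxes x π := by
  refine ⟨fun hx => ?_, fun ⟨π, h⟩ => h.mem_Oh⟩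
  apply exists_permutesAxes_of_column
  intro j
  -- The images of (1, 1, 1) and of the vertex with coordinate `j` flipped differ by twice column
  -- `j`, and both have entries ±1. Hence the entries of the column are 0 or ±1, and its norm leaves
  -- exactly one nonzero entry.
  have hent : ∀ i, x.1 i j = 0 ∨ x.1 i j ^ 2 = 1 := by
    intro i
    have h1 : (1 : Fin 3 → ℝ) ∈ cube := fun i => Or.inl rfl
    have h2 : (1 - (2 : ℝ) • Pi.single j 1 : Fin 3 → ℝ) ∈ cube := by
      intro k
      by_cases hk : k = j
      · subst hk
        right
        simp
        norm_num
      · left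
        simp [hk]
    have h3 := ((mem_symmetryGroup.1 hx) _).2 h1 i
    have h4 := ((mem_symmetryGroup.1 hx) _).2 h2 i
    have h5 : (x • (1 - (2 : ℝ) • Pi.single j 1 : Fin 3 → ℝ)) i
        = (x • (1 : Fin 3 → ℝ)) i - 2 * x.1 i j := by
      rw [sub_eq_add_neg, vec_smul_add, vec_smul_neg, vec_smul_smul, ← apply_single]
      simp [sub_eq_add_neg]
    rw [h5] at h4
    rcases h3 with h3 | h3 <;> rcases h4 with h4 | h4 <;> rw [h3] at h4
    · left; linarith
    · right
      have : x.1 i j = 1 := by linarith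
      rw [this]; norm_num
    · right
      have : x.1 i j = -1 := by linarith
      rw [this]; norm_num
    · left; linarith
  have hnorm : x.1 0 j ^ 2 + x.1 1 j ^ 2 + x.1 2 j ^ 2 = 1 := by
    have h1 := congrFun (congrFun (transpose_mul_self x) j) j
    rw [Matrix.mul_apply, Fin.sum_univ_three] at h1
    simpa [sq] using h1
  have h0 := sq_nonneg (x.1 0 j)
  have h1 := sq_nonneg (x.1 1 j)
  have h2 := sq_nonneg (x.1 2 j)
  rcases hent 0 with e0 | e0
  · rcases hent 1 with e1 | e1
    · exact ⟨2, fun k hk => by fin_cases k <;> simp_all⟩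
    · have e2 : x.1 2 j = 0 := by nlinarith
      exact ⟨1, fun k hk => by fin_cases k <;> simp_all⟩
  · have e1 : x.1 1 j = 0 := by nlinarith
    have e2 : x.1 2 j = 0 := by nlinarith
    exact ⟨0, fun k hk => by fin_cases k <;> simp_all⟩

/-- The elements of `O_h` are the signed permutation matrices. -/
theorem exists_diag3_mul_permO {x : O3} (hx : x ∈ Oh) : ∃ a b c π, x = diag3 a b c * permO π := by
  obtain ⟨π, hπ⟩ := mem_Oh.1 hx
  have h := hπ.mul (permutesAxes_permO π).inv
  rw [mul_inv_cancel, permutesAxes_one_iff] at h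
  obtain ⟨a, b, c, h⟩ := h
  exact ⟨a, b, c, π, mul_inv_eq_iff_eq_mul.1 h⟩

/-! ### The tetrahedral groups inside O_h. -/

theorem inversion_mem_Oh : inversion ∈ Oh := by
  rw [Oh, mem_symmetryGroup]
  intro v
  rw [mem_cube_iff_sq, mem_cube_iff_sq, inversion_smul]
  simp

theorem neg_mem_cube {v : Fin 3 → ℝ} : -v ∈ cube ↔ v ∈ cube := by
  rw [mem_cube_iff_sq, mem_cube_iff_sq]
  simp

theorem mem_cube_iff {v : Fin 3 → ℝ} : v ∈ cube ↔ v ∈ tetrahedron ∨ -v ∈ tetrahedron := by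
  constructor
  · intro h
    have h' := mem_cube_iff_sq.1 h
    have h2 : (v 0 * v 1 * v 2) * (v 0 * v 1 * v 2) = 1 := by
      have e : (v 0 * v 1 * v 2) * (v 0 * v 1 * v 2) = v 0 ^ 2 * v 1 ^ 2 * v 2 ^ 2 := by ring
      rw [e, h', h', h']
      norm_num
    rcases mul_self_eq_one_iff.1 h2 with h2 | h2
    · exact Or.inl ⟨h, h2⟩
    · refine Or.inr ⟨neg_mem_cube.2 h, ?_⟩
      simp [h2]
  · rintro (h | h)
    · exact h.1
    · exact neg_mem_cube.1 h.1

theorem Td_le_Oh : Td ≤ Oh := by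
  have key : ∀ g ∈ Td, ∀ v, v ∈ cube → g • v ∈ cube := by
    intro g hg v hv
    rw [mem_cube_iff] at hv ⊢
    exact hv.imp (mem_symmetryGroup.1 hg v).2
      fun h => by rw [← vec_smul_neg]; exact (mem_symmetryGroup.1 hg _).2 h
  intro g hg
  rw [Oh, mem_symmetryGroup]
  refine fun v => ⟨fun h => ?_, key g hg v⟩
  have := key _ (inv_mem hg) _ h
  rwa [inv_smul_smul] at this

theorem permO_mem_Td (π : Equiv.Perm (Fin 3)) : permO π ∈ Td := by
  have hprod : ∀ v : Fin 3 → ℝ, v 0 * v 1 * v 2 = ∏ i, v i := fun v => by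
    rw [Fin.prod_univ_three]
  rw [Td, mem_symmetryGroup]
  intro v
  rw [tetrahedron, Set.mem_ofPred_eq, Set.mem_ofPred_eq, hprod, hprod,
    mem_symmetryGroup.1 (permutesAxes_permO π).mem_Oh]
  simp only [permO_smul]
  rw [Equiv.prod_comp (π⁻¹) v]

theorem diag3_mem_Oh (a b c : ℤˣ) : diag3 a b c ∈ Oh :=
  (permutesAxes_one_iff.2 ⟨a, b, c, rfl⟩).mem_Oh

theorem diag3_mem_Td {a b c : ℤˣ} : diag3 a b c ∈ Td ↔ a * b * c = 1 := by
  have hprod : ∀ v : Fin 3 → ℝ, (diag3 a b c • v) 0 * (diag3 a b c • v) 1 * (diag3 a b c • v) 2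
      = sgnR (a * b * c) * (v 0 * v 1 * v 2) := by
    intro v
    rw [diag3_smul, sgnR_mul, sgnR_mul]
    simp
    ring
  constructor
  · intro h
    have h1 : (1 : Fin 3 → ℝ) ∈ tetrahedron := ⟨fun i => Or.inl rfl, by simp⟩
    have h2 := ((mem_symmetryGroup.1 h 1).2 h1).2
    rw [hprod] at h2
    apply sgnR_injective
    simpa using h2
  · intro h
    rw [Td, mem_symmetryGroup]
    intro v
    rw [tetrahedron, Set.mem_ofPred_eq, Set.mem_ofPred_eq, hprod, h,
      mem_symmetryGroup.1 (diag3_mem_Oh a b c)]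
    simp

theorem inversion_mul_diag3 (a b c : ℤˣ) : inversion * diag3 a b c = diag3 (-a) (-b) (-c) := by
  apply ext_vec_smul
  intro v
  have h : ∀ s : ℤˣ, sgnR (-s) = -sgnR s := fun s => by
    rcases Int.units_eq_one_or s with rfl | rfl <;> simp
  rw [mul_smul, inversion_smul, diag3_smul, diag3_smul]
  ext i
  fin_cases i <;> simp [h]

theorem inversion_eq_diag3 : inversion = diag3 (-1) (-1) (-1) := by
  rw [inversion_eq, diag3]
  simp

theorem inversion_notMem_Td : inversion ∉ Td := by
  rw [inversion_eq_diag3, diag3_mem_Td]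
  decide

/-- Permutation matrices preserve the tetrahedron, so for a signed permutation matrix only the
product of the signs matters, and the inversion flips that product. -/
theorem mem_Td_or {x : O3} (hx : x ∈ Oh) : x ∈ Td ∨ inversion * x ∈ Td := by
  obtain ⟨a, b, c, π, rfl⟩ := exists_diag3_mul_permO hx
  rw [← mul_assoc, inversion_mul_diag3, Subgroup.mul_mem_cancel_right _ (permO_mem_Td π),
    Subgroup.mul_mem_cancel_right _ (permO_mem_Td π), diag3_mem_Td, diag3_mem_Td]
  rcases Int.units_eq_one_or (a * b * c) with h | h
  · exact Or.inl h
  · right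
    simp [h]

theorem T_le_Oh : T ≤ Oh := inf_le_left.trans Td_le_Oh

theorem inversion_mul_mul (x y : O3) : inversion * x * (inversion * y) = x * y := by
  rw [inversion_comm x, mul_assoc, ← mul_assoc inversion, inversion_mul_inversion, one_mul]

theorem inversion_mul_cube (x : O3) :
    inversion * x * (inversion * x) * (inversion * x) = inversion * (x * x * x) := by
  rw [inversion_mul_mul, ← mul_assoc, ← inversion_comm, mul_assoc]

/-- An element of order three lies in every subgroup of index two. In the present form: if x missed
SO(3) or T_d, then the cube of `inversion * x`, which is the inversion, would lie there. -/
theorem mem_T_of_cube {x : O3} (hx : x ∈ Oh) (h3 : x * x * x = 1) : x ∈ T := by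
  have hdet : x ∈ SO3 := by
    by_contra h
    have h1 := inversion_mul_mem_SO3 h
    have h2 := mul_mem (mul_mem h1 h1) h1
    rw [inversion_mul_cube, h3, mul_one] at h2
    exact inversion_notMem_SO3 h2
  refine ⟨?_, hdet⟩
  rcases mem_Td_or hx with h | h
  · exact h
  · exfalso
    have h2 := mul_mem (mul_mem h h) h
    rw [inversion_mul_cube, h3, mul_one] at h2
    exact inversion_notMem_Td h2

/-! ### D_2 and D_{2h} as groups of diagonal matrices. -/

theorem mem_Dnh_two {x : O3} : x ∈ Dnh 2 ↔ PermutesAxes x 1 := by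
  rw [Dnh_eq (by norm_num), permutesAxes_one_iff]
  constructor
  · rintro ⟨z, s, t, rfl, -, hz⟩
    obtain ⟨u, rfl⟩ := sq_eq_one_iff_sgnC.1 (by simpa using hz)
    exact ⟨_, _, _, dih_sgnC u s t⟩
  · rintro ⟨a, b, c, rfl⟩
    rw [diag3_mem_axial]
    simp [sq_eq_one_iff_sgnC]

theorem mem_Dn_two {x : O3} : x ∈ Dn 2 ↔ PermutesAxes x 1 ∧ x ∈ SO3 := by
  rw [← mem_Dnh_two, Dn_eq (by norm_num), Dnh_eq (by norm_num)]
  constructor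
  · rintro ⟨z, s, t, rfl, h, hz⟩
    exact ⟨⟨z, s, t, rfl, trivial, hz⟩, dih_mem_SO3.2 h⟩
  · rintro ⟨⟨z, s, t, rfl, -, hz⟩, h⟩
    exact ⟨z, s, t, rfl, dih_mem_SO3.1 h, hz⟩

theorem diag3_mem_SO3 {a b c : ℤˣ} : diag3 a b c ∈ SO3 ↔ a * b * c = 1 := by
  rw [mem_SO3, det_diag3]
  exact ⟨fun h => sgnR_injective (by simpa using h), fun h => by simp [h]⟩

theorem Dn_two_le_T : Dn 2 ≤ T := by
  intro x hx
  obtain ⟨h, hdet⟩ := mem_Dn_two.1 hx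
  obtain ⟨a, b, c, rfl⟩ := permutesAxes_one_iff.1 h
  exact ⟨diag3_mem_Td.2 (diag3_mem_SO3.1 hdet), hdet⟩

/-- For a signed permutation matrix in T the product of the signs is 1, by membership in T_d. The
determinant is this product times the sign of the permutation. -/
theorem sign_of_mem_T {x : O3} (hx : x ∈ T) {π : Equiv.Perm (Fin 3)} (hπ : PermutesAxes x π) :
    Equiv.Perm.sign π = 1 := by
  obtain ⟨a, b, c, ρ, rfl⟩ := exists_diag3_mul_permO (T_le_Oh hx)
  have hρ := (permutesAxes_one_iff.2 ⟨a, b, c, rfl⟩).mul (permutesAxes_permO ρ)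
  rw [one_mul] at hρ
  rw [hπ.unique hρ]
  have h1 : a * b * c = 1 := by
    rw [← diag3_mem_Td, ← Subgroup.mul_mem_cancel_right _ (permO_mem_Td ρ)]
    exact hx.1
  have h2 := mem_SO3.1 hx.2
  rw [det_mul, det_diag3, h1, det_permO] at h2
  rw [sgnR_one, one_mul] at h2
  exact sgnR_injective (h2.trans sgnR_one.symm)

theorem perm_three_even : ∀ π : Equiv.Perm (Fin 3), Equiv.Perm.sign π = 1 → π * π = 1 → π = 1 := by
  decide

theorem mem_Dn_two_of_sq {x : O3} (hx : x ∈ T) (h : x * x = 1) : x ∈ Dn 2 := by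
  obtain ⟨π, hπ⟩ := mem_Oh.1 (T_le_Oh hx)
  have h2 := hπ.mul hπ
  rw [h] at h2
  rw [perm_three_even π (sign_of_mem_T hx hπ) (h2.unique permutesAxes_one)] at hπ
  exact mem_Dn_two.2 ⟨hπ, hx.2⟩

/-! ### Normalizers of the subgroups of `O_h` -/

theorem Oh_le_normalizer_Dnh_two : Oh ≤ Subgroup.normalizer (Dnh 2 : Set O3) := by
  refine le_normalizer_of_conj_mem fun g hg x hx => ?_
  obtain ⟨π, hπ⟩ := mem_Oh.1 hg
  rw [mem_Dnh_two] at hx ⊢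
  simpa using (hπ.mul hx).mul hπ.inv

theorem Oh_le_normalizer_Dn_two : Oh ≤ Subgroup.normalizer (Dn 2 : Set O3) := by
  refine le_normalizer_of_conj_mem fun g hg x hx => ?_
  obtain ⟨π, hπ⟩ := mem_Oh.1 hg
  rw [mem_Dn_two] at hx ⊢
  exact ⟨by simpa using (hπ.mul hx.1).mul hπ.inv, conj_mem_SO3.2 hx.2⟩

/-- Each basis vector e_j is fixed by a nontrivial d in D_2. The conjugate g d g⁻¹ is again a
nontrivial diagonal rotation, whose fixed vectors lie on one coordinate axis, and it fixes g e_j. So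
every column of g has a single nonzero entry. -/
theorem normalizer_Dn_two : Subgroup.normalizer (Dn 2 : Set O3) = Oh := by
  refine le_antisymm (fun g hg => mem_Oh.2 (exists_permutesAxes_of_column fun j => ?_))
    Oh_le_normalizer_Dn_two
  obtain ⟨d, hd, hd1, hdj⟩ : ∃ d ∈ Dn 2, d ≠ 1 ∧ d • (Pi.single j 1 : Fin 3 → ℝ) = Pi.single j 1 := by
    have h : ∀ a b c : ℤˣ, a * b * c = 1 → diag3 a b c ∈ Dn 2 := fun a b c h =>
      mem_Dn_two.2 ⟨permutesAxes_one_iff.2 ⟨a, b, c, rfl⟩, diag3_mem_SO3.2 h⟩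
    have h1 : ∀ a b c : ℤˣ, diag3 a b c = 1 → a * b = 1 ∧ c = 1 := by
      intro a b c h
      rw [diag3, ← dih_one] at h
      exact (dih_inj h).2
    fin_cases j
    · refine ⟨_, h 1 (-1) (-1) (by decide), fun h => absurd (h1 _ _ _ h).1 (by decide), ?_⟩
      rw [diag3_smul]
      ext i
      fin_cases i <;> simp
    · refine ⟨_, h (-1) 1 (-1) (by decide), fun h => absurd (h1 _ _ _ h).1 (by decide), ?_⟩
      rw [diag3_smul]
      ext i
      fin_cases i <;> simp
    · refine ⟨_, h (-1) (-1) 1 (by decide), fun h => ?_, ?_⟩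
      · rw [diag3, ← dih_one] at h
        have := (dih_inj h).1
        rw [sgnC_neg_one] at this
        exact circle_neg_one_ne_one this
      · rw [diag3_smul]
        ext i
        fin_cases i <;> simp
  have hx := conj_mem_of_mem_normalizer hg hd
  set x := g * d * g⁻¹ with hxd
  have hx1 : x ≠ 1 := fun h => hd1 (by rwa [hxd, mul_inv_eq_one, mul_eq_left] at h)
  have hfix : x • (g • (Pi.single j 1 : Fin 3 → ℝ)) = g • Pi.single j 1 := by
    rw [hxd, mul_smul, mul_smul, inv_smul_smul, hdj]
  obtain ⟨hp, hdet⟩ := mem_Dn_two.1 hx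
  obtain ⟨a, b, c, hxe⟩ := permutesAxes_one_iff.1 hp
  rw [hxe] at hx1 hfix hdet
  have habc := diag3_mem_SO3.1 hdet
  set w := g • (Pi.single j 1 : Fin 3 → ℝ) with hw
  have hwe : ∀ k, w k = g.1 k j := fun k => apply_single g k j
  rw [diag3_smul] at hfix
  have f0 := congrFun hfix 0
  have f1 := congrFun hfix 1
  have f2 := congrFun hfix 2
  simp only [Matrix.cons_val_zero, Matrix.cons_val_one, Matrix.cons_val] at f0 f1 f2
  simp only [← hwe]
  have hz : ∀ y : ℝ, -y = y → y = 0 := fun y h => by linarith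
  rcases Int.units_eq_one_or a with rfl | rfl <;> rcases Int.units_eq_one_or b with rfl | rfl <;>
    rcases Int.units_eq_one_or c with rfl | rfl <;> simp at f0 f1 f2 habc
  · exfalso
    apply hx1
    simp [diag3, dih_one]
  · refine ⟨0, fun k hk => ?_⟩
    fin_cases k
    · exact absurd rfl hk
    · exact hz _ f1
    · exact hz _ f2
  · refine ⟨1, fun k hk => ?_⟩
    fin_cases k
    · exact hz _ f0
    · exact absurd rfl hk
    · exact hz _ f2
  · refine ⟨2, fun k hk => ?_⟩
    fin_cases k
    · exact hz _ f0
    · exact hz _ f1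
    · exact absurd rfl hk

theorem normalizer_Dnh_two : Subgroup.normalizer (Dnh 2 : Set O3) = Oh := by
  refine le_antisymm ?_ Oh_le_normalizer_Dnh_two
  rw [← normalizer_Dn_two]
  refine le_normalizer_of_conj_mem fun g hg x hx => ?_
  rw [mem_Dn_two, ← mem_Dnh_two] at hx ⊢
  exact ⟨conj_mem_of_mem_normalizer hg hx.1, conj_mem_SO3.2 hx.2⟩

end PointGroup

namespace PointGroup

/-! ### The generators of `O_h` -/

theorem aO_smul (v : Fin 3 → ℝ) : aO • v = ![-v 1, v 0, v 2] := by
  rw [vec_smul_def, aO, rotZ]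
  ext i
  fin_cases i <;> simp [Matrix.mulVec, dotProduct, Fin.sum_univ_three]

theorem bO_smul (v : Fin 3 → ℝ) : bO • v = ![v 0, -v 2, v 1] := by
  rw [vec_smul_def, bO, rotX]
  ext i
  fin_cases i <;> simp [Matrix.mulVec, dotProduct, Fin.sum_univ_three]

theorem vec_ext_smul {g h : O3} (h0 : ∀ v : Fin 3 → ℝ, (g • v) 0 = (h • v) 0)
    (h1 : ∀ v : Fin 3 → ℝ, (g • v) 1 = (h • v) 1) (h2 : ∀ v : Fin 3 → ℝ, (g • v) 2 = (h • v) 2) :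
    g = h := by
  apply ext_vec_smul
  intro v
  ext i
  fin_cases i
  exacts [h0 v, h1 v, h2 v]

theorem aO_mem_Oh : aO ∈ Oh := by
  refine PermutesAxes.mem_Oh (π := Equiv.swap 0 1) fun v i => ?_
  rw [aO_smul]
  have h : (Equiv.swap 0 1 : Equiv.Perm (Fin 3)) 2 = 2 := by decide
  fin_cases i <;> simp [h]

theorem bO_mem_Oh : bO ∈ Oh := by
  refine PermutesAxes.mem_Oh (π := Equiv.swap 1 2) fun v i => ?_
  rw [bO_smul]
  fin_cases i <;> simp [Equiv.swap_apply_of_ne_of_ne]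

theorem aO_mem_SO3 : aO ∈ SO3 := by
  rw [aO, rotZ_eq]
  exact dih_mem_SO3.2 rfl

theorem bO_mem_SO3 : bO ∈ SO3 := by
  rw [mem_SO3, bO, rotX, Matrix.det_fin_three]
  simp

theorem aO_mul_bO_smul (v : Fin 3 → ℝ) : (aO * bO) • v = ![v 2, v 0, v 1] := by
  rw [mul_smul, aO_smul, bO_smul]
  simp

theorem bO_mul_aO_smul (v : Fin 3 → ℝ) : (bO * aO) • v = ![-v 1, -v 2, v 0] := by
  rw [mul_smul, aO_smul, bO_smul]
  simp

theorem bO_mul_aO_sq_smul (v : Fin 3 → ℝ) : (bO * aO ^ 2) • v = ![-v 0, -v 2, -v 1] := by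
  rw [sq, mul_smul, mul_smul, aO_smul, aO_smul, bO_smul]
  simp

theorem aO_sq_mul_bO_smul (v : Fin 3 → ℝ) : (aO ^ 2 * bO) • v = ![-v 0, v 2, v 1] := by
  rw [sq, mul_smul, mul_smul, aO_smul, aO_smul, bO_smul]
  simp

theorem aO_mul_bO_cube : aO * bO * (aO * bO) * (aO * bO) = 1 := by
  apply vec_ext_smul <;> intro v <;> simp [mul_smul _ (aO * bO), aO_mul_bO_smul]

theorem bO_mul_aO_cube : bO * aO * (bO * aO) * (bO * aO) = 1 := by
  apply vec_ext_smul <;> intro v <;> simp [mul_smul _ (bO * aO), bO_mul_aO_smul]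

theorem aO_sq_mul_bO_mul_self : aO ^ 2 * bO * (aO ^ 2 * bO) = 1 := by
  apply vec_ext_smul <;> intro v <;> simp [mul_smul _ (aO ^ 2 * bO), aO_sq_mul_bO_smul]

theorem aO_mul_bO_mem_T : aO * bO ∈ T :=
  mem_T_of_cube (mul_mem aO_mem_Oh bO_mem_Oh) aO_mul_bO_cube

theorem bO_mul_aO_mem_T : bO * aO ∈ T :=
  mem_T_of_cube (mul_mem bO_mem_Oh aO_mem_Oh) bO_mul_aO_cube

theorem permutesAxes_aO_mul_bO :
    PermutesAxes (aO * bO) (Equiv.swap 0 1 * Equiv.swap 1 2) := by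
  intro v i
  rw [aO_mul_bO_smul]
  fin_cases i
  · rw [show (Equiv.swap 0 1 * Equiv.swap 1 2 : Equiv.Perm (Fin 3))⁻¹ _ = 2 by decide]
    simp
  · rw [show (Equiv.swap 0 1 * Equiv.swap 1 2 : Equiv.Perm (Fin 3))⁻¹ _ = 0 by decide]
    simp
  · rw [show (Equiv.swap 0 1 * Equiv.swap 1 2 : Equiv.Perm (Fin 3))⁻¹ _ = 1 by decide]
    simp

theorem permutesAxes_bO_mul_aO_sq : PermutesAxes (bO * aO ^ 2) (Equiv.swap 1 2) := by
  intro v i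
  rw [bO_mul_aO_sq_smul]
  fin_cases i <;> simp [Equiv.swap_apply_of_ne_of_ne]

theorem perm_three_even_eq : ∀ π : Equiv.Perm (Fin 3), Equiv.Perm.sign π = 1 →
    π = 1 ∨ π = Equiv.swap 0 1 * Equiv.swap 1 2 ∨
      π = Equiv.swap 0 1 * Equiv.swap 1 2 * (Equiv.swap 0 1 * Equiv.swap 1 2) := by
  decide

theorem perm_three_eq : ∀ π : Equiv.Perm (Fin 3),
    (π = 1 ∨ π = Equiv.swap 0 1 * Equiv.swap 1 2 ∨
      π = Equiv.swap 0 1 * Equiv.swap 1 2 * (Equiv.swap 0 1 * Equiv.swap 1 2)) ∨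
    (π * Equiv.swap 1 2 = 1 ∨ π * Equiv.swap 1 2 = Equiv.swap 0 1 * Equiv.swap 1 2 ∨
      π * Equiv.swap 1 2 =
        Equiv.swap 0 1 * Equiv.swap 1 2 * (Equiv.swap 0 1 * Equiv.swap 1 2)) := by
  decide

/-- The product `aO * bO` permutes the coordinates cyclically, and `aO * bO * (bO * aO)` is diag(1,
-1, -1). Its conjugates supply D_2. Modulo D_2 the elements of T are even permutations of the axes,
and these are powers of the cycle. -/
theorem closure_T : Subgroup.closure {aO * bO, bO * aO} = T := by
  set K := Subgroup.closure {aO * bO, bO * aO} with hK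
  have hab : aO * bO ∈ K := Subgroup.subset_closure (Or.inl rfl)
  have hba : bO * aO ∈ K := Subgroup.subset_closure (Or.inr rfl)
  apply le_antisymm
  · rw [hK, Subgroup.closure_le]
    rintro _ (rfl | rfl)
    exacts [aO_mul_bO_mem_T, bO_mul_aO_mem_T]
  · have hx : diag3 1 (-1) (-1) ∈ K := by
      have : diag3 1 (-1) (-1) = aO * bO * (bO * aO) := by
        apply vec_ext_smul <;> intro v <;>
          simp [mul_smul _ (bO * aO), aO_mul_bO_smul, bO_mul_aO_smul, diag3_smul]
      rw [this]
      exact mul_mem hab hba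
    have hy : diag3 (-1) 1 (-1) ∈ K := by
      have : diag3 (-1) 1 (-1) = aO * bO * diag3 1 (-1) (-1) * (aO * bO)⁻¹ := by
        rw [eq_mul_inv_iff_mul_eq]
        apply vec_ext_smul <;> intro v <;>
          simp [mul_smul _ (aO * bO), mul_smul _ (diag3 _ _ _), aO_mul_bO_smul, diag3_smul]
      rw [this]
      exact mul_mem (mul_mem hab hx) (inv_mem hab)
    have hz : diag3 (-1) (-1) 1 ∈ K := by
      have : diag3 (-1) (-1) 1 = diag3 1 (-1) (-1) * diag3 (-1) 1 (-1) := by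
        apply vec_ext_smul <;> intro v <;>
          simp [mul_smul, diag3_smul]
      rw [this]
      exact mul_mem hx hy
    have hD2 : Dn 2 ≤ K := by
      intro x hx'
      obtain ⟨h, hdet⟩ := mem_Dn_two.1 hx'
      obtain ⟨a, b, c, rfl⟩ := permutesAxes_one_iff.1 h
      have habc := diag3_mem_SO3.1 hdet
      have h1 : diag3 1 1 1 = 1 := by simp [diag3, dih_one]
      rcases Int.units_eq_one_or a with rfl | rfl <;>
        rcases Int.units_eq_one_or b with rfl | rfl <;>
        rcases Int.units_eq_one_or c with rfl | rfl <;> simp at habc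
      · rw [h1]; exact one_mem _
      · exact hx
      · exact hy
      · exact hz
    intro x hxT
    obtain ⟨π, hπ⟩ := mem_Oh.1 (T_le_Oh hxT)
    have key : ∀ k ∈ K, k ∈ T → PermutesAxes k π → x ∈ K := by
      intro k hk hkT hkπ
      have h1 := hπ.mul hkπ.inv
      rw [mul_inv_cancel] at h1
      have h2 := hD2 (mem_Dn_two.2 ⟨h1, mul_mem hxT.2 (inv_mem hkT.2)⟩)
      rwa [Subgroup.mul_mem_cancel_right _ (inv_mem hk)] at h2
    have hc := permutesAxes_aO_mul_bO
    rcases perm_three_even_eq π (sign_of_mem_T hxT hπ) with rfl | rfl | rfl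
    · exact key 1 (one_mem _) (one_mem _) permutesAxes_one
    · exact key _ hab aO_mul_bO_mem_T hc
    · exact key _ (mul_mem hab hab) (mul_mem aO_mul_bO_mem_T aO_mul_bO_mem_T) (hc.mul hc)

theorem aO_notMem_Td : aO ∉ Td := by
  intro h
  have h1 : (1 : Fin 3 → ℝ) ∈ tetrahedron := ⟨fun i => Or.inl rfl, by simp⟩
  have h2 := ((mem_symmetryGroup.1 h 1).2 h1).2
  rw [aO_smul] at h2
  simp only [Matrix.cons_val_zero, Matrix.cons_val_one, Matrix.cons_val, Pi.one_apply] at h2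
  norm_num at h2

theorem aO_sq_mul_bO_notMem_Td : aO ^ 2 * bO ∉ Td := by
  intro h
  have h1 : (1 : Fin 3 → ℝ) ∈ tetrahedron := ⟨fun i => Or.inl rfl, by simp⟩
  have h2 := ((mem_symmetryGroup.1 h 1).2 h1).2
  rw [aO_sq_mul_bO_smul] at h2
  simp only [Matrix.cons_val_zero, Matrix.cons_val_one, Matrix.cons_val, Pi.one_apply] at h2
  norm_num at h2

theorem aO_sq_mul_bO_mem_Oh : aO ^ 2 * bO ∈ Oh := mul_mem (pow_mem aO_mem_Oh 2) bO_mem_Oh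

theorem aO_sq_mul_bO_mem_SO3 : aO ^ 2 * bO ∈ SO3 := mul_mem (pow_mem aO_mem_SO3 2) bO_mem_SO3

/-- `T_d` has index two in `O_h`. -/
theorem mul_mem_Td {x y : O3} (hx : x ∈ Oh) (hxT : x ∉ Td) (hy : y ∈ Oh) (hyT : y ∉ Td) :
    x * y ∈ Td := by
  rw [← inversion_mul_mul]
  exact mul_mem ((mem_Td_or hx).resolve_left hxT) ((mem_Td_or hy).resolve_left hyT)

/-- `SO(3)` has index two in `O(3)`. -/
theorem mul_mem_SO3 {x y : O3} (hx : x ∉ SO3) (hy : y ∉ SO3) : x * y ∈ SO3 := by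
  rw [← inversion_mul_mul]
  exact mul_mem (inversion_mul_mem_SO3 hx) (inversion_mul_mem_SO3 hy)

/-- The inversion i is central of order two, so S ⊔ C_i is the union of S and iS. -/
theorem mem_sup_Ci {S : Subgroup O3} {x : O3} : x ∈ S ⊔ Ci ↔ x ∈ S ∨ inversion * x ∈ S := by
  constructor
  · intro h
    have : S ⊔ Ci ≤ { carrier := {x | x ∈ S ∨ inversion * x ∈ S}
                      one_mem' := Or.inl (one_mem _)
                      mul_mem' := by
                        rintro x y (hx | hx) (hy | hy)
                        · exact Or.inl (mul_mem hx hy)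
                        · right
                          rw [← mul_assoc, inversion_comm x, mul_assoc]
                          exact mul_mem hx hy
                        · right
                          rw [← mul_assoc]
                          exact mul_mem hx hy
                        · left
                          rw [← inversion_mul_mul]
                          exact mul_mem hx hy
                      inv_mem' := by
                        rintro x (hx | hx)
                        · exact Or.inl (inv_mem hx)
                        · right
                          have := inv_mem hx
                          rwa [mul_inv_rev, inversion_inv, ← inversion_comm] at this } := by
      rw [sup_le_iff]
      refine ⟨fun y hy => Or.inl hy, fun y hy => ?_⟩
      rcases mem_Ci.1 hy with rfl | rfl
      · exact Or.inl (one_mem _)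
      · right
        rw [inversion_mul_inversion]
        exact one_mem _
    exact this h
  · have hi : inversion ∈ S ⊔ Ci := Subgroup.mem_sup_right (mem_Ci.2 (Or.inr rfl))
    rintro (h | h)
    · exact Subgroup.mem_sup_left h
    · have := mul_mem hi (Subgroup.mem_sup_left (T := Ci) h)
      rwa [← mul_assoc, inversion_mul_inversion, one_mul] at this

theorem closure_Td : Subgroup.closure {aO * bO, bO * aO, aO * inversion} = Td := by
  have hai : aO * inversion ∈ Td := by
    rw [← inversion_comm]
    exact (mem_Td_or aO_mem_Oh).resolve_left aO_notMem_Td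
  have haiS : aO * inversion ∉ SO3 := by
    rw [Subgroup.mul_mem_cancel_left _ aO_mem_SO3]
    exact inversion_notMem_SO3
  have hT : T ≤ Subgroup.closure {aO * bO, bO * aO, aO * inversion} := by
    rw [← closure_T]
    refine Subgroup.closure_mono ?_
    rintro x (rfl | rfl)
    exacts [Or.inl rfl, Or.inr (Or.inl rfl)]
  have hK : aO * inversion ∈ Subgroup.closure {aO * bO, bO * aO, aO * inversion} :=
    Subgroup.subset_closure (Or.inr (Or.inr rfl))
  apply le_antisymm
  · rw [Subgroup.closure_le]
    rintro _ (rfl | rfl | rfl)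
    exacts [aO_mul_bO_mem_T.1, bO_mul_aO_mem_T.1, hai]
  · intro x hx
    by_cases hdet : x ∈ SO3
    · exact hT ⟨hx, hdet⟩
    · rw [← Subgroup.mul_mem_cancel_right _ hK]
      exact hT ⟨mul_mem hx hai, mul_mem_SO3 hdet haiS⟩

theorem closure_Th : Subgroup.closure {aO * bO, bO * aO, inversion} = Th := by
  rw [Th, ← closure_T, Ci, ← Subgroup.closure_union]
  congr 1
  ext x
  simp only [Set.mem_insert_iff, Set.mem_singleton_iff, Set.mem_union]
  tauto

theorem closure_O : Subgroup.closure {aO, bO} = O := by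
  have ha : aO ∈ Subgroup.closure {aO, bO} := Subgroup.subset_closure (Or.inl rfl)
  have hb : bO ∈ Subgroup.closure {aO, bO} := Subgroup.subset_closure (Or.inr rfl)
  have hT : T ≤ Subgroup.closure {aO, bO} := by
    rw [← closure_T, Subgroup.closure_le]
    rintro x (rfl | rfl)
    exacts [mul_mem ha hb, mul_mem hb ha]
  apply le_antisymm
  · rw [Subgroup.closure_le]
    rintro _ (rfl | rfl)
    exacts [⟨aO_mem_Oh, aO_mem_SO3⟩, ⟨bO_mem_Oh, bO_mem_SO3⟩]
  · intro x hx
    by_cases hxT : x ∈ Td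
    · exact hT ⟨hxT, hx.2⟩
    · rw [← Subgroup.mul_mem_cancel_right _ ha]
      exact hT ⟨mul_mem_Td hx.1 hxT aO_mem_Oh aO_notMem_Td, mul_mem hx.2 aO_mem_SO3⟩

theorem closure_Oh : Subgroup.closure {aO, bO, inversion} = Oh := by
  have hO : O ≤ Subgroup.closure {aO, bO, inversion} := by
    rw [← closure_O]
    refine Subgroup.closure_mono ?_
    rintro x (rfl | rfl)
    exacts [Or.inl rfl, Or.inr (Or.inl rfl)]
  have hi : inversion ∈ Subgroup.closure {aO, bO, inversion} :=
    Subgroup.subset_closure (Or.inr (Or.inr rfl))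
  apply le_antisymm
  · rw [Subgroup.closure_le]
    rintro _ (rfl | rfl | rfl)
    exacts [aO_mem_Oh, bO_mem_Oh, inversion_mem_Oh]
  · intro x hx
    by_cases hdet : x ∈ SO3
    · exact hO ⟨hx, hdet⟩
    · rw [← Subgroup.mul_mem_cancel_left _ hi]
      exact hO ⟨mul_mem inversion_mem_Oh hx, inversion_mul_mem_SO3 hdet⟩

/-! ### Normalizers of the cubic groups -/

/-- T is generated by two elements of order three and contains every element of order three of O_h,
so the normalizer of any intermediate group preserves T. -/
theorem normalizer_le_normalizer_T {S : Subgroup O3} (h1 : T ≤ S) (h2 : S ≤ Oh) :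
    Subgroup.normalizer (S : Set O3) ≤ Subgroup.normalizer (T : Set O3) := by
  refine le_normalizer_of_conj_mem fun g hg x hx => ?_
  have key : ∀ y ∈ T, y * y * y = 1 → g * y * g⁻¹ ∈ T := by
    intro y hy h3
    refine mem_T_of_cube (h2 (conj_mem_of_mem_normalizer hg (h1 hy))) ?_
    have : g * y * g⁻¹ * (g * y * g⁻¹) * (g * y * g⁻¹) = g * (y * y * y) * g⁻¹ := by group
    rw [this, h3]
    group
  have hle : conj g T ≤ T := by
    nth_rewrite 1 [← closure_T]
    rw [conj_closure, Subgroup.closure_le]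
    rintro _ ⟨y, rfl | rfl, rfl⟩
    · exact key _ aO_mul_bO_mem_T aO_mul_bO_cube
    · exact key _ bO_mul_aO_mem_T bO_mul_aO_cube
  exact hle (conj_mem_conj hx)

/-- D_2 consists of the elements of T with square 1, so the normalizer of T normalizes D_2. -/
theorem normalizer_T : Subgroup.normalizer (T : Set O3) = Oh := by
  apply le_antisymm
  · rw [← normalizer_Dn_two]
    refine le_normalizer_of_conj_mem fun g hg x hx => ?_
    refine mem_Dn_two_of_sq (conj_mem_of_mem_normalizer hg (Dn_two_le_T hx)) ?_
    have h1 : x * x = 1 := by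
      obtain ⟨a, b, c, rfl⟩ := permutesAxes_one_iff.1 (mem_Dn_two.1 hx).1
      apply vec_ext_smul <;> intro v <;>
        simp [mul_smul, diag3_smul, ← mul_assoc, sgnR_mul_self]
    have : g * x * g⁻¹ * (g * x * g⁻¹) = g * (x * x) * g⁻¹ := by group
    rw [this, h1]
    group
  · exact Subgroup.le_normalizer.trans (normalizer_le_normalizer_T T_le_Oh le_rfl)

theorem normalizer_cubic {S : Subgroup O3} (h1 : T ≤ S) (h2 : S ≤ Oh)
    (h3 : Oh ≤ Subgroup.normalizer (S : Set O3)) : Subgroup.normalizer (S : Set O3) = Oh :=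
  le_antisymm ((normalizer_le_normalizer_T h1 h2).trans normalizer_T.le) h3

theorem inversion_mem_normalizer (S : Subgroup O3) :
    inversion ∈ Subgroup.normalizer (S : Set O3) := by
  rw [Subgroup.mem_normalizer_iff]
  intro x
  rw [inversion_comm, mul_inv_cancel_right]

theorem normalizer_Td : Subgroup.normalizer (Td : Set O3) = Oh := by
  refine normalizer_cubic inf_le_left Td_le_Oh fun x hx => ?_
  rcases mem_Td_or hx with h | h
  · exact Subgroup.le_normalizer h
  · rw [← Subgroup.mul_mem_cancel_left _ (inversion_mem_normalizer Td)]
    exact Subgroup.le_normalizer h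

theorem normalizer_le_normalizer_inf_SO3 (S : Subgroup O3) :
    Subgroup.normalizer (S : Set O3) ≤
      Subgroup.normalizer ((S ⊓ SO3 : Subgroup O3) : Set O3) :=
  le_normalizer_of_conj_mem fun _ hg _ hx =>
    ⟨conj_mem_of_mem_normalizer hg hx.1, conj_mem_SO3.2 hx.2⟩

theorem normalizer_le_normalizer_sup_Ci (S : Subgroup O3) :
    Subgroup.normalizer (S : Set O3) ≤
      Subgroup.normalizer ((S ⊔ Ci : Subgroup O3) : Set O3) := by
  refine le_normalizer_of_conj_mem fun g hg x hx => ?_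
  rw [mem_sup_Ci] at hx ⊢
  refine hx.imp (conj_mem_of_mem_normalizer hg) fun h => ?_
  have := conj_mem_of_mem_normalizer hg h
  rwa [← mul_assoc, ← inversion_comm, mul_assoc, mul_assoc, ← mul_assoc g] at this

theorem Th_le_Oh : Th ≤ Oh := by
  refine sup_le T_le_Oh fun x hx => ?_
  rcases mem_Ci.1 hx with rfl | rfl
  exacts [one_mem _, inversion_mem_Oh]

theorem normalizer_Th : Subgroup.normalizer (Th : Set O3) = Oh :=
  normalizer_cubic le_sup_left Th_le_Oh
    (normalizer_T.ge.trans (normalizer_le_normalizer_sup_Ci T))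

theorem normalizer_Oh : Subgroup.normalizer (Oh : Set O3) = Oh :=
  normalizer_cubic T_le_Oh le_rfl Subgroup.le_normalizer

theorem T_le_O : T ≤ O := inf_le_inf_right _ Td_le_Oh

theorem normalizer_O : Subgroup.normalizer (O : Set O3) = Oh :=
  normalizer_cubic T_le_O inf_le_left
    (normalizer_Oh.ge.trans (normalizer_le_normalizer_inf_SO3 Oh))

/-! ### Complements of the cubic groups -/

/-- The group preserving the line spanned by `u`. -/
noncomputable def lineStabilizer (u : Fin 3 → ℝ) : Subgroup O3 where
  carrier := {g | g • u = u ∨ g • u = -u}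
  one_mem' := Or.inl (one_smul _ _)
  mul_mem' := by
    rintro g h hg hh
    rw [Set.mem_ofPred_eq, mul_smul]
    rcases hg with hg | hg <;> rcases hh with hh | hh <;> simp [hg, hh]
  inv_mem' := by
    rintro g hg
    rw [Set.mem_ofPred_eq, inv_smul_eq_iff, inv_smul_eq_iff, vec_smul_neg]
    rcases hg with hg | hg
    · exact Or.inl hg.symm
    · right
      rw [hg, neg_neg]

theorem closure_D3d_le :
    Subgroup.closure {aO * bO, bO * aO ^ 2, inversion} ≤ lineStabilizer 1 := by
  rw [Subgroup.closure_le]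
  rintro _ (rfl | rfl | rfl)
  · left
    rw [aO_mul_bO_smul]
    ext i
    fin_cases i <;> simp
  · right
    rw [bO_mul_aO_sq_smul]
    ext i
    fin_cases i <;> simp
  · exact Or.inr (inversion_smul 1)

theorem closure_D3_le_D3d : Subgroup.closure {aO * bO, bO * aO ^ 2} ≤
    Subgroup.closure {aO * bO, bO * aO ^ 2, inversion} := by
  refine Subgroup.closure_mono ?_
  rintro x (rfl | rfl)
  exacts [Or.inl rfl, Or.inr (Or.inl rfl)]

theorem closure_D3_le_O : Subgroup.closure {aO * bO, bO * aO ^ 2} ≤ O := by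
  rw [Subgroup.closure_le]
  have ha : aO ∈ O := ⟨aO_mem_Oh, aO_mem_SO3⟩
  have hb : bO ∈ O := ⟨bO_mem_Oh, bO_mem_SO3⟩
  rintro _ (rfl | rfl)
  exacts [mul_mem ha hb, mul_mem hb (pow_mem ha 2)]

/-- The listed complements of D_2 and D_{2h} preserve the body diagonal through (1, 1, 1). A
diagonal sign matrix doing so has equal signs, which bounds the intersection. -/
theorem diag3_of_mem_lineStabilizer {x : O3} (h1 : PermutesAxes x 1)
    (h2 : x ∈ lineStabilizer 1) : x = 1 ∨ x = inversion := by
  obtain ⟨a, b, c, rfl⟩ := permutesAxes_one_iff.1 h1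
  rcases h2 with h2 | h2
  · left
    rw [diag3_smul] at h2
    have h0 := congrFun h2 0
    have h1 := congrFun h2 1
    have h2 := congrFun h2 2
    simp at h0 h1 h2
    rw [← sgnR_one] at h0 h1 h2
    rw [sgnR_injective h0, sgnR_injective h1, sgnR_injective h2]
    simp [diag3, dih_one]
  · right
    rw [diag3_smul] at h2
    have h0 := congrFun h2 0
    have h1 := congrFun h2 1
    have h2 := congrFun h2 2
    simp at h0 h1 h2
    rw [← sgnR_neg_one] at h0 h1 h2
    rw [sgnR_injective h0, sgnR_injective h1, sgnR_injective h2, inversion_eq_diag3]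

/-- O_h/D_{2h} is the group of permutations of the axes. A three-fold rotation and a two-fold
rotation interchanging two axes reach all of it. -/
theorem exists_mem_D3_permutesAxes (π : Equiv.Perm (Fin 3)) :
    ∃ h ∈ Subgroup.closure {aO * bO, bO * aO ^ 2}, PermutesAxes h π := by
  have hab : aO * bO ∈ Subgroup.closure {aO * bO, bO * aO ^ 2} :=
    Subgroup.subset_closure (Or.inl rfl)
  have hba : bO * aO ^ 2 ∈ Subgroup.closure {aO * bO, bO * aO ^ 2} :=
    Subgroup.subset_closure (Or.inr rfl)
  have hc := permutesAxes_aO_mul_bO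
  have key : ∀ ρ : Equiv.Perm (Fin 3), (ρ = 1 ∨ ρ = Equiv.swap 0 1 * Equiv.swap 1 2 ∨
      ρ = Equiv.swap 0 1 * Equiv.swap 1 2 * (Equiv.swap 0 1 * Equiv.swap 1 2)) →
      ∃ h ∈ Subgroup.closure {aO * bO, bO * aO ^ 2}, PermutesAxes h ρ := by
    rintro ρ (rfl | rfl | rfl)
    exacts [⟨1, one_mem _, permutesAxes_one⟩, ⟨_, hab, hc⟩, ⟨_, mul_mem hab hab, hc.mul hc⟩]
  rcases perm_three_eq π with h | h
  · exact key π h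
  · obtain ⟨k, hk, hkπ⟩ := key _ h
    refine ⟨k * (bO * aO ^ 2), mul_mem hk hba, ?_⟩
    have := hkπ.mul permutesAxes_bO_mul_aO_sq
    rwa [mul_assoc, Equiv.swap_mul_self, mul_one] at this

theorem isComplementIn_D2h :
    IsComplementIn Oh (Dnh 2) (Subgroup.closure {aO * bO, bO * aO ^ 2}) := by
  rw [isComplementIn_iff]
  refine ⟨fun x hx => (mem_Dnh_two.1 hx).mem_Oh, closure_D3_le_O.trans inf_le_left, ?_, ?_⟩
  · intro x hx hx'
    rcases diag3_of_mem_lineStabilizer (mem_Dnh_two.1 hx)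
      (closure_D3d_le (closure_D3_le_D3d hx')) with h | h
    · exact h
    · exact absurd (h ▸ (closure_D3_le_O hx').2) inversion_notMem_SO3
  · intro x hx
    obtain ⟨π, hπ⟩ := mem_Oh.1 hx
    obtain ⟨h, hh, hhπ⟩ := exists_mem_D3_permutesAxes π
    refine ⟨x * h⁻¹, mem_Dnh_two.2 ?_, h, hh, by group⟩
    simpa using hπ.mul hhπ.inv

theorem isComplementIn_D2 :
    IsComplementIn Oh (Dn 2) (Subgroup.closure {aO * bO, bO * aO ^ 2, inversion}) := by
  rw [isComplementIn_iff]
  have hi : inversion ∈ Subgroup.closure {aO * bO, bO * aO ^ 2, inversion} :=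
    Subgroup.subset_closure (Or.inr (Or.inr rfl))
  refine ⟨fun x hx => (mem_Dn_two.1 hx).1.mem_Oh, ?_, ?_, ?_⟩
  · rw [Subgroup.closure_le]
    rintro _ (rfl | rfl | rfl)
    exacts [mul_mem aO_mem_Oh bO_mem_Oh, mul_mem bO_mem_Oh (pow_mem aO_mem_Oh 2),
      inversion_mem_Oh]
  · intro x hx hx'
    obtain ⟨h1, h2⟩ := mem_Dn_two.1 hx
    rcases diag3_of_mem_lineStabilizer h1 (closure_D3d_le hx') with rfl | rfl
    · rfl
    · exact absurd h2 inversion_notMem_SO3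
  · intro x hx
    -- Rotations are factored first; an improper element is the inversion times a rotation, and the
    -- central inversion goes into the second factor.
    have key : ∀ y ∈ O, ∃ s ∈ Dn 2,
        ∃ h ∈ Subgroup.closure {aO * bO, bO * aO ^ 2, inversion}, s * h = y := by
      intro y hy
      obtain ⟨π, hπ⟩ := mem_Oh.1 hy.1
      obtain ⟨h, hh, hhπ⟩ := exists_mem_D3_permutesAxes π
      refine ⟨y * h⁻¹, mem_Dn_two.2 ⟨?_, mul_mem hy.2 (inv_mem (closure_D3_le_O hh).2)⟩,
        h, closure_D3_le_D3d hh, by group⟩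
      simpa using hπ.mul hhπ.inv
    by_cases hdet : x ∈ SO3
    · exact key x ⟨hx, hdet⟩
    · obtain ⟨s, hs, h, hh, e⟩ :=
        key _ ⟨mul_mem inversion_mem_Oh hx, inversion_mul_mem_SO3 hdet⟩
      refine ⟨s, hs, h * inversion, mul_mem hh hi, ?_⟩
      rw [← mul_assoc, e, ← inversion_comm, ← mul_assoc, inversion_mul_inversion, one_mul]

/-- O_h/T is a Klein four-group, read off from membership in T_d and in SO(3). The rotation `aO ^ 2
* bO` fails the first condition only and the inversion fails both, so together they represent all
classes. -/
theorem isComplementIn_T :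
    IsComplementIn Oh T (Subgroup.closure {aO ^ 2 * bO, inversion}) := by
  have hf : aO ^ 2 * bO ∈ Subgroup.closure {aO ^ 2 * bO, inversion} :=
    Subgroup.subset_closure (Or.inl rfl)
  have hi : inversion ∈ Subgroup.closure {aO ^ 2 * bO, inversion} :=
    Subgroup.subset_closure (Or.inr rfl)
  have hsub : ∀ x ∈ Subgroup.closure {aO ^ 2 * bO, inversion},
      x ∈ Subgroup.closure {aO ^ 2 * bO} ⊔ Ci := by
    intro x hx
    rw [Ci, ← Subgroup.closure_union]
    exact hx
  rw [isComplementIn_iff]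
  refine ⟨T_le_Oh, ?_, ?_, ?_⟩
  · rw [Subgroup.closure_le]
    rintro _ (rfl | rfl)
    exacts [aO_sq_mul_bO_mem_Oh, inversion_mem_Oh]
  · intro x hx hx'
    have h1 := hsub x hx'
    rw [mem_sup_Ci, mem_closure_involution aO_sq_mul_bO_mul_self,
      mem_closure_involution aO_sq_mul_bO_mul_self] at h1
    have hne : ∀ y ∈ SO3, inversion * x ≠ y := by
      intro y hy h
      rw [← h, Subgroup.mul_mem_cancel_right _ hx.2] at hy
      exact inversion_notMem_SO3 hy
    rcases h1 with (h1 | h1) | (h1 | h1)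
    · exact h1
    · exact absurd (h1 ▸ hx.1) aO_sq_mul_bO_notMem_Td
    · exact absurd h1 (hne 1 (one_mem _))
    · exact absurd h1 (hne _ aO_sq_mul_bO_mem_SO3)
  · intro x hx
    have key : ∀ y ∈ O, ∃ s ∈ T, ∃ h ∈ Subgroup.closure {aO ^ 2 * bO, inversion}, s * h = y := by
      intro y hy
      by_cases hyT : y ∈ Td
      · exact ⟨y, ⟨hyT, hy.2⟩, 1, one_mem _, mul_one y⟩
      · refine ⟨y * (aO ^ 2 * bO), ⟨mul_mem_Td hy.1 hyT aO_sq_mul_bO_mem_Oh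
          aO_sq_mul_bO_notMem_Td, mul_mem hy.2 aO_sq_mul_bO_mem_SO3⟩, _, hf, ?_⟩
        rw [mul_assoc, aO_sq_mul_bO_mul_self, mul_one]
    by_cases hdet : x ∈ SO3
    · exact key x ⟨hx, hdet⟩
    · obtain ⟨s, hs, h, hh, e⟩ :=
        key _ ⟨mul_mem inversion_mem_Oh hx, inversion_mul_mem_SO3 hdet⟩
      refine ⟨s, hs, h * inversion, mul_mem hh hi, ?_⟩
      rw [← mul_assoc, e, ← inversion_comm, ← mul_assoc, inversion_mul_inversion, one_mul]

theorem isComplementIn_Td : IsComplementIn Oh Td (Subgroup.closure {aO ^ 2 * bO}) :=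
  isComplementIn_closure_singleton aO_sq_mul_bO_mul_self aO_sq_mul_bO_mem_Oh Td_le_Oh
    aO_sq_mul_bO_notMem_Td fun _ hg hgT =>
      mul_mem_Td hg hgT aO_sq_mul_bO_mem_Oh aO_sq_mul_bO_notMem_Td

theorem isComplementIn_Th : IsComplementIn Oh Th (Subgroup.closure {aO ^ 2 * bO}) := by
  refine isComplementIn_closure_singleton aO_sq_mul_bO_mul_self aO_sq_mul_bO_mem_Oh Th_le_Oh
    ?_ fun x hx hxT => ?_
  · rw [Th, mem_sup_Ci]
    rintro (h | h)
    · exact aO_sq_mul_bO_notMem_Td h.1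
    · have : inversion * (aO ^ 2 * bO) ∈ SO3 := h.2
      rw [Subgroup.mul_mem_cancel_right _ aO_sq_mul_bO_mem_SO3] at this
      exact inversion_notMem_SO3 this
  · rw [Th, mem_sup_Ci, not_or] at hxT
    have key : ∀ y ∈ O, y ∉ T → y * (aO ^ 2 * bO) ∈ T := fun y hy hyT =>
      ⟨mul_mem_Td hy.1 (fun h => hyT ⟨h, hy.2⟩) aO_sq_mul_bO_mem_Oh aO_sq_mul_bO_notMem_Td,
        mul_mem hy.2 aO_sq_mul_bO_mem_SO3⟩
    rw [Th, mem_sup_Ci]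
    by_cases hdet : x ∈ SO3
    · exact Or.inl (key x ⟨hx, hdet⟩ hxT.1)
    · right
      rw [← mul_assoc]
      exact key _ ⟨mul_mem inversion_mem_Oh hx, inversion_mul_mem_SO3 hdet⟩ hxT.2

theorem isComplementIn_inversion {S : Subgroup O3} (hi : inversion ∈ S) :
    IsComplementIn S (S ⊓ SO3) Ci :=
  isComplementIn_closure_singleton inversion_mul_inversion hi inf_le_left
    (fun h => inversion_notMem_SO3 h.2) fun _ hg hg' =>
      ⟨mul_mem hg hi, mul_mem_SO3 (fun h => hg' ⟨hg, h⟩) inversion_notMem_SO3⟩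

theorem isComplementIn_self_bot {G : Type*} [Group G] (S : Subgroup G) :
    IsComplementIn S S ⊥ := by
  rw [isComplementIn_iff]
  exact ⟨le_rfl, bot_le, fun x _ hx => Subgroup.mem_bot.1 hx, fun n hn =>
    ⟨n, hn, 1, one_mem _, mul_one n⟩⟩

end PointGroup

namespace PointGroup

/-! ### The names of the groups in the tables -/

/-- For a rotation found to have order three the angle may be either of two values. As the order is
prime, any nontrivial root of unity generates the others, so the value need not be known. -/
theorem exists_pow_eq_of_prime {p : ℕ} (hp : p.Prime) {z w : Circle} (hz : z ^ p = 1)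
    (hz1 : z ≠ 1) (hw : w ^ p = 1) : ∃ k : ℕ, w = z ^ k := by
  have : Fact p.Prime := ⟨hp⟩
  have : NeZero p := ⟨hp.ne_zero⟩
  have hz' : orderOf (z : ℂ) = p :=
    orderOf_eq_prime (by rw [← Circle.coe_pow, hz, Circle.coe_one])
      fun h => hz1 (Circle.ext (h.trans Circle.coe_one.symm))
  have hprim : IsPrimitiveRoot (z : ℂ) p := hz' ▸ IsPrimitiveRoot.orderOf (z : ℂ)
  obtain ⟨k, -, hk⟩ := hprim.eq_pow_of_pow_eq_one (ξ := (w : ℂ))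
    (by rw [← Circle.coe_pow, hw, Circle.coe_one])
  exact ⟨k, Circle.ext (by rw [Circle.coe_pow, hk])⟩

theorem Dnd_eq {n : ℕ} (hn : n ≠ 0) :
    Dnd n = axial n ⊤ (MonoidHom.fst ℤˣ ℤˣ * MonoidHom.snd ℤˣ ℤˣ) := by
  have hg : rotZ (Real.pi / n) * reflXY ∈ Dnd n := Subgroup.subset_closure (Or.inl rfl)
  have hb : dih 1 (-1) (-1) ∈ Dnd n := by
    rw [← rotX_pi_eq]; exact Subgroup.subset_closure (Or.inr rfl)
  apply le_antisymm
  · rw [Dnd, Subgroup.closure_le]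
    rintro _ (rfl | rfl)
    · rw [rotZ_half_mul_reflXY, SetLike.mem_coe, dih_mem_axial]
      simpa using exp_half_pow n hn
    · rw [rotX_pi_eq, SetLike.mem_coe, dih_mem_axial]
      simp
  · refine axial_le hn ?_ ?_
    · rw [← rotZ_half_mul_reflXY_sq]
      exact mul_mem hg hg
    · rw [rotZ_half_mul_reflXY] at hg
      rintro s t -
      rcases Int.units_eq_one_or s with rfl | rfl <;> rcases Int.units_eq_one_or t with rfl | rfl
      · exact ⟨1, by simp, by rw [dih_one]; exact one_mem _⟩
      · exact ⟨_, by simpa using exp_half_pow n hn, hg⟩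
      · exact ⟨Circle.exp (Real.pi / n), by simpa using exp_half_pow n hn,
          by simpa [dih_mul] using mul_mem hg hb⟩
      · exact ⟨1, by simp, hb⟩

/-- In the canonical orientation the x-axis is a two-fold axis, whereas in the table the xz-plane is
a mirror. A turn through half of π/n exchanges the two pictures. -/
theorem areConj_Dnd {n : ℕ} (hn : n ≠ 0) :
    AreConj (Dnd n) (Subgroup.closure {aD n ^ 2, aD n * bD * mD, mD}) := by
  obtain ⟨w, hw⟩ := exists_circle_sq (Circle.exp (Real.pi / n))
  refine ⟨dih w 1 1, ?_⟩
  rw [Dnd_eq hn, closure_Dnd hn]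
  refine (conj_axial (u := -1) ?_ ?_).symm
  · rw [hw, exp_half_pow n hn, sgnC_neg_one]
  · intro s t _
    rcases Int.units_eq_one_or s with rfl | rfl <;> simp

/-- A quarter turn, whose circle part squares to -1, carries the mirror plane xz to yz. -/
theorem areConj_Cnv (n : ℕ) : AreConj (Cnv n) (Subgroup.closure {aD n ^ 2, mD}) := by
  obtain ⟨w, hw⟩ := exists_circle_sq (-1)
  refine AreConj.symm ⟨dih w 1 1, ?_⟩
  rw [conj_closure, Set.image_pair, aD_sq, rotZ_eq, mD_eq, conj_dih_rot, conj_dih_rot, Cnv,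
    reflYZ_eq, rotZ_eq]
  congr 3
  · simp
  · simp [← hw, sq]

/-- The vertical mirror of `fan ζ` is the xz-plane turned through half the angle of ζ. -/
theorem fan_eq_conj {w : Circle} : fan (w ^ 2) = conj (dih w 1 1) (axial 1 ⊤ 1) := by
  ext g
  constructor
  · rintro ⟨s, t, rfl⟩
    refine ⟨dih 1 s t, dih_mem_axial.2 (by simp), (conj_dih_rot _ _ _ _).trans ?_⟩
    congr 1
    rcases Int.units_eq_one_or s with rfl | rfl <;> simp [sq]
  · rintro ⟨_, ⟨z, s, t, rfl, -, hz⟩, rfl⟩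
    obtain rfl : z = 1 := by simpa using hz
    refine ⟨s, t, (conj_dih_rot _ _ _ _).trans ?_⟩
    congr 1
    rcases Int.units_eq_one_or s with rfl | rfl <;> simp [sq]

theorem areConj_Cnv_two (n : ℕ) :
    AreConj (Cnv 2) (Subgroup.closure {aD n * mD, bD * mD}) := by
  obtain ⟨w, hw⟩ := exists_circle_sq (Circle.exp (Real.pi / n))
  refine (areConj_Cnv 2).trans ?_
  rw [closure_Cnv (by norm_num), closure_fan, ← hw]
  exact areConj_C2v_D1h.trans ⟨_, fan_eq_conj⟩

theorem areConj_Cs_aD_mul_mD (n : ℕ) : AreConj Cs (Subgroup.closure {aD n * mD}) := by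
  obtain ⟨w, hw⟩ := exists_circle_sq (Circle.exp (Real.pi / n))
  rw [Cs_eq]
  refine areConj_Cs_C1v.trans ⟨dih w 1 1, ?_⟩
  have h : axial 1 Qv 1 = Subgroup.closure {dih 1 (-1) 1} := by
    ext g
    rw [mem_closure_involution (dih_refl_mul_self 1 1)]
    constructor
    · rintro ⟨z, s, t, rfl, rfl, hz⟩
      obtain rfl : z = 1 := by simpa using hz
      rcases Int.units_eq_one_or s with rfl | rfl <;> simp [dih_one]
    · rintro (rfl | rfl)
      · exact one_mem _
      · rw [dih_mem_axial]; simp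
  rw [h, conj_closure, Set.image_singleton, conj_dih_rot, aD_mul_mD]
  congr 3
  simp [← hw, sq]

theorem areConj_Cs_bD_mul_mD : AreConj Cs (Subgroup.closure {bD * mD}) := by
  rw [bD_mul_mD, ← reflXY_eq]
  exact AreConj.refl _

theorem Cn_one : Cn 1 = ⊥ := by
  rw [Cn_eq one_ne_zero, axial_one_bot]

theorem dih_smul_e1 (z : Circle) (s t : ℤˣ) :
    dih z s t • e1 = ![(z : ℂ).re, (z : ℂ).im, 0] := by
  rw [vec_smul_def, dih_val, e1]
  ext i
  fin_cases i <;> simp [Matrix.mulVec, dotProduct, Fin.sum_univ_three]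

theorem eq_sgnC_of_smul_e1 {z : Circle} {s t u : ℤˣ} (h : dih z s t • e1 = sgnR u • e1) :
    z = sgnC u := by
  rw [dih_smul_e1] at h
  have h0 := congrFun h 0
  have h1 := congrFun h 1
  simp [e1] at h0 h1
  apply Circle.ext
  rcases Int.units_eq_one_or u with rfl | rfl
  · apply Complex.ext <;> simp [h0, h1]
  · apply Complex.ext <;> simp [h0, h1]

/-- In a frame adapted to an axis u of g and a perpendicular f, the conjugate of g is some `dih z s
t`. The image of f then determines z. -/
theorem exists_frame_conj (g : O3) {u f : Fin 3 → ℝ} {k : O3} (hu : k • u = e3) (hf : k • f = e1)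
    {t : ℤˣ} (hg : g • u = sgnR t • u) :
    ∃ z s, k * g * k⁻¹ = dih z s t ∧ (k * g * k⁻¹) • e1 = k • g • f := by
  have h3 : (k * g * k⁻¹) • e3 = sgnR t • e3 := by
    rw [← hu, mul_smul, mul_smul, inv_smul_smul, hg, vec_smul_smul]
  have h1 : (k * g * k⁻¹) • e1 = k • g • f := by
    rw [← hf, mul_smul, mul_smul, inv_smul_smul]
  obtain ⟨z, s, t', h⟩ := exists_dih (g := k * g * k⁻¹) (by
    rw [h3]
    rcases Int.units_eq_one_or t with rfl | rfl <;> simp)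
  have ht : t' = t := by
    rw [h, dih_smul_e3] at h3
    have := congrFun h3 2
    simp only [e3, Pi.smul_apply, smul_eq_mul, Matrix.cons_val, mul_one] at this
    exact sgnR_injective this
  subst ht
  exact ⟨z, s, h, h1⟩

theorem exists_conj_aO_sq_mul_bO : ∃ k : O3, k * (aO ^ 2 * bO) * k⁻¹ = dih (-1) 1 1 := by
  have h2 : Real.sqrt 2 * Real.sqrt 2 = 2 := Real.mul_self_sqrt (by norm_num)
  have h2' : Real.sqrt 2 ≠ 0 := by positivity
  -- The vector (0, 1, 1) spans the axis of `aO ^ 2 * bO`, and the perpendicular vector e₁ is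
  -- negated, so the rotation is by π.
  obtain ⟨k, hu, hf⟩ := exists_frame (u := ![0, (Real.sqrt 2)⁻¹, (Real.sqrt 2)⁻¹])
    (f := ![1, 0, 0])
    (by simp [dotProduct, Fin.sum_univ_three]; field_simp; nlinarith)
    (by simp [dotProduct, Fin.sum_univ_three])
    (by simp [dotProduct, Fin.sum_univ_three])
  refine ⟨k, ?_⟩
  obtain ⟨z, s, h, h1⟩ := exists_frame_conj (aO ^ 2 * bO) (t := 1) hu hf (by
    rw [aO_sq_mul_bO_smul]
    ext i
    fin_cases i <;> simp)
  have hdet : k * (aO ^ 2 * bO) * k⁻¹ ∈ SO3 := conj_mem_SO3.2 aO_sq_mul_bO_mem_SO3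
  have hneg : (aO ^ 2 * bO) • (![1, 0, 0] : Fin 3 → ℝ) = -![1, 0, 0] := by
    rw [aO_sq_mul_bO_smul]
    ext i
    fin_cases i <;> simp
  rw [hneg, vec_smul_neg, hf] at h1
  rw [h] at h1 hdet ⊢
  have hz : z = sgnC (-1) := eq_sgnC_of_smul_e1 (by rw [h1]; simp)
  rw [dih_mem_SO3.1 hdet, hz, sgnC_neg_one]

theorem areConj_C2_closure : AreConj (Cn 2) (Subgroup.closure {aO ^ 2 * bO}) := by
  obtain ⟨k, hk⟩ := exists_conj_aO_sq_mul_bO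
  refine AreConj.symm ⟨k, ?_⟩
  rw [conj_closure, Set.image_singleton, hk, Cn, rotZ_eq]
  congr 3
  rw [← exp_pi]
  congr 1
  push_cast
  ring

theorem areConj_C2h_closure : AreConj (Cnh 2) (Subgroup.closure {aO ^ 2 * bO, inversion}) := by
  obtain ⟨k, hk⟩ := exists_conj_aO_sq_mul_bO
  refine AreConj.symm ⟨k, ?_⟩
  rw [conj_closure, Set.image_pair, hk, inversion_conj, Cnh_eq (by norm_num)]
  have h1 : dih (-1) 1 1 ∈ Subgroup.closure {dih (-1) 1 1, inversion} :=
    Subgroup.subset_closure (Or.inl rfl)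
  have h2 : inversion ∈ Subgroup.closure {dih (-1) 1 1, inversion} :=
    Subgroup.subset_closure (Or.inr rfl)
  rw [inversion_eq] at h1 h2 ⊢
  apply le_antisymm
  · refine axial_le (by norm_num) ?_ ?_
    · have : rotZ (2 * Real.pi / (2 : ℕ)) = dih (-1) 1 1 := by
        rw [rotZ_eq, ← exp_pi]
        congr 2
        push_cast
        ring
      rw [this]
      exact h1
    · rintro s t rfl
      rcases Int.units_eq_one_or t with rfl | rfl
      · exact ⟨1, by simp, by rw [dih_one]; exact one_mem _⟩
      · exact ⟨-1, by simp, h2⟩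
  · rw [Subgroup.closure_le]
    rintro _ (rfl | rfl)
    · rw [SetLike.mem_coe, dih_mem_axial]; simp
    · rw [SetLike.mem_coe, dih_mem_axial]; simp

theorem exists_conj_D3 : ∃ (k : O3) (z : Circle), z ^ 3 = 1 ∧ z ≠ 1 ∧
    k * (aO * bO) * k⁻¹ = dih z 1 1 ∧ k * (bO * aO ^ 2) * k⁻¹ = dih 1 (-1) (-1) := by
  have h2 : Real.sqrt 2 * Real.sqrt 2 = 2 := Real.mul_self_sqrt (by norm_num)
  have h2' : Real.sqrt 2 ≠ 0 := by positivity
  have h3 : Real.sqrt 3 * Real.sqrt 3 = 3 := Real.mul_self_sqrt (by norm_num)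
  have h3' : Real.sqrt 3 ≠ 0 := by positivity
  set a := (Real.sqrt 3)⁻¹ with ha
  set b := (Real.sqrt 2)⁻¹ with hb
  -- The body diagonal is the axis of the three-fold rotation `aO * bO`, and the perpendicular
  -- vector (0, 1, -1) is fixed by `bO * aO ^ 2`.
  obtain ⟨k, hu, hf⟩ := exists_frame (u := ![a, a, a]) (f := ![0, b, -b])
    (by simp [dotProduct, Fin.sum_univ_three, ha]; field_simp; nlinarith)
    (by simp [dotProduct, Fin.sum_univ_three, hb]; field_simp; nlinarith)
    (by simp [dotProduct, Fin.sum_univ_three])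
  obtain ⟨z, s, h, -⟩ := exists_frame_conj (aO * bO) (t := 1) hu hf (by
    rw [aO_mul_bO_smul]
    ext i
    fin_cases i <;> simp)
  obtain ⟨w, s', h', h1'⟩ := exists_frame_conj (bO * aO ^ 2) (t := -1) hu hf (by
    rw [bO_mul_aO_sq_smul]
    ext i
    fin_cases i <;> simp)
  have hdet : k * (aO * bO) * k⁻¹ ∈ SO3 := conj_mem_SO3.2 aO_mul_bO_mem_T.2
  have hdet' : k * (bO * aO ^ 2) * k⁻¹ ∈ SO3 :=
    conj_mem_SO3.2 (mul_mem bO_mem_SO3 (pow_mem aO_mem_SO3 2))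
  have hfix : (bO * aO ^ 2) • (![0, b, -b] : Fin 3 → ℝ) = ![0, b, -b] := by
    rw [bO_mul_aO_sq_smul]
    ext i
    fin_cases i <;> simp
  rw [hfix, hf] at h1'
  rw [h'] at h1' hdet'
  rw [h] at hdet
  obtain rfl := dih_mem_SO3.1 hdet
  obtain rfl := dih_mem_SO3.1 hdet'
  obtain rfl : w = 1 := by simpa using eq_sgnC_of_smul_e1 (u := 1) (by rw [h1']; simp)
  refine ⟨k, z, ?_, ?_, h, h'⟩
  · have : dih z 1 1 ^ 3 = 1 := by
      rw [← h, conj_pow, pow_succ, sq, aO_mul_bO_cube]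
      group
    rw [dih_rot_pow, ← dih_one] at this
    exact (dih_inj this).1
  · rintro rfl
    rw [dih_one, mul_inv_eq_one, mul_eq_left] at h
    have := congrFun (congrArg (fun g : O3 => g • e1) h) 1
    simp only [aO_mul_bO_smul, one_smul, e1] at this
    norm_num at this

theorem rotZ_mem_of_prime {p : ℕ} (hp : p.Prime) {K : Subgroup O3} {z : Circle} (hz : z ^ p = 1)
    (hz1 : z ≠ 1) (hK : dih z 1 1 ∈ K) : rotZ (2 * Real.pi / p) ∈ K := by
  obtain ⟨k, hk⟩ := exists_pow_eq_of_prime hp hz hz1 (exp_pow_eq_one p hp.ne_zero)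
  rw [rotZ_eq, hk, ← dih_rot_pow]
  exact pow_mem hK k

theorem areConj_D3_closure : AreConj (Dn 3) (Subgroup.closure {aO * bO, bO * aO ^ 2}) := by
  obtain ⟨k, z, hz, hz1, h1, h2⟩ := exists_conj_D3
  refine AreConj.symm ⟨k, ?_⟩
  rw [conj_closure, Set.image_pair, h1, h2, Dn_eq (by norm_num)]
  have hz' : dih z 1 1 ∈ Subgroup.closure {dih z 1 1, dih 1 (-1) (-1)} :=
    Subgroup.subset_closure (Or.inl rfl)
  have hb' : dih 1 (-1) (-1) ∈ Subgroup.closure {dih z 1 1, dih 1 (-1) (-1)} :=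
    Subgroup.subset_closure (Or.inr rfl)
  apply le_antisymm
  · refine axial_le (by norm_num) (rotZ_mem_of_prime Nat.prime_three hz hz1 hz') ?_
    intro s t h
    obtain rfl : s = t := h
    refine ⟨1, by simp, ?_⟩
    rcases Int.units_eq_one_or s with rfl | rfl
    · rw [dih_one]; exact one_mem _
    · exact hb'
  · rw [Subgroup.closure_le]
    rintro _ (rfl | rfl)
    · rw [SetLike.mem_coe, dih_mem_axial]; simpa using hz
    · rw [SetLike.mem_coe, dih_mem_axial]; simp

theorem areConj_D3d_closure :
    AreConj (Dnd 3) (Subgroup.closure {aO * bO, bO * aO ^ 2, inversion}) := by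
  obtain ⟨k, z, hz, hz1, h1, h2⟩ := exists_conj_D3
  refine AreConj.symm ⟨k, ?_⟩
  rw [conj_closure, Set.image_insert_eq, Set.image_pair, h1, h2, inversion_conj,
    Dnd_eq (by norm_num), inversion_eq]
  have hz' : dih z 1 1 ∈ Subgroup.closure {dih z 1 1, dih 1 (-1) (-1), dih (-1) 1 (-1)} :=
    Subgroup.subset_closure (Or.inl rfl)
  have hb' : dih 1 (-1) (-1) ∈ Subgroup.closure {dih z 1 1, dih 1 (-1) (-1), dih (-1) 1 (-1)} :=
    Subgroup.subset_closure (Or.inr (Or.inl rfl))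
  have hi' : dih (-1) 1 (-1) ∈ Subgroup.closure {dih z 1 1, dih 1 (-1) (-1), dih (-1) 1 (-1)} :=
    Subgroup.subset_closure (Or.inr (Or.inr rfl))
  have h3 : (-1 : Circle) ^ 3 = -1 := Odd.neg_one_pow (by decide)
  apply le_antisymm
  · refine axial_le (by norm_num) (rotZ_mem_of_prime Nat.prime_three hz hz1 hz') ?_
    rintro s t -
    rcases Int.units_eq_one_or s with rfl | rfl <;> rcases Int.units_eq_one_or t with rfl | rfl
    · exact ⟨1, by simp, by rw [dih_one]; exact one_mem _⟩
    · exact ⟨-1, by simp [h3], hi'⟩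
    · exact ⟨-1, by simp [h3], by simpa [dih_mul] using mul_mem hi' hb'⟩
    · exact ⟨1, by simp, hb'⟩
  · rw [Subgroup.closure_le]
    rintro _ (rfl | rfl | rfl)
    · rw [SetLike.mem_coe, dih_mem_axial]; simpa using hz
    · rw [SetLike.mem_coe, dih_mem_axial]; simp
    · rw [SetLike.mem_coe, dih_mem_axial]; simp [h3]

end PointGroup

namespace PointGroup

/-! ### Poles of finite rotation groups -/

/-- This solves 1/a + 1/b + 1/c = 1 + 2/N for a ≤ b ≤ c. Bounding the three orbit lengths by N/3
gives a = 2, then b ≤ 3. The case b = 2 makes an orbit of two points, and b = 3 forces c ≤ 5. -/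
theorem orbit_numbers_sorted {N a b c x y z : ℕ} (ha : 2 ≤ a) (hab : a ≤ b) (hbc : b ≤ c)
    (hx : a * x = N) (hy : b * y = N) (hz : c * z = N) (h : x + y + z = N + 2) :
    z ≤ 2 ∨ (a = 2 ∧ b = 3 ∧ (c = 3 ∧ N = 12 ∨ c = 4 ∧ N = 24 ∨ c = 5 ∧ N = 60)) := by
  have ha2 : a = 2 := by
    by_contra hne
    have h1 : 3 * x ≤ a * x := Nat.mul_le_mul_right _ (by omega)
    have h2 : 3 * y ≤ b * y := Nat.mul_le_mul_right _ (by omega)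
    have h3 : 3 * z ≤ c * z := Nat.mul_le_mul_right _ (by omega)
    omega
  subst ha2
  have hb4 : b < 4 := by
    by_contra hne
    have h2 : 4 * y ≤ b * y := Nat.mul_le_mul_right _ (by omega)
    have h3 : 4 * z ≤ c * z := Nat.mul_le_mul_right _ (by omega)
    omega
  have hb : b = 2 ∨ b = 3 := by omega
  rcases hb with rfl | rfl
  · left; omega
  · have hc : c < 6 := by
      by_contra hne
      have h3 : 6 * z ≤ c * z := Nat.mul_le_mul_right _ (by omega)
      omega
    interval_cases c <;> omega

/-- For N = 24 and N = 60 the stabilizer order 4 or 5 occurs on exactly one orbit. This uniqueness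
is used to show that the orbit is symmetric under negation. -/
theorem orbit_numbers {N a b c x y z : ℕ} (ha : 2 ≤ a) (hb : 2 ≤ b) (hc : 2 ≤ c)
    (hx : a * x = N) (hy : b * y = N) (hz : c * z = N) (h : x + y + z = N + 2) :
    (x ≤ 2 ∨ y ≤ 2 ∨ z ≤ 2) ∨ (N = 12 ∧ (a = 3 ∨ b = 3 ∨ c = 3)) ∨
      (N = 24 ∧ (a = 4 ∧ b ≠ 4 ∧ c ≠ 4 ∨ a ≠ 4 ∧ b = 4 ∧ c ≠ 4 ∨ a ≠ 4 ∧ b ≠ 4 ∧ c = 4)) ∨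
      (N = 60 ∧ (a = 5 ∧ b ≠ 5 ∧ c ≠ 5 ∨ a ≠ 5 ∧ b = 5 ∧ c ≠ 5 ∨ a ≠ 5 ∧ b ≠ 5 ∧ c = 5)) := by
  rcases le_total a b with h1 | h1 <;> rcases le_total b c with h2 | h2 <;>
    rcases le_total a c with h3 | h3
  · have := orbit_numbers_sorted ha h1 h2 hx hy hz h
    omega
  · have := orbit_numbers_sorted ha h1 h2 hx hy hz h
    omega
  · have := orbit_numbers_sorted ha h3 h2 hx hz hy (by omega)
    omega
  · have := orbit_numbers_sorted hc h3 h1 hz hx hy (by omega)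
    omega
  · have := orbit_numbers_sorted hb h1 h3 hy hx hz (by omega)
    omega
  · have := orbit_numbers_sorted hb h2 h3 hy hz hx (by omega)
    omega
  · have := orbit_numbers_sorted hc h2 h1 hz hy hx (by omega)
    omega
  · have := orbit_numbers_sorted hc h2 h1 hz hy hx (by omega)
    omega

variable (P : Subgroup O3)

noncomputable instance (priority := 10000) subgroupVecMulAction : MulAction P (Fin 3 → ℝ) :=
  Subgroup.instMulAction

noncomputable instance (priority := 10000) subgroupVecSMul : SMul P (Fin 3 → ℝ) :=
  (subgroupVecMulAction P).toSMul

/-- The unit vectors on the axes of the non-trivial elements of `P`. -/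
def poles : Set (Fin 3 → ℝ) := {v | v ⬝ᵥ v = 1 ∧ ∃ g ∈ P, g ≠ 1 ∧ g • v = v}

variable {P} in
theorem smul_mem_poles {h : O3} (hh : h ∈ P) {v : Fin 3 → ℝ} (hv : v ∈ poles P) :
    h • v ∈ poles P := by
  obtain ⟨hv, g, hg, hg1, hgv⟩ := hv
  refine ⟨by rw [dot_vec_smul, hv], h * g * h⁻¹,
    mul_mem (mul_mem hh hg) (inv_mem hh), ?_, ?_⟩
  · intro h1
    rw [mul_inv_eq_one, mul_eq_left] at h1
    exact hg1 h1
  · rw [mul_smul, mul_smul, inv_smul_smul, hgv]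

noncomputable instance (priority := 10000) polesMulAction : MulAction P (poles P) where
  smul g v := ⟨(g : O3) • v.1, smul_mem_poles g.2 v.2⟩
  one_smul v := Subtype.ext (one_smul O3 v.1)
  mul_smul g h v := Subtype.ext (mul_smul (g : O3) (h : O3) v.1)

noncomputable instance (priority := 10000) polesSMul : SMul P (poles P) :=
  (polesMulAction P).toSMul

variable {P}

theorem ne_neg_of_unit {u : Fin 3 → ℝ} (hu : u ⬝ᵥ u = 1) : u ≠ -u := by
  intro h
  have h1 : u ⬝ᵥ u = -(u ⬝ᵥ u) := by
    nth_rewrite 2 [h]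
    rw [dotProduct_neg]
  rw [hu] at h1
  norm_num at h1

/-- The two poles are the two unit vectors on the axis of the rotation. -/
theorem card_fixedBy_poles (hP : P ≤ SO3) {g : P} (hg : g ≠ 1) :
    Nat.card (MulAction.fixedBy (poles P) g) = 2 := by
  have hg1 : (g : O3) ≠ 1 := fun h => hg (Subtype.ext h)
  obtain ⟨u, hu, hgu⟩ := exists_fixed (hP g.2)
  have hu' : u ∈ poles P := ⟨hu, g, g.2, hg1, hgu⟩
  have hnu' : -u ∈ poles P := ⟨by simpa using hu, g, g.2, hg1, by rw [vec_smul_neg, hgu]⟩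
  have : MulAction.fixedBy (poles P) g = {⟨u, hu'⟩, ⟨-u, hnu'⟩} := by
    ext ⟨v, hv⟩
    rw [MulAction.mem_fixedBy, Set.mem_insert_iff, Set.mem_singleton_iff, Subtype.ext_iff,
      Subtype.ext_iff, Subtype.ext_iff]
    change (g : O3) • v = v ↔ v = u ∨ v = -u
    constructor
    · intro h
      exact eq_or_eq_neg_of_fixed (hP g.2) hg1 hu hv.1 hgu h
    · rintro (rfl | rfl)
      · exact hgu
      · rw [vec_smul_neg, hgu]
  rw [this, Nat.card_coe_set_eq, Set.ncard_pair]
  intro h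
  exact ne_neg_of_unit hu (Subtype.ext_iff.1 h)

theorem finite_poles (hP : P ≤ SO3) [Finite P] : Finite (poles P) := by
  have h : ∀ g : {g : P // g ≠ 1}, Finite (MulAction.fixedBy (poles P) g.1) := fun g =>
    Nat.finite_of_card_ne_zero (by rw [card_fixedBy_poles hP g.2]; norm_num)
  refine Finite.of_surjective
    (fun x : Σ g : {g : P // g ≠ 1}, MulAction.fixedBy (poles P) g.1 => x.2.1) ?_
  rintro ⟨v, hv, g, hg, hg1, hgv⟩
  exact ⟨⟨⟨⟨g, hg⟩, fun h => hg1 (Subtype.ext_iff.1 h)⟩, ⟨⟨v, hv, g, hg, hg1, hgv⟩,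
    Subtype.ext hgv⟩⟩, rfl⟩

theorem two_le_card_stabilizer [Finite P] (x : poles P) :
    2 ≤ Nat.card (MulAction.stabilizer P x) := by
  obtain ⟨v, hv, g, hg, hg1, hgv⟩ := x
  have hne : (⟨⟨g, hg⟩, Subtype.ext hgv⟩ :
      MulAction.stabilizer P (⟨v, hv, g, hg, hg1, hgv⟩ : poles P)) ≠ 1 := by
    intro h
    exact hg1 (Subtype.ext_iff.1 (Subtype.ext_iff.1 h))
  have : Nontrivial (MulAction.stabilizer P (⟨v, hv, g, hg, hg1, hgv⟩ : poles P)) :=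
    ⟨⟨_, _, hne⟩⟩
  exact Finite.one_lt_card

theorem card_stabilizer_mul_card_orbit (x : poles P) :
    Nat.card (MulAction.stabilizer P x) * Nat.card (MulAction.orbit P x) = Nat.card P := by
  rw [Nat.card_coe_set_eq, ← MulAction.index_stabilizer, Subgroup.card_mul_index]

/-- Burnside's count of the orbits of poles. -/
theorem sum_card_orbits (hP : P ≤ SO3) [Finite P] [Finite (poles P)]
    [Fintype (Quotient (MulAction.orbitRel P (poles P)))] :
    (∑ ω : Quotient (MulAction.orbitRel P (poles P)), Nat.card (MulAction.orbit P ω.out)) +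
      2 * (Nat.card P - 1) =
      Fintype.card (Quotient (MulAction.orbitRel P (poles P))) * Nat.card P := by
  classical
  have := Fintype.ofFinite P
  have := Fintype.ofFinite (poles P)
  have h := MulAction.sum_card_fixedBy_eq_card_orbits_mul_card_group P (poles P)
  have hX : Nat.card (poles P) =
      ∑ ω : Quotient (MulAction.orbitRel P (poles P)), Nat.card (MulAction.orbit P ω.out) := by
    rw [Nat.card_congr (MulAction.selfEquivSigmaOrbits P (poles P)), Nat.card_sigma]
  rw [← Finset.add_sum_erase _ _ (Finset.mem_univ (1 : P))] at h
  have h1 : Fintype.card (MulAction.fixedBy (poles P) (1 : P)) = Nat.card (poles P) := by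
    rw [← Nat.card_eq_fintype_card, MulAction.fixedBy_one_eq_univ, Nat.card_coe_set_eq,
      Set.ncard_univ]
  have h2 : ∑ g ∈ Finset.univ.erase (1 : P), Fintype.card (MulAction.fixedBy (poles P) g)
      = 2 * (Nat.card P - 1) := by
    rw [Finset.sum_congr rfl fun g hg => ?_, Finset.sum_const, Finset.card_erase_of_mem
      (Finset.mem_univ _), Finset.card_univ, smul_eq_mul, mul_comm, Nat.card_eq_fintype_card]
    rw [← Nat.card_eq_fintype_card]
    exact card_fixedBy_poles hP (Finset.ne_of_mem_erase hg)
  rw [h1, h2, hX] at h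
  rw [h, Nat.card_eq_fintype_card]

/-- If g moves x to y, the orbit is {x, y}. A nontrivial rotation fixing the pole x then also fixes
y, so y lies on the line of x and y = -x. -/
theorem exists_axis_of_small_orbit (hP : P ≤ SO3) [Finite P] (x : poles P)
    (hx : Nat.card (MulAction.orbit P x) ≤ 2) :
    ∀ g ∈ P, g • x.1 = x.1 ∨ g • x.1 = -x.1 := by
  intro g hg
  by_cases hgx : g • x.1 = x.1
  · exact Or.inl hgx
  have h2 : ∀ h ∈ P, h • x.1 = x.1 ∨ h • x.1 = g • x.1 := by
    intro h hh
    by_contra! hne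
    have hfin : (MulAction.orbit P x).Finite := Set.finite_range _
    have hsub : {x, (⟨g, hg⟩ : P) • x, (⟨h, hh⟩ : P) • x} ⊆ MulAction.orbit P x := by
      rintro y (h | h | h)
      · rw [h]
        exact MulAction.mem_orbit_self x
      · rw [h]
        exact MulAction.mem_orbit _ _
      · rw [h]
        exact MulAction.mem_orbit _ _
    have h3 := Set.ncard_le_ncard hsub hfin
    rw [Set.ncard_eq_three.2 ⟨_, _, _, ?_, ?_, ?_, rfl⟩] at h3
    · rw [Nat.card_coe_set_eq] at hx
      omega
    · exact fun h => hgx (Subtype.ext_iff.1 h).symm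
    · exact fun h => hne.1 (Subtype.ext_iff.1 h).symm
    · exact fun h => hne.2 (Subtype.ext_iff.1 h).symm
  obtain ⟨hx1, k, hk, hk1, hkx⟩ := x.2
  have h3 := h2 (k * g) (mul_mem hk hg)
  have h4 : k • g • x.1 = g • x.1 := by
    rw [mul_smul] at h3
    refine h3.resolve_left fun h => hgx ?_
    have h5 : k • g • x.1 = k • x.1 := h.trans hkx.symm
    exact smul_left_cancel k h5
  exact eq_or_eq_neg_of_fixed (hP hk) hk1 hx1 (by rw [dot_vec_smul, hx1]) hkx h4

theorem card_stabilizer_coe (x : poles P) :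
    Nat.card (MulAction.stabilizer P x.1) = Nat.card (MulAction.stabilizer P x) := by
  congr 2
  ext g
  rw [MulAction.mem_stabilizer_iff, MulAction.mem_stabilizer_iff, Subtype.ext_iff]
  rfl

/-- A finite rotation group either preserves an axis or it has an orbit of poles as in a
tetrahedron, an octahedron or an icosahedron. -/
theorem exists_axis_or_pole (hP : P ≤ SO3) [Finite P] :
    (∃ u : Fin 3 → ℝ, u ⬝ᵥ u = 1 ∧ ∀ g ∈ P, g • u = u ∨ g • u = -u) ∨
      ∃ x : Fin 3 → ℝ, x ⬝ᵥ x = 1 ∧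
        ((Nat.card P = 12 ∧ Nat.card (MulAction.stabilizer P x) = 3) ∨
        (Nat.card P = 24 ∧ Nat.card (MulAction.stabilizer P x) = 4 ∧ -x ∈ MulAction.orbit P x) ∨
        (Nat.card P = 60 ∧ Nat.card (MulAction.stabilizer P x) = 5 ∧
          -x ∈ MulAction.orbit P x)) := by
  classical
  by_cases hone : Nat.card P = 1
  · left
    refine ⟨e3, e3_dot_e3, fun g hg => Or.inl ?_⟩
    have := (Nat.card_eq_one_iff_unique.1 hone).1
    have : (⟨g, hg⟩ : P) = 1 := Subsingleton.elim _ _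
    rw [show g = 1 from Subtype.ext_iff.1 this, one_smul]
  have hN0 : 0 < Nat.card P := Nat.card_pos
  have := finite_poles hP
  by_cases hsmall : ∃ x : poles P, Nat.card (MulAction.orbit P x) ≤ 2
  · obtain ⟨x, hx⟩ := hsmall
    exact Or.inl ⟨x, x.2.1, exists_axis_of_small_orbit hP x hx⟩
  right
  push Not at hsmall
  let Ω := Quotient (MulAction.orbitRel P (poles P))
  have : Fintype Ω := Fintype.ofFinite _
  have hsum := sum_card_orbits hP
  set m : Ω → ℕ := fun ω => Nat.card (MulAction.orbit P ω.out) with hm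
  set n : Ω → ℕ := fun ω => Nat.card (MulAction.stabilizer P ω.out) with hn
  have hnm : ∀ ω, n ω * m ω = Nat.card P := fun ω => card_stabilizer_mul_card_orbit _
  have hn2 : ∀ ω, 2 ≤ n ω := fun ω => two_le_card_stabilizer _
  have hm3 : ∀ ω, 3 ≤ m ω := fun ω => hsmall _
  have hm2 : ∀ ω, 2 * m ω ≤ Nat.card P := fun ω => by
    rw [← hnm ω]
    exact Nat.mul_le_mul_right _ (hn2 ω)
  -- The orbit lengths sum to kN - 2(N - 1), where k is the number of orbits. Each length is at most
  -- N/2, which excludes k ≥ 4, and at least 3, which together with N ≠ 1 excludes k ≤ 2.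
  have hcard : Fintype.card Ω = 3 := by
    have h1 : (∑ ω : Ω, 2 * m ω) ≤ ∑ ω : Ω, Nat.card P := Finset.sum_le_sum fun ω _ => hm2 ω
    have h2 : (∑ ω : Ω, 3) ≤ ∑ ω : Ω, m ω := Finset.sum_le_sum fun ω _ => hm3 ω
    rw [← Finset.mul_sum, Finset.sum_const, Finset.card_univ, smul_eq_mul] at h1
    rw [Finset.sum_const, Finset.card_univ, smul_eq_mul] at h2
    have h3 : (∑ ω : Ω, m ω) + 2 * (Nat.card P - 1) = Fintype.card Ω * Nat.card P := hsum
    have h4 : Fintype.card Ω < 4 := by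
      by_contra hne
      have : 4 * Nat.card P ≤ Fintype.card Ω * Nat.card P :=
        Nat.mul_le_mul_right _ (by omega)
      omega
    interval_cases Fintype.card Ω <;> omega
  obtain ⟨e⟩ : Nonempty (Ω ≃ Fin 3) := ⟨Fintype.equivFinOfCardEq hcard⟩
  have hs : m (e.symm 0) + m (e.symm 1) + m (e.symm 2) = Nat.card P + 2 := by
    have h3 : (∑ ω : Ω, m ω) + 2 * (Nat.card P - 1) = Fintype.card Ω * Nat.card P := hsum
    rw [hcard, ← Equiv.sum_comp e.symm, Fin.sum_univ_three] at h3
    omega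
  have hres := orbit_numbers (hn2 _) (hn2 _) (hn2 _) (hnm (e.symm 0)) (hnm (e.symm 1))
    (hnm (e.symm 2)) hs
  have hb0 := hm3 (e.symm 0)
  have hb1 := hm3 (e.symm 1)
  have hb2 := hm3 (e.symm 2)
  replace hres := hres.resolve_left (by omega)
  -- A pole and its negative have the same stabilizer. If only one orbit has stabilizers of order
  -- `k`, the negative lies in that same orbit.
  have huniq : ∀ k ω, n ω = k → (∀ ω', n ω' = k → ω' = ω) →
      -(ω.out : Fin 3 → ℝ) ∈ MulAction.orbit P (ω.out : Fin 3 → ℝ) := by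
    intro k ω hω hu
    obtain ⟨hx1, g, hg, hg1, hgx⟩ := ω.out.2
    set y : poles P := ⟨-(ω.out : Fin 3 → ℝ), by simpa using hx1, g, hg, hg1, by
      rw [vec_smul_neg, hgx]⟩ with hy
    have hst : MulAction.stabilizer P y = MulAction.stabilizer P ω.out := by
      ext h
      rw [MulAction.mem_stabilizer_iff, MulAction.mem_stabilizer_iff, Subtype.ext_iff,
        Subtype.ext_iff]
      change (h : O3) • (-(ω.out : Fin 3 → ℝ)) = -(ω.out : Fin 3 → ℝ) ↔
        (h : O3) • (ω.out : Fin 3 → ℝ) = (ω.out : Fin 3 → ℝ)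
      rw [vec_smul_neg, neg_inj]
    set ω' : Ω := Quotient.mk (MulAction.orbitRel P (poles P)) y with hω'
    have hrel : (MulAction.orbitRel P (poles P)) ω'.out y := @Quotient.mk_out _ (MulAction.orbitRel P (poles P)) y
    have hn' : n ω' = k := by
      have h1 : Nat.card (MulAction.orbit P ω'.out) = Nat.card (MulAction.orbit P y) := by
        rw [MulAction.orbit_eq_iff.2 hrel]
      have h2 := card_stabilizer_mul_card_orbit ω'.out
      have h3 := card_stabilizer_mul_card_orbit y
      rw [h1, ← h3, hst] at h2
      have h4 : 0 < Nat.card (MulAction.orbit P y) := by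
        have := hsmall y
        omega
      rw [← hω]
      exact Nat.eq_of_mul_eq_mul_right h4 h2
    have heq := hu ω' hn'
    rw [heq] at hrel
    obtain ⟨h, hh⟩ := MulAction.orbitRel_apply.1 ((MulAction.orbitRel P (poles P)).symm hrel)
    exact ⟨h, congrArg Subtype.val hh⟩
  have hall : ∀ ω, ω = e.symm 0 ∨ ω = e.symm 1 ∨ ω = e.symm 2 := by
    intro ω
    rw [← e.symm_apply_apply ω]
    generalize e ω = i
    fin_cases i <;> simp
  have fin3 : ∀ k, (∃ ω, n ω = k ∧ ∀ ω', n ω' = k → ω' = ω) →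
      ∃ x : Fin 3 → ℝ, x ⬝ᵥ x = 1 ∧ Nat.card (MulAction.stabilizer P x) = k ∧
        -x ∈ MulAction.orbit P x := by
    rintro k ⟨ω, hω, hu⟩
    exact ⟨ω.out, ω.out.2.1, by rw [card_stabilizer_coe]; exact hω, huniq k ω hω hu⟩
  have pick : ∀ k, (n (e.symm 0) = k ∧ n (e.symm 1) ≠ k ∧ n (e.symm 2) ≠ k ∨
      n (e.symm 0) ≠ k ∧ n (e.symm 1) = k ∧ n (e.symm 2) ≠ k ∨
      n (e.symm 0) ≠ k ∧ n (e.symm 1) ≠ k ∧ n (e.symm 2) = k) →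
      ∃ ω, n ω = k ∧ ∀ ω', n ω' = k → ω' = ω := by
    rintro k (⟨h0, h1, h2⟩ | ⟨h0, h1, h2⟩ | ⟨h0, h1, h2⟩)
    · refine ⟨_, h0, fun ω' h => ?_⟩
      rcases hall ω' with rfl | rfl | rfl
      exacts [rfl, absurd h h1, absurd h h2]
    · refine ⟨_, h1, fun ω' h => ?_⟩
      rcases hall ω' with rfl | rfl | rfl
      exacts [absurd h h0, rfl, absurd h h2]
    · refine ⟨_, h2, fun ω' h => ?_⟩
      rcases hall ω' with rfl | rfl | rfl
      exacts [absurd h h0, absurd h h1, rfl]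
  rcases hres with ⟨hN, h⟩ | ⟨hN, h⟩ | ⟨hN, h⟩
  · obtain ⟨ω, hω⟩ : ∃ ω, n ω = 3 := by
      rcases h with h | h | h
      exacts [⟨_, h⟩, ⟨_, h⟩, ⟨_, h⟩]
    exact ⟨ω.out, ω.out.2.1, Or.inl ⟨hN, by rw [card_stabilizer_coe]; exact hω⟩⟩
  · obtain ⟨x, hx, h1, h2⟩ := fin3 4 (pick 4 h)
    exact ⟨x, hx, Or.inr (Or.inl ⟨hN, h1, h2⟩)⟩
  · obtain ⟨x, hx, h1, h2⟩ := fin3 5 (pick 5 h)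
    exact ⟨x, hx, Or.inr (Or.inr ⟨hN, h1, h2⟩)⟩

end PointGroup

namespace PointGroup

/-! ### Standard position of the non-axial rotation groups -/

/-- The unit vector of height `c` in the `xz`-plane. -/
noncomputable def heightVec (c : ℝ) : Fin 3 → ℝ := ![Real.sqrt (1 - c ^ 2), 0, c]

theorem dih_smul_heightVec (z : Circle) (c : ℝ) : dih z 1 1 • heightVec c =
    ![(z : ℂ).re * Real.sqrt (1 - c ^ 2), (z : ℂ).im * Real.sqrt (1 - c ^ 2), c] := by
  rw [vec_smul_def, dih_val, heightVec]
  ext i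
  fin_cases i <;> simp [Matrix.mulVec, dotProduct, Fin.sum_univ_three]

theorem dih_smul_heightVec_injective {c : ℝ} (hc : c ^ 2 < 1) :
    Function.Injective fun z : Circle => dih z 1 1 • heightVec c := by
  intro z w h
  have hs : Real.sqrt (1 - c ^ 2) ≠ 0 := (Real.sqrt_pos.2 (by linarith)).ne'
  simp only [dih_smul_heightVec] at h
  have h0 := congrFun h 0
  have h1 := congrFun h 1
  simp only [Matrix.cons_val_zero, Matrix.cons_val_one] at h0 h1
  exact Circle.ext (Complex.ext (mul_right_cancel₀ hs h0) (mul_right_cancel₀ hs h1))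

theorem heightVec_dot_dih_smul {c : ℝ} (hc : c ^ 2 < 1) (z : Circle) :
    heightVec c ⬝ᵥ dih z 1 1 • heightVec c = (1 - c ^ 2) * (z : ℂ).re + c ^ 2 := by
  have hs : Real.sqrt (1 - c ^ 2) * Real.sqrt (1 - c ^ 2) = 1 - c ^ 2 :=
    Real.mul_self_sqrt (by linarith)
  rw [dih_smul_heightVec, heightVec]
  simp only [dotProduct, Fin.sum_univ_three, Matrix.cons_val_zero, Matrix.cons_val_one,
    Matrix.cons_val]
  linear_combination (z : ℂ).re * hs

/-- The vertices of a regular `p`-gon at height `c`. -/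
def polygon (p : ℕ) (c : ℝ) : Set (Fin 3 → ℝ) :=
  (fun z : Circle => dih z 1 1 • heightVec c) '' {z | z ^ p = 1}

theorem height_of_mem_polygon {p : ℕ} {c : ℝ} {v : Fin 3 → ℝ} (h : v ∈ polygon p c) : v 2 = c := by
  obtain ⟨z, -, rfl⟩ := h
  simp only [dih_smul_heightVec, Matrix.cons_val]

theorem ncard_polygon (p : ℕ) {c : ℝ} (hc : c ^ 2 < 1) :
    (polygon p c).ncard = Set.ncard {z : Circle | z ^ p = 1} :=
  Set.ncard_image_of_injective _ (dih_smul_heightVec_injective hc)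

/-- `P` is a rotation group for which the `z`-axis is `p`-fold, and `V` is the orbit of `e3`.
Only `p`-fold rotations about the `z`-axis preserve `V`. -/
structure IsStandard (p : ℕ) (V : Set (Fin 3 → ℝ)) (P : Subgroup O3) : Prop where
  le : P ≤ SO3
  rot : ∀ z, dih z 1 1 ∈ P ↔ z ^ p = 1
  orbit : MulAction.orbit P e3 = V
  rigid : ∃ v ∈ V, ∀ z, dih z 1 1 • v ∈ V → z ^ p = 1

theorem exists_rot_of_smul_e3 {g : O3} (hg : g ∈ SO3) (h : g • e3 = e3) : ∃ z, g = dih z 1 1 := by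
  obtain ⟨z, s, t, rfl⟩ := exists_dih (Or.inl h)
  obtain rfl := dih_mem_SO3.1 hg
  rcases Int.units_eq_one_or s with rfl | rfl
  · exact ⟨z, rfl⟩
  · rw [dih_smul_e3] at h
    have := congrFun h 2
    simp only [e3, sgnR_neg_one, Pi.smul_apply, Matrix.cons_val, smul_eq_mul] at this
    norm_num at this

theorem smul_mem_orbit {P : Subgroup O3} {g : O3} (hg : g ∈ P) {x v : Fin 3 → ℝ}
    (hv : v ∈ MulAction.orbit P x) : g • v ∈ MulAction.orbit P x := by
  obtain ⟨k, rfl⟩ := hv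
  exact ⟨⟨g, hg⟩ * k, mul_smul g k.1 x⟩

/-- For g in P some h in Q agrees with g at e₃, since both groups have the orbit V. Then h⁻¹g is a
rotation about the z-axis that preserves V; by rigidity it is one of the p-fold rotations, which
belong to Q. -/
theorem IsStandard.le_of_isStandard {p : ℕ} {V : Set (Fin 3 → ℝ)} {P Q : Subgroup O3}
    (hP : IsStandard p V P) (hQ : IsStandard p V Q) : P ≤ Q := by
  intro g hg
  have hgV : g • e3 ∈ MulAction.orbit Q e3 := by
    rw [hQ.orbit, ← hP.orbit]
    exact ⟨⟨g, hg⟩, rfl⟩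
  obtain ⟨⟨h, hh⟩, hhg : h • e3 = g • e3⟩ := hgV
  obtain ⟨z, hz⟩ := exists_rot_of_smul_e3 (g := h⁻¹ * g)
    (mul_mem (inv_mem (hQ.le hh)) (hP.le hg)) (by rw [mul_smul, ← hhg, inv_smul_smul])
  have hPV : ∀ v ∈ V, g • v ∈ V := by
    rw [← hP.orbit]
    exact fun v hv => smul_mem_orbit hg hv
  have hQV : ∀ v ∈ V, h⁻¹ • v ∈ V := by
    rw [← hQ.orbit]
    exact fun v hv => smul_mem_orbit (inv_mem hh) hv
  obtain ⟨v, hv, hrig⟩ := hP.rigid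
  have hz' : z ^ p = 1 := hrig z (by
    rw [← hz, mul_smul]
    exact hQV _ (hPV v hv))
  rw [show g = h * dih z 1 1 by rw [← hz, mul_inv_cancel_left]]
  exact mul_mem hh ((hQ.rot z).2 hz')

theorem IsStandard.eq {p : ℕ} {V : Set (Fin 3 → ℝ)} {P Q : Subgroup O3}
    (hP : IsStandard p V P) (hQ : IsStandard p V Q) : P = Q :=
  le_antisymm (hP.le_of_isStandard hQ) (hQ.le_of_isStandard hP)

theorem card_comap_rotHom {P : Subgroup O3} (hP : P ≤ SO3) {k : O3} {x : Fin 3 → ℝ}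
    (hk : k • x = e3) :
    Nat.card ((conj k P).comap rotHom) = Nat.card (MulAction.stabilizer P x) := by
  have hx : x = k⁻¹ • e3 := by rw [← hk, inv_smul_smul]
  have hmem : ∀ z : (conj k P).comap rotHom, k⁻¹ * dih z 1 1 * k ∈ P := fun z => mem_conj.1 z.2
  refine Nat.card_eq_of_bijective (fun z => ⟨⟨k⁻¹ * dih z 1 1 * k, hmem z⟩, ?_⟩) ⟨?_, ?_⟩
  · change (k⁻¹ * dih z 1 1 * k) • x = x
    rw [mul_smul, hk, mul_smul, dih_smul_e3, sgnR_one, one_smul, hx]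
  · intro z w h
    have h1 : k⁻¹ * dih z 1 1 * k = k⁻¹ * dih w 1 1 * k :=
      Subtype.ext_iff.1 (Subtype.ext_iff.1 h)
    rw [mul_left_inj, mul_right_inj] at h1
    exact Subtype.ext (dih_inj h1).1
  · rintro ⟨⟨g, hg⟩, hgx : g • x = x⟩
    obtain ⟨z, hz⟩ := exists_rot_of_smul_e3 (g := k * g * k⁻¹) (conj_mem_SO3.2 (hP hg))
      (by rw [mul_smul, mul_smul, ← hx, hgx, hk])
    refine ⟨⟨z, ?_⟩, ?_⟩
    · change dih z 1 1 ∈ conj k P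
      rw [← hz]
      exact conj_mem_conj hg
    · apply Subtype.ext
      apply Subtype.ext
      change k⁻¹ * dih z 1 1 * k = g
      rw [← hz]
      group

theorem card_stabilizer_mul_ncard_orbit (P : Subgroup O3) (x : Fin 3 → ℝ) :
    Nat.card (MulAction.stabilizer P x) * (MulAction.orbit P x).ncard = Nat.card P := by
  rw [← MulAction.index_stabilizer, Subgroup.card_mul_index]

/-- The inner product of g e₃ and h e₃ is the height of g⁻¹h e₃. So inner products between orbit
points are again heights of orbit points. -/
theorem orbit_dot {P : Subgroup O3} {v w : Fin 3 → ℝ} (hv : v ∈ MulAction.orbit P e3)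
    (hw : w ∈ MulAction.orbit P e3) : ∃ u ∈ MulAction.orbit P e3, v ⬝ᵥ w = u 2 := by
  obtain ⟨g, rfl⟩ := hv
  obtain ⟨h, rfl⟩ := hw
  refine ⟨(g⁻¹ * h) • e3, ⟨_, rfl⟩, ?_⟩
  have h1 : g • (g⁻¹ * h) • e3 = h • e3 := by rw [← mul_smul, mul_inv_cancel_left]
  change g • e3 ⬝ᵥ h • e3 = _
  rw [← h1]
  refine (dot_vec_smul g.1 _ _).trans ?_
  simp [e3, dotProduct, Fin.sum_univ_three]

/-- A second point of the orbit of a pole can be moved into the `xz`-plane. -/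
theorem exists_conj_heightVec {P : Subgroup O3} (hP : P ≤ SO3) [Finite P] {x y : Fin 3 → ℝ}
    (hx : x ⬝ᵥ x = 1) (hy : y ∈ MulAction.orbit P x) (h1 : y ≠ x) (h2 : y ≠ -x) :
    ∃ Q : Subgroup O3, AreConj P Q ∧ Q ≤ SO3 ∧ (x ⬝ᵥ y) ^ 2 < 1 ∧
      (∀ z, dih z 1 1 ∈ Q ↔ z ^ Nat.card (MulAction.stabilizer P x) = 1) ∧
      Set.ncard {z : Circle | z ^ Nat.card (MulAction.stabilizer P x) = 1} =
        Nat.card (MulAction.stabilizer P x) ∧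
      Nat.card (MulAction.stabilizer P x) * (MulAction.orbit Q e3).ncard = Nat.card P ∧
      heightVec (x ⬝ᵥ y) ∈ MulAction.orbit Q e3 ∧
      (-x ∈ MulAction.orbit P x → -e3 ∈ MulAction.orbit Q e3) := by
  obtain ⟨g, hg⟩ := hy
  have hyy : y ⬝ᵥ y = 1 := by
    rw [← hg, ← hx]
    exact dot_vec_smul g.1 x x
  obtain ⟨k, hkx, hky⟩ := exists_frame_pair hx hyy h1 h2
  have hconj : AreConj P (conj k P) := ⟨k, rfl⟩
  have := hconj.finite
  have hcard := card_comap_rotHom hP hkx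
  have hle : conj k P ≤ SO3 := by
    rw [← conj_SO3 k]
    exact conj_mono hP
  have hrot := dih_rot_mem_iff (conj k P)
  have horb : ∀ v ∈ MulAction.orbit P x, k • v ∈ MulAction.orbit (conj k P) e3 := by
    rintro _ ⟨h, rfl⟩
    refine ⟨⟨_, conj_mem_conj h.2⟩, ?_⟩
    change (k * h.1 * k⁻¹) • e3 = k • h.1 • x
    rw [← hkx, mul_smul, mul_smul, inv_smul_smul]
  have hst := card_comap_rotHom hle (k := 1) (one_smul O3 e3)
  rw [conj_one, hcard] at hst
  refine ⟨conj k P, hconj, hle, dot_sq_lt_one hx hyy h1 h2, hcard ▸ hrot, ?_, ?_, ?_, ?_⟩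
  · rw [← hcard, ← Nat.card_coe_set_eq]
    congr 1
    congr 1
    ext z
    exact (hrot z).symm
  · rw [hst, card_stabilizer_mul_ncard_orbit, hconj.card_eq]
  · have := horb y ⟨g, hg⟩
    rwa [hky] at this
  · intro h
    have := horb _ h
    rwa [vec_smul_neg, hkx] at this

theorem polygon_subset_orbit {Q : Subgroup O3} {p : ℕ} {c : ℝ}
    (hrot : ∀ z, dih z 1 1 ∈ Q ↔ z ^ p = 1) (hc : heightVec c ∈ MulAction.orbit Q e3) :
    polygon p c ⊆ MulAction.orbit Q e3 := by
  obtain ⟨g, hg⟩ := hc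
  rintro _ ⟨z, hz, rfl⟩
  refine ⟨⟨_, (hrot z).2 hz⟩ * g, ?_⟩
  have hg' : g.1 • e3 = heightVec c := hg
  change (dih z 1 1 * g.1) • e3 = dih z 1 1 • heightVec c
  rw [mul_smul, hg']

/-- The height of the neighbours of the pole is determined by the order of the axis. -/
theorem height_eq {Q : Subgroup O3} {p : ℕ} (hp : 2 ≤ p) {c : ℝ} (hc1 : c ^ 2 < 1)
    (hrot : ∀ z, dih z 1 1 ∈ Q ↔ z ^ p = 1) (hc : heightVec c ∈ MulAction.orbit Q e3)
    (h : ∀ u ∈ MulAction.orbit Q e3,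
      u 2 = (1 - c ^ 2) * Real.cos (2 * Real.pi / p) + c ^ 2 → u 2 = 1 ∨ u 2 = c) :
    c = Real.cos (2 * Real.pi / p) / (1 - Real.cos (2 * Real.pi / p)) := by
  have hre : (Circle.exp (2 * Real.pi / p) : ℂ).re = Real.cos (2 * Real.pi / p) := by
    rw [Circle.coe_exp, Complex.exp_ofReal_mul_I_re]
  have him : (Circle.exp (2 * Real.pi / p) : ℂ).im = Real.sin (2 * Real.pi / p) := by
    rw [Circle.coe_exp, Complex.exp_ofReal_mul_I_im]
  have hC : Real.cos (2 * Real.pi / p) ≠ 1 := by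
    intro hC
    refine exp_ne_one p hp (Circle.ext (Complex.ext (hre.trans hC) (him.trans ?_)))
    have := Real.sin_sq_add_cos_sq (2 * Real.pi / p)
    rw [hC] at this
    have h0 : Real.sin (2 * Real.pi / p) = 0 := by
      apply pow_eq_zero_iff (two_ne_zero) |>.1
      linarith
    simpa using h0
  have hmem := polygon_subset_orbit hrot hc
    ⟨_, exp_pow_eq_one p (by omega), rfl⟩
  -- Two neighbouring vertices of the polygon at height `c` have inner product (1 - c²) cos(2π/p) +
  -- c², which must be a height in the orbit.
  obtain ⟨u, hu, hdot⟩ := orbit_dot hc hmem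
  rw [heightVec_dot_dih_smul hc1, hre] at hdot
  have hne : c ≠ 1 := by
    rintro rfl
    norm_num at hc1
  have h3 := h u hu hdot.symm
  rw [← hdot] at h3
  rw [eq_div_iff (sub_ne_zero.2 hC.symm)]
  rcases h3 with h3 | h3
  · exfalso
    have h4 : (1 - c ^ 2) * (Real.cos (2 * Real.pi / p) - 1) = 0 := by linarith
    rcases mul_eq_zero.1 h4 with h5 | h5
    · linarith
    · exact hC (by linarith)
  -- Equating this inner product with `c` gives a quadratic equation whose root `c = 1` is excluded.
  · have h4 : (c - 1) * (c * (1 - Real.cos (2 * Real.pi / p)) - Real.cos (2 * Real.pi / p)) = 0 := by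
      linear_combination h3
    have := (mul_eq_zero.1 h4).resolve_left (sub_ne_zero.2 hne)
    linarith

/-- The height of the neighbours of a pole of order `p`. -/
noncomputable def poleHeight (p : ℕ) : ℝ :=
  Real.cos (2 * Real.pi / p) / (1 - Real.cos (2 * Real.pi / p))

theorem e3_notMem_polygon {p : ℕ} {c : ℝ} (hc : c ^ 2 < 1) : e3 ∉ polygon p c := by
  intro h
  have := height_of_mem_polygon h
  simp only [e3, Matrix.cons_val] at this
  rw [← this] at hc
  norm_num at hc

theorem neg_e3_notMem_polygon {p : ℕ} {c : ℝ} (hc : c ^ 2 < 1) : -e3 ∉ polygon p c := by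
  intro h
  have := height_of_mem_polygon h
  simp only [e3, Pi.neg_apply, Matrix.cons_val] at this
  rw [← this] at hc
  norm_num at hc

theorem heightVec_mem_polygon (p : ℕ) (c : ℝ) : heightVec c ∈ polygon p c :=
  ⟨1, one_pow p, by simp only [dih_one, one_smul]⟩

theorem pow_eq_one_of_mem_polygon {p : ℕ} {c : ℝ} (hc : c ^ 2 < 1) {z : Circle}
    (h : dih z 1 1 • heightVec c ∈ polygon p c) : z ^ p = 1 := by
  obtain ⟨w, hw, h⟩ := h
  rw [← dih_smul_heightVec_injective hc h]
  exact hw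

theorem e3_ne_neg_e3 : e3 ≠ -e3 := ne_neg_of_unit e3_dot_e3

theorem height_smul_heightVec (z : Circle) (c : ℝ) : (dih z 1 1 • heightVec c) 2 = c := by
  simp only [dih_smul_heightVec, Matrix.cons_val]

theorem dih_smul_heightVec_ne_e3 {c : ℝ} (hc : c ^ 2 < 1) (z : Circle) :
    dih z 1 1 • heightVec c ≠ e3 := by
  intro h
  have h1 := height_smul_heightVec z c
  rw [h] at h1
  simp only [e3, Matrix.cons_val] at h1
  rw [← h1] at hc
  norm_num at hc

theorem dih_smul_heightVec_ne_neg_e3 {c : ℝ} (hc : c ^ 2 < 1) (z : Circle) :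
    dih z 1 1 • heightVec c ≠ -e3 := by
  intro h
  have h1 := height_smul_heightVec z c
  rw [h] at h1
  simp only [e3, Pi.neg_apply, Matrix.cons_val] at h1
  rw [← h1] at hc
  norm_num at hc

theorem exists_mem_orbit_ne {P : Subgroup O3} {x : Fin 3 → ℝ}
    (h : 2 < (MulAction.orbit P x).ncard) : ∃ y ∈ MulAction.orbit P x, y ≠ x ∧ y ≠ -x := by
  have h2 : ({x, -x} : Set (Fin 3 → ℝ)).ncard ≤ 2 := by
    exact (Set.ncard_insert_le _ _).trans (by rw [Set.ncard_singleton])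
  obtain ⟨y, hy, hyn⟩ := Set.exists_mem_notMem_of_ncard_lt_ncard (h2.trans_lt h)
    (Set.toFinite _)
  exact ⟨y, hy, fun h => hyn (Or.inl h), fun h => hyn (Or.inr h)⟩

theorem orbit_finite (P : Subgroup O3) [Finite P] (x : Fin 3 → ℝ) :
    (MulAction.orbit P x).Finite := Set.finite_range _

/-- The orbit has 12/3 = 4 points: the pole and the triangle obtained by rotating a second point
about it. -/
theorem exists_isStandard_tetrahedral {P : Subgroup O3} (hP : P ≤ SO3) [Finite P] {x : Fin 3 → ℝ}
    (hx : x ⬝ᵥ x = 1) (h12 : Nat.card P = 12) (h3 : Nat.card (MulAction.stabilizer P x) = 3) :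
    ∃ Q, AreConj P Q ∧ IsStandard 3 (insert e3 (polygon 3 (poleHeight 3))) Q := by
  have hcard := card_stabilizer_mul_ncard_orbit P x
  rw [h12, h3] at hcard
  obtain ⟨y, hy, h1, h2⟩ := exists_mem_orbit_ne (P := P) (x := x) (by omega)
  obtain ⟨Q, hQ, hle, hc, hrot, hroots, hcard', hmem, -⟩ := exists_conj_heightVec hP hx hy h1 h2
  have := hQ.finite
  set c := x ⬝ᵥ y
  rw [h3] at hrot hroots hcard'
  rw [h12] at hcard'
  have horb : insert e3 (polygon 3 c) = MulAction.orbit Q e3 := by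
    refine Set.eq_of_subset_of_ncard_le (Set.insert_subset (MulAction.mem_orbit_self _)
      (polygon_subset_orbit hrot hmem)) ?_ (orbit_finite _ _)
    have hfin : (polygon 3 c).Finite :=
      (orbit_finite Q e3).subset (polygon_subset_orbit hrot hmem)
    rw [Set.ncard_insert_of_notMem (e3_notMem_polygon hc) hfin, ncard_polygon _ hc, hroots]
    omega
  have hceq := height_eq (p := 3) (by norm_num) hc hrot hmem (by
    rw [← horb]
    rintro u (rfl | hu) -
    · left; simp [e3]
    · right; exact height_of_mem_polygon hu)
  refine ⟨Q, hQ, hle, hrot, ?_, ?_⟩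
  · rw [← horb, hceq, poleHeight]
  · rw [poleHeight, ← hceq]
    refine ⟨heightVec c, Or.inr (heightVec_mem_polygon _ _), fun z hz => ?_⟩
    rcases hz with hz | hz
    · exact absurd hz (dih_smul_heightVec_ne_e3 hc z)
    · exact pow_eq_one_of_mem_polygon hc hz

/-- The orbit has 24/4 = 6 points: the pole, its negative and a square. -/
theorem exists_isStandard_octahedral {P : Subgroup O3} (hP : P ≤ SO3) [Finite P] {x : Fin 3 → ℝ}
    (hx : x ⬝ᵥ x = 1) (h24 : Nat.card P = 24) (h4 : Nat.card (MulAction.stabilizer P x) = 4)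
    (hneg : -x ∈ MulAction.orbit P x) :
    ∃ Q, AreConj P Q ∧
      IsStandard 4 (insert e3 (insert (-e3) (polygon 4 (poleHeight 4)))) Q := by
  have hcard := card_stabilizer_mul_ncard_orbit P x
  rw [h24, h4] at hcard
  obtain ⟨y, hy, h1, h2⟩ := exists_mem_orbit_ne (P := P) (x := x) (by omega)
  obtain ⟨Q, hQ, hle, hc, hrot, hroots, hcard', hmem, hneg'⟩ :=
    exists_conj_heightVec hP hx hy h1 h2
  have := hQ.finite
  set c := x ⬝ᵥ y
  rw [h4] at hrot hroots hcard'
  rw [h24] at hcard'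
  have horb : insert e3 (insert (-e3) (polygon 4 c)) = MulAction.orbit Q e3 := by
    refine Set.eq_of_subset_of_ncard_le (Set.insert_subset (MulAction.mem_orbit_self _)
      (Set.insert_subset (hneg' hneg) (polygon_subset_orbit hrot hmem))) ?_ (orbit_finite _ _)
    have hfin : (polygon 4 c).Finite :=
      (orbit_finite Q e3).subset (polygon_subset_orbit hrot hmem)
    rw [Set.ncard_insert_of_notMem ?_ (hfin.insert _),
      Set.ncard_insert_of_notMem (neg_e3_notMem_polygon hc) hfin, ncard_polygon _ hc, hroots]
    · omega
    · rintro (h | h)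
      exacts [e3_ne_neg_e3 h, e3_notMem_polygon hc h]
  have hceq := height_eq (p := 4) (by norm_num) hc hrot hmem (by
    have hcos : Real.cos (2 * Real.pi / (4 : ℕ)) = 0 := by
      rw [← Real.cos_pi_div_two]
      congr 1
      push_cast
      ring
    rw [← horb, hcos]
    rintro u (rfl | rfl | hu) h
    · left; simp [e3]
    -- As cos(π/2) = 0, the inner product of neighbours is c², which cannot be the height -1.
    · simp only [e3, Pi.neg_apply, Matrix.cons_val] at h
      nlinarith [sq_nonneg c]
    · right; exact height_of_mem_polygon hu)
  refine ⟨Q, hQ, hle, hrot, ?_, ?_⟩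
  · rw [← horb, hceq, poleHeight]
  · rw [poleHeight, ← hceq]
    refine ⟨heightVec c, Or.inr (Or.inr (heightVec_mem_polygon _ _)), fun z hz => ?_⟩
    rcases hz with hz | hz | hz
    · exact absurd hz (dih_smul_heightVec_ne_e3 hc z)
    · exact absurd hz (dih_smul_heightVec_ne_neg_e3 hc z)
    · exact pow_eq_one_of_mem_polygon hc hz

theorem neg_mem_orbit {P : Subgroup O3} {x v : Fin 3 → ℝ} (hneg : -x ∈ MulAction.orbit P x)
    (hv : v ∈ MulAction.orbit P x) : -v ∈ MulAction.orbit P x := by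
  obtain ⟨g, rfl⟩ := hv
  obtain ⟨h, hh⟩ := hneg
  refine ⟨g * h, ?_⟩
  change (g * h) • x = -(g.1 • x)
  rw [mul_smul, ← vec_smul_neg, ← hh]
  rfl

/-- Opposite points in one polygon force c = 0, and then z and -z are both p-th roots of unity up to
identification. For odd p this is impossible. -/
theorem neg_notMem_polygon {p : ℕ} (hp : Odd p) {c : ℝ} (hc : c ^ 2 < 1) {v : Fin 3 → ℝ}
    (hv : v ∈ polygon p c) : -v ∉ polygon p c := by
  rintro ⟨w, hw, h⟩
  obtain ⟨z, hz, rfl⟩ := hv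
  have h2 := height_smul_heightVec w c
  simp only at h
  rw [h, Pi.neg_apply, height_smul_heightVec] at h2
  have hc0 : c = 0 := by linarith
  have h3 : dih w 1 1 • heightVec c = dih (-z) 1 1 • heightVec c := by
    rw [h, dih_smul_heightVec, dih_smul_heightVec]
    ext i
    fin_cases i <;> simp [hc0]
  have h4 := dih_smul_heightVec_injective hc h3
  rw [Set.mem_ofPred_eq] at hz hw
  rw [h4, hp.neg_pow, hz] at hw
  exact circle_neg_one_ne_one hw

theorem cos_two_pi_div_five_pos : 0 < Real.cos (2 * Real.pi / (5 : ℕ)) := by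
  apply Real.cos_pos_of_mem_Ioo
  have := Real.pi_pos
  constructor
  · have : 0 < 2 * Real.pi / (5 : ℕ) := by positivity
    linarith
  · push_cast
    linarith

theorem cos_two_pi_div_five_lt_one : Real.cos (2 * Real.pi / (5 : ℕ)) < 1 := by
  have h1 := Real.pi_pos
  rw [← Real.cos_zero]
  apply Real.cos_lt_cos_of_nonneg_of_le_pi le_rfl <;> push_cast <;> linarith

/-- The orbit has 60/5 = 12 points: the pole, its negative, a pentagon and the opposite pentagon. -/
theorem exists_isStandard_icosahedral {P : Subgroup O3} (hP : P ≤ SO3) [Finite P]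
    {x : Fin 3 → ℝ} (hx : x ⬝ᵥ x = 1) (h60 : Nat.card P = 60)
    (h5 : Nat.card (MulAction.stabilizer P x) = 5) (hneg : -x ∈ MulAction.orbit P x) :
    ∃ Q, AreConj P Q ∧ IsStandard 5
      (insert e3 (insert (-e3) (polygon 5 (poleHeight 5) ∪ -polygon 5 (poleHeight 5)))) Q := by
  have hcard := card_stabilizer_mul_ncard_orbit P x
  rw [h60, h5] at hcard
  -- The orbit is symmetric under negation, so the second point may be taken in the closed upper
  -- half-space.
  obtain ⟨y, hy, h1, h2, hpos⟩ :
      ∃ y ∈ MulAction.orbit P x, y ≠ x ∧ y ≠ -x ∧ 0 ≤ x ⬝ᵥ y := by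
    obtain ⟨y, hy, h1, h2⟩ := exists_mem_orbit_ne (P := P) (x := x) (by omega)
    rcases le_total 0 (x ⬝ᵥ y) with h | h
    · exact ⟨y, hy, h1, h2, h⟩
    · refine ⟨-y, neg_mem_orbit hneg hy, fun h => h2 (by rw [← h, neg_neg]),
        fun h => h1 (neg_inj.1 h), ?_⟩
      rw [dotProduct_neg]
      linarith
  obtain ⟨Q, hQ, hle, hc, hrot, hroots, hcard', hmem, hneg'⟩ :=
    exists_conj_heightVec hP hx hy h1 h2
  have := hQ.finite
  set c := x ⬝ᵥ y
  rw [h5] at hrot hroots hcard'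
  rw [h60] at hcard'
  have hodd : Odd 5 := by decide
  have hsub := polygon_subset_orbit hrot hmem
  have hsub' : polygon 5 c ∪ -polygon 5 c ⊆ MulAction.orbit Q e3 := by
    refine Set.union_subset hsub fun v hv => ?_
    rw [← neg_neg v]
    exact neg_mem_orbit (hneg' hneg) (hsub hv)
  have horb : insert e3 (insert (-e3) (polygon 5 c ∪ -polygon 5 c)) = MulAction.orbit Q e3 := by
    refine Set.eq_of_subset_of_ncard_le (Set.insert_subset (MulAction.mem_orbit_self _)
      (Set.insert_subset (hneg' hneg) hsub')) ?_ (orbit_finite _ _)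
    have hfin : (polygon 5 c).Finite := (orbit_finite Q e3).subset hsub
    have hfin' : (-polygon 5 c).Finite := (orbit_finite Q e3).subset
      (Set.subset_union_right.trans hsub')
    have hdisj : Disjoint (polygon 5 c) (-polygon 5 c) :=
      Set.disjoint_left.2 fun v hv hv' => neg_notMem_polygon hodd hc hv hv'
    rw [Set.ncard_insert_of_notMem ?_ ((hfin.union hfin').insert _),
      Set.ncard_insert_of_notMem ?_ (hfin.union hfin'), Set.ncard_union_eq hdisj hfin hfin',
      ← Set.image_neg_eq_neg, Set.ncard_image_of_injective _ neg_injective,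
      ncard_polygon _ hc, hroots]
    · omega
    · rintro (h | h)
      · exact neg_e3_notMem_polygon hc h
      · rw [Set.mem_neg, neg_neg] at h
        exact e3_notMem_polygon hc h
    · rintro (h | h | h)
      exacts [e3_ne_neg_e3 h, e3_notMem_polygon hc h, neg_e3_notMem_polygon hc h]
  have hceq := height_eq (p := 5) (by norm_num) hc hrot hmem (by
    have hcos := cos_two_pi_div_five_pos
    -- The inner product of neighbours is positive, and `c ≥ 0`, so the heights -1 and `-c` of the
    -- lower half cannot occur.
    have hprod : 0 < (1 - c ^ 2) * Real.cos (2 * Real.pi / (5 : ℕ)) :=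
      mul_pos (by linarith) hcos
    rw [← horb]
    rintro u (rfl | rfl | hu | hu) h
    · left; simp [e3]
    · simp only [e3, Pi.neg_apply, Matrix.cons_val] at h
      nlinarith [sq_nonneg c]
    · right; exact height_of_mem_polygon hu
    · have h3 := height_of_mem_polygon hu
      rw [Pi.neg_apply] at h3
      nlinarith [sq_nonneg c])
  -- The two pentagons lie at different heights, so a rotation about the axis cannot take one into
  -- the other.
  have hc0 : c ≠ 0 := by
    rw [hceq]
    exact (div_pos cos_two_pi_div_five_pos (sub_pos.2 cos_two_pi_div_five_lt_one)).ne'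
  refine ⟨Q, hQ, hle, hrot, ?_, ?_⟩
  · rw [← horb, hceq, poleHeight]
  · rw [poleHeight, ← hceq]
    refine ⟨heightVec c, Or.inr (Or.inr (Or.inl (heightVec_mem_polygon _ _))), fun z hz => ?_⟩
    rcases hz with hz | hz | hz | hz
    · exact absurd hz (dih_smul_heightVec_ne_e3 hc z)
    · exact absurd hz (dih_smul_heightVec_ne_neg_e3 hc z)
    · exact pow_eq_one_of_mem_polygon hc hz
    · have h3 := height_of_mem_polygon hz
      rw [Pi.neg_apply, height_smul_heightVec] at h3
      exact absurd (by linarith) hc0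

/-- Some line is preserved by `P`. -/
def HasAxis (P : Subgroup O3) : Prop :=
  ∃ u : Fin 3 → ℝ, u ⬝ᵥ u = 1 ∧ ∀ g ∈ P, g • u = u ∨ g • u = -u

theorem card_of_not_hasAxis {P : Subgroup O3} (hP : P ≤ SO3) [Finite P] (h : ¬ HasAxis P) :
    Nat.card P = 12 ∨ Nat.card P = 24 ∨ Nat.card P = 60 := by
  rcases exists_axis_or_pole hP with h1 | ⟨x, -, h1 | h1 | h1⟩
  exacts [absurd h1 h, Or.inl h1.1, Or.inr (Or.inl h1.1), Or.inr (Or.inr h1.1)]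

/-- Rotation groups without an axis are determined by their order. -/
theorem areConj_of_card_eq {P Q : Subgroup O3} (hP : P ≤ SO3) (hQ : Q ≤ SO3) [Finite P] [Finite Q]
    (hP' : ¬ HasAxis P) (hQ' : ¬ HasAxis Q) (h : Nat.card P = Nat.card Q) : AreConj P Q := by
  have key : ∀ {p V}, (∃ P', AreConj P P' ∧ IsStandard p V P') →
      (∃ Q', AreConj Q Q' ∧ IsStandard p V Q') → AreConj P Q := by
    rintro p V ⟨P', hPP, hP'⟩ ⟨Q', hQQ, hQ'⟩
    rw [hP'.eq hQ'] at hPP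
    exact hPP.trans hQQ.symm
  rcases exists_axis_or_pole hP with h1 | ⟨x, hx, h1 | h1 | h1⟩
  · exact absurd h1 hP'
  all_goals rcases exists_axis_or_pole hQ with h2 | ⟨y, hy, h2 | h2 | h2⟩
  all_goals first
    | exact absurd h2 hQ'
    | exact key (exists_isStandard_tetrahedral hP hx h1.1 h1.2)
        (exists_isStandard_tetrahedral hQ hy h2.1 h2.2)
    | exact key (exists_isStandard_octahedral hP hx h1.1 h1.2.1 h1.2.2)
        (exists_isStandard_octahedral hQ hy h2.1 h2.2.1 h2.2.2)
    | exact key (exists_isStandard_icosahedral hP hx h1.1 h1.2.1 h1.2.2)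
        (exists_isStandard_icosahedral hQ hy h2.1 h2.2.1 h2.2.2)
    | (have := h1.1; have := h2.1; omega)

end PointGroup

namespace PointGroup

/-! ### The icosahedral group -/

/-- The golden ratio, as a constant that is not unfolded to `(1 + √5) / 2`. -/
noncomputable def gold : ℝ := Real.goldenRatio

theorem gold_sq : gold ^ 2 = gold + 1 := Real.goldenRatio_sq

theorem gold_ne_zero : gold ≠ 0 := Real.goldenRatio_ne_zero

theorem mem_icosahedron {v : Fin 3 → ℝ} : v ∈ icosahedron ↔
    (v 0 = 0 ∧ v 1 ^ 2 = 1 ∧ v 2 ^ 2 = gold ^ 2) ∨ (v 1 = 0 ∧ v 2 ^ 2 = 1 ∧ v 0 ^ 2 = gold ^ 2) ∨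
      (v 2 = 0 ∧ v 0 ^ 2 = 1 ∧ v 1 ^ 2 = gold ^ 2) := by
  simp only [sq_eq_sq_iff_eq_or_eq_neg, sq_eq_one_iff]
  constructor
  · rintro ⟨i, h⟩
    fin_cases i
    exacts [Or.inl h, Or.inr (Or.inl h), Or.inr (Or.inr h)]
  · rintro (h | h | h)
    exacts [⟨0, h⟩, ⟨1, h⟩, ⟨2, h⟩]

theorem finite_icosahedron : icosahedron.Finite := by
  refine (Set.Finite.pi' fun _ : Fin 3 =>
    (Set.toFinite ({0, 1, -1, Real.goldenRatio, -Real.goldenRatio} : Set ℝ))).subset fun v hv => ?_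
  obtain ⟨i, h0, h1, h2⟩ := hv
  intro j
  have hj : j = i ∨ j = i + 1 ∨ j = i + 2 := by
    clear h0 h1 h2
    revert i j
    decide
  simp only [Set.mem_insert_iff, Set.mem_singleton_iff]
  rcases hj with rfl | rfl | rfl <;> tauto

theorem mem_symmetryGroup_of_forall {V : Set (Fin 3 → ℝ)} (hV : V.Finite) {g : O3}
    (h : ∀ v ∈ V, g • v ∈ V) : g ∈ symmetryGroup V := by
  have hsub : (fun v => g • v) '' V ⊆ V := by
    rintro _ ⟨v, hv, rfl⟩
    exact h v hv
  have heq := Set.eq_of_subset_of_ncard_le hsub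
    (Set.ncard_image_of_injective V (MulAction.injective g)).ge hV
  refine mem_symmetryGroup.2 fun v => ⟨fun hv => ?_, h v⟩
  rw [← heq] at hv
  obtain ⟨w, hw, hwv⟩ := hv
  rwa [← smul_left_cancel g hwv]

theorem mem_Ih_of_forall {g : O3} (h : ∀ v ∈ icosahedron, g • v ∈ icosahedron) : g ∈ Ih :=
  mem_symmetryGroup_of_forall finite_icosahedron h

theorem diag3_mem_Ih (a b c : ℤˣ) : diag3 a b c ∈ Ih := by
  refine mem_Ih_of_forall fun v hv => ?_
  have h : ∀ (s : ℤˣ) (x : ℝ), (sgnR s * x) ^ 2 = x ^ 2 := fun s x => by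
    rw [mul_pow, sq (sgnR s), sgnR_mul_self, one_mul]
  have h0 : ∀ (s : ℤˣ) (x : ℝ), sgnR s * x = 0 ↔ x = 0 := fun s x => by
    rcases Int.units_eq_one_or s with rfl | rfl <;> simp
  rw [mem_icosahedron] at hv ⊢
  rw [diag3_smul]
  simpa only [Matrix.cons_val_zero, Matrix.cons_val_one, Matrix.cons_val, h, h0] using hv

theorem aO_mul_bO_mem_Ih : aO * bO ∈ Ih := by
  refine mem_Ih_of_forall fun v hv => ?_
  rw [mem_icosahedron] at hv ⊢
  rw [aO_mul_bO_smul]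
  simp only [Matrix.cons_val_zero, Matrix.cons_val_one, Matrix.cons_val]
  tauto

theorem inversion_mem_Ih : inversion ∈ Ih := by
  rw [inversion_eq_diag3]
  exact diag3_mem_Ih _ _ _

/-- A five-fold rotation of the icosahedron. -/
noncomputable def rotI : O3 :=
  ⟨!![1 / 2, (gold - 1) / 2, -gold / 2; (gold - 1) / 2, gold / 2, 1 / 2; gold / 2, -1 / 2, (gold - 1) / 2], by
    have h := gold_sq
    rw [Matrix.mem_orthogonalGroup_iff]
    ext i j
    fin_cases i <;> fin_cases j <;> simp [Matrix.mul_apply, Fin.sum_univ_three] <;>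
      nlinarith only [h]⟩

theorem rotI_smul (v : Fin 3 → ℝ) : rotI • v =
    ![(v 0 + (gold - 1) * v 1 - gold * v 2) / 2, ((gold - 1) * v 0 + gold * v 1 + v 2) / 2,
      (gold * v 0 - v 1 + (gold - 1) * v 2) / 2] := by
  rw [vec_smul_def, rotI]
  ext i
  fin_cases i <;> simp [Matrix.mulVec, dotProduct, Fin.sum_univ_three] <;> ring

theorem rotI_mem_SO3 : rotI ∈ SO3 := by
  have h := gold_sq
  rw [mem_SO3, rotI, Matrix.det_fin_three]
  simp
  linear_combination (3 / 4 : ℝ) * h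

theorem rotI_mem_Ih : rotI ∈ Ih := by
  have h := gold_sq
  have key : ∀ x y : ℝ, x ^ 2 = 1 → y ^ 2 = gold ^ 2 → y = gold * x ∨ y = -(gold * x) := by
    intro x y hx hy
    rw [← sq_eq_sq_iff_eq_or_eq_neg, hy, mul_pow, hx, mul_one]
  refine mem_Ih_of_forall fun v hv => ?_
  rw [mem_icosahedron] at hv ⊢
  rw [rotI_smul]
  simp only [Matrix.cons_val_zero, Matrix.cons_val_one, Matrix.cons_val]
  rcases hv with ⟨h0, h1, h2⟩ | ⟨h0, h1, h2⟩ | ⟨h0, h1, h2⟩ <;>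
    rcases key _ _ h1 h2 with h3 | h3 <;> rw [h0, h3]
  · have e0 : (0 + (gold - 1) * v 1 - gold * (gold * v 1)) / 2 = -v 1 := by
      linear_combination (-v 1 / 2) * h
    have e1 : ((gold - 1) * 0 + gold * v 1 + gold * v 1) / 2 = gold * v 1 := by ring
    have e2 : (gold * 0 - v 1 + (gold - 1) * (gold * v 1)) / 2 = 0 := by
      linear_combination (v 1 / 2) * h
    rw [e0, e1, e2, mul_pow, neg_sq, h1]
    simp
  · have e0 : (0 + (gold - 1) * v 1 - gold * -(gold * v 1)) / 2 = gold * v 1 := by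
      linear_combination (v 1 / 2) * h
    have e1 : ((gold - 1) * 0 + gold * v 1 + -(gold * v 1)) / 2 = 0 := by ring
    have e2 : (gold * 0 - v 1 + (gold - 1) * -(gold * v 1)) / 2 = -v 1 := by
      linear_combination (-v 1 / 2) * h
    rw [e0, e1, e2, mul_pow, neg_sq, h1]
    simp
  · have e0 : (gold * v 2 + (gold - 1) * 0 - gold * v 2) / 2 = 0 := by ring
    have e1 : ((gold - 1) * (gold * v 2) + gold * 0 + v 2) / 2 = v 2 := by
      linear_combination (v 2 / 2) * h
    have e2 : (gold * (gold * v 2) - 0 + (gold - 1) * v 2) / 2 = gold * v 2 := by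
      linear_combination (v 2 / 2) * h
    rw [e0, e1, e2, mul_pow, h1]
    simp
  · have e0 : (-(gold * v 2) + (gold - 1) * 0 - gold * v 2) / 2 = -(gold * v 2) := by ring
    have e1 : ((gold - 1) * -(gold * v 2) + gold * 0 + v 2) / 2 = 0 := by
      linear_combination (-v 2 / 2) * h
    have e2 : (gold * -(gold * v 2) - 0 + (gold - 1) * v 2) / 2 = -v 2 := by
      linear_combination (-v 2 / 2) * h
    rw [e0, e1, e2, neg_sq, neg_sq, mul_pow, h1]
    simp
  · have e0 : (v 0 + (gold - 1) * (gold * v 0) - gold * 0) / 2 = v 0 := by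
      linear_combination (v 0 / 2) * h
    have e1 : ((gold - 1) * v 0 + gold * (gold * v 0) + 0) / 2 = gold * v 0 := by
      linear_combination (v 0 / 2) * h
    have e2 : (gold * v 0 - gold * v 0 + (gold - 1) * 0) / 2 = 0 := by ring
    rw [e0, e1, e2, mul_pow, h1]
    simp
  · have e0 : (v 0 + (gold - 1) * -(gold * v 0) - gold * 0) / 2 = 0 := by
      linear_combination (-v 0 / 2) * h
    have e1 : ((gold - 1) * v 0 + gold * -(gold * v 0) + 0) / 2 = -v 0 := by
      linear_combination (-v 0 / 2) * h
    have e2 : (gold * v 0 - -(gold * v 0) + (gold - 1) * 0) / 2 = gold * v 0 := by ring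
    rw [e0, e1, e2, mul_pow, neg_sq, h1]
    simp

theorem rotI_mem_I : rotI ∈ I := ⟨rotI_mem_Ih, rotI_mem_SO3⟩

theorem rotI_smul_fixed : rotI • (![1, gold, 0] : Fin 3 → ℝ) = ![1, gold, 0] := by
  have h := gold_sq
  rw [rotI_smul]
  ext i
  fin_cases i <;> simp <;> linear_combination (1 / 2) * h

theorem rotI_smul_vertex : rotI • (![gold, 0, 1] : Fin 3 → ℝ) = ![0, 1, gold] := by
  have h := gold_sq
  rw [rotI_smul]
  ext i
  fin_cases i <;> simp <;> linear_combination (1 / 2) * h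

theorem rotI_ne_one : rotI ≠ 1 := by
  intro h
  have h1 := rotI_smul_vertex
  rw [h, one_smul] at h1
  exact gold_ne_zero (congrFun h1 0)

/-- The rotation fixes the vertex (1, φ, 0) and moves (φ, 0, 1) through a cycle of five vertices.
Its fifth power fixes both, and they are not parallel. -/
theorem rotI_pow_five : rotI ^ 5 = 1 := by
  have h := gold_sq
  have h2 : rotI • (![0, 1, gold] : Fin 3 → ℝ) = ![-1, gold, 0] := by
    rw [rotI_smul]
    ext i
    fin_cases i <;> simp <;> linarith
  have h3 : rotI • (![-1, gold, 0] : Fin 3 → ℝ) = ![0, 1, -gold] := by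
    rw [rotI_smul]
    ext i
    fin_cases i <;> simp <;> linarith
  have h4 : rotI • (![0, 1, -gold] : Fin 3 → ℝ) = ![gold, 0, -1] := by
    rw [rotI_smul]
    ext i
    fin_cases i <;> simp <;> linarith
  have h5 : rotI • (![gold, 0, -1] : Fin 3 → ℝ) = ![gold, 0, 1] := by
    rw [rotI_smul]
    ext i
    fin_cases i <;> simp <;> linarith
  refine eq_one_of_fixes_two (pow_mem rotI_mem_SO3 5) (u := ![1, gold, 0]) (v := ![gold, 0, 1]) ?_ ?_ ?_
  · simp only [pow_succ, pow_zero, one_mul, mul_smul, rotI_smul_fixed]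
  · simp only [pow_succ, pow_zero, one_mul, mul_smul, rotI_smul_vertex, h2, h3, h4, h5]
  · intro h0
    have := congrFun h0 1
    simp [crossProduct] at this

theorem orderOf_rotI : orderOf rotI = 5 :=
  have : Fact (Nat.Prime 5) := ⟨by norm_num⟩
  orderOf_eq_prime rotI_pow_five rotI_ne_one

theorem Dn_two_eq {x : O3} : x ∈ Dn 2 ↔ ∃ a b c : ℤˣ, a * b * c = 1 ∧ x = diag3 a b c := by
  rw [mem_Dn_two, permutesAxes_one_iff]
  constructor
  · rintro ⟨⟨a, b, c, rfl⟩, h⟩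
    refine ⟨a, b, c, ?_, rfl⟩
    rw [mem_SO3, det_diag3] at h
    rcases Int.units_eq_one_or (a * b * c) with h1 | h1
    · exact h1
    · rw [h1] at h
      norm_num at h
  · rintro ⟨a, b, c, h, rfl⟩
    refine ⟨⟨a, b, c, rfl⟩, ?_⟩
    rw [mem_SO3, det_diag3, h, sgnR_one]

theorem bO_mul_aO_eq : bO * aO = diag3 (-1) (-1) 1 * (aO * bO) * (aO * bO) := by
  apply vec_ext_smul <;> intro v <;>
    simp [mul_smul _ (aO * bO), bO_mul_aO_smul, aO_mul_bO_smul, diag3_smul]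

theorem T_le_I : T ≤ I := by
  refine le_inf ?_ inf_le_right
  rw [← closure_T, Subgroup.closure_le]
  rintro _ (rfl | rfl)
  · exact aO_mul_bO_mem_Ih
  · rw [bO_mul_aO_eq]
    exact mul_mem (mul_mem (diag3_mem_Ih _ _ _) aO_mul_bO_mem_Ih) aO_mul_bO_mem_Ih

/-- Invariance of a line under the cyclic permutation makes the squares of its coordinates equal.
Invariance under diag(1, -1, -1) makes one coordinate vanish, so no nonzero vector is left. -/
theorem not_hasAxis_T : ¬ HasAxis T := by
  rintro ⟨u, hu, h⟩
  have h1 := h _ aO_mul_bO_mem_T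
  have h2 := h (diag3 1 (-1) (-1)) (Dn_two_le_T (Dn_two_eq.2 ⟨_, _, _, by simp, rfl⟩))
  rw [aO_mul_bO_smul] at h1
  rw [diag3_smul] at h2
  have e : u 0 ^ 2 = u 1 ^ 2 ∧ u 1 ^ 2 = u 2 ^ 2 := by
    rcases h1 with h1 | h1 <;>
    · have h3 := congrFun h1 1
      have h4 := congrFun h1 2
      simp only [Matrix.cons_val_one, Matrix.cons_val, Pi.neg_apply] at h3 h4
      rw [h3, h4]
      simp
      try rw [← neg_eq_iff_eq_neg.2 h3.symm]
  have h0 : u 0 = 0 ∨ u 1 = 0 := by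
    rcases h2 with h2 | h2
    · right
      have h3 := congrFun h2 1
      simp at h3
      linarith
    · left
      have h3 := congrFun h2 0
      simp at h3
      linarith
  rw [dotProduct, Fin.sum_univ_three] at hu
  rcases h0 with h0 | h0 <;> rw [h0] at e hu <;> nlinarith [e.1, e.2]

theorem HasAxis.mono {P Q : Subgroup O3} (h : HasAxis Q) (hPQ : P ≤ Q) : HasAxis P := by
  obtain ⟨u, hu, h⟩ := h
  exact ⟨u, hu, fun g hg => h g (hPQ hg)⟩

theorem HasAxis.of_areConj {P Q : Subgroup O3} (hPQ : AreConj P Q) (h : HasAxis Q) :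
    HasAxis P := by
  obtain ⟨k, rfl⟩ := hPQ
  obtain ⟨u, hu, h⟩ := h
  refine ⟨k⁻¹ • u, by rw [dot_vec_smul, hu], fun g hg => ?_⟩
  have h1 := h _ (conj_mem_conj (g := k) hg)
  rw [mul_smul, mul_smul] at h1
  refine h1.imp (fun h => ?_) fun h => ?_
  · rwa [eq_inv_smul_iff]
  · rwa [← vec_smul_neg, eq_inv_smul_iff]

/-! ### Finiteness and orders of T, O and I. -/

instance finite_Oh : Finite Oh := by
  have : (Oh : Set O3) ⊆ Set.range
      fun p : ℤˣ × ℤˣ × ℤˣ × Equiv.Perm (Fin 3) => diag3 p.1 p.2.1 p.2.2.1 * permO p.2.2.2 := by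
    intro x hx
    obtain ⟨a, b, c, π, rfl⟩ := exists_diag3_mul_permO hx
    exact ⟨⟨a, b, c, π⟩, rfl⟩
  exact (Set.finite_range _).subset this

theorem finite_of_le {P Q : Subgroup O3} [hQ : Finite Q] (h : P ≤ Q) : Finite P :=
  Set.Finite.subset (s := (Q : Set O3)) hQ h

instance finite_O : Finite O := finite_of_le (inf_le_left : O ≤ Oh)

instance finite_T : Finite T := finite_of_le T_le_Oh

/-- A rotation is determined by its effect on two non-parallel vertices, and there are finitely many
vertices. -/
instance finite_I : Finite I := by
  have := finite_icosahedron.to_subtype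
  have h1 : (![1, gold, 0] : Fin 3 → ℝ) ∈ icosahedron := by
    rw [mem_icosahedron]
    simp
  have h2 : (![gold, 0, 1] : Fin 3 → ℝ) ∈ icosahedron := by
    rw [mem_icosahedron]
    simp
  refine Finite.of_injective (fun g : I => ((⟨g.1 • ![1, gold, 0], (g.2.1 _).2 h1⟩ : icosahedron),
    (⟨g.1 • ![gold, 0, 1], (g.2.1 _).2 h2⟩ : icosahedron))) fun g h hgh => ?_
  rw [Prod.mk.injEq, Subtype.mk.injEq, Subtype.mk.injEq] at hgh
  have : h.1⁻¹ * g.1 = 1 := by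
    refine eq_one_of_fixes_two (mul_mem (inv_mem h.2.2) g.2.2) (u := ![1, gold, 0])
      (v := ![gold, 0, 1]) ?_ ?_ ?_
    · rw [mul_smul, hgh.1, inv_smul_smul]
    · rw [mul_smul, hgh.2, inv_smul_smul]
    · intro h0
      have := congrFun h0 1
      simp [crossProduct] at this
  exact Subtype.ext (inv_mul_eq_one.1 this).symm

theorem not_hasAxis_O : ¬ HasAxis O := fun h => not_hasAxis_T (h.mono T_le_O)

theorem not_hasAxis_I : ¬ HasAxis I := fun h => not_hasAxis_T (h.mono T_le_I)

theorem aO_mem_O : aO ∈ O := ⟨aO_mem_Oh, aO_mem_SO3⟩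

theorem aO_notMem_T : aO ∉ T := fun h => aO_notMem_Td h.1

/-- `T` has index two in `O`. -/
theorem mul_mem_T {x y : O3} (hx : x ∈ O) (hxT : x ∉ T) (hy : y ∈ O) (hyT : y ∉ T) :
    x * y ∈ T :=
  ⟨mul_mem_Td hx.1 (fun h => hxT ⟨h, hx.2⟩) hy.1 (fun h => hyT ⟨h, hy.2⟩), mul_mem hx.2 hy.2⟩

theorem card_O_eq : Nat.card O = 2 * Nat.card T := by
  have h : (T.subgroupOf O).index = 2 := by
    rw [Subgroup.index_eq_two_iff]
    refine ⟨⟨aO, aO_mem_O⟩, fun b => ?_⟩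
    rw [Subgroup.mem_subgroupOf, Subgroup.mem_subgroupOf]
    change Xor (b.1 * aO ∈ T) (b.1 ∈ T)
    by_cases hb : b.1 ∈ T
    · exact Or.inr ⟨hb, fun h => aO_notMem_T ((Subgroup.mul_mem_cancel_left _ hb).1 h)⟩
    · exact Or.inl ⟨mul_mem_T b.2 hb aO_mem_O aO_notMem_T, hb⟩
  rw [← Subgroup.card_mul_index (T.subgroupOf O), h, mul_comm,
    Nat.card_congr (Subgroup.subgroupOfEquivOfLe T_le_O).toEquiv]

/-- The orders of T and O both lie in {12, 24, 60} and one is twice the other; no elements need to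
be counted. -/
theorem card_T : Nat.card T = 12 := by
  have h1 := card_of_not_hasAxis (P := T) inf_le_right not_hasAxis_T
  have h2 := card_of_not_hasAxis (P := O) inf_le_right not_hasAxis_O
  have := card_O_eq
  omega

theorem card_O : Nat.card O = 24 := by
  rw [card_O_eq, card_T]

/-- Of the orders 12, 24 and 60 only the last is divisible by the order 5 of `rotI`. -/
theorem card_eq_sixty {P : Subgroup O3} (hP : P ≤ SO3) [Finite P] (h : ¬ HasAxis P)
    (hr : rotI ∈ P) : Nat.card P = 60 := by
  have h1 := card_of_not_hasAxis hP h
  have h2 : 5 ∣ Nat.card P := by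
    rw [← orderOf_rotI, ← Subgroup.orderOf_mk rotI hr]
    exact orderOf_dvd_natCard _
  omega

theorem card_I : Nat.card I = 60 := card_eq_sixty (P := I) inf_le_right not_hasAxis_I rotI_mem_I

/-! ### The vertices of the icosahedron and the normalizer of I. -/

theorem exists_smul_vertex {v : Fin 3 → ℝ} (hv : v ∈ icosahedron) :
    ∃ g ∈ I, g • (![1, gold, 0] : Fin 3 → ℝ) = v := by
  have hab := T_le_I aO_mul_bO_mem_T
  -- Sign changes with product 1 permute the four vertices in the plane z = 0 transitively. The
  -- cyclic permutation of coordinates brings every other vertex into this plane.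
  have key : ∀ w ∈ icosahedron, w 2 = 0 → ∃ g ∈ I, g • (![1, gold, 0] : Fin 3 → ℝ) = w := by
    intro w hw hw2
    have hw' : w 0 ^ 2 = 1 ∧ w 1 ^ 2 = gold ^ 2 := by
      rw [mem_icosahedron, hw2] at hw
      have := gold_ne_zero
      rcases hw with ⟨-, -, h⟩ | ⟨-, h, -⟩ | ⟨-, h⟩
      · simp at h
        exact absurd h.symm (by simpa using this)
      · simp at h
      · exact h
    have hs : ∀ x y : ℝ, x ^ 2 = y ^ 2 → ∃ s : ℤˣ, sgnR s * y = x := by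
      intro x y h
      rcases sq_eq_sq_iff_eq_or_eq_neg.1 h with rfl | rfl
      exacts [⟨1, by simp⟩, ⟨-1, by simp⟩]
    obtain ⟨s, hs1⟩ := hs (w 0) 1 (by rw [hw'.1, one_pow])
    obtain ⟨t, ht1⟩ := hs (w 1) gold hw'.2
    refine ⟨diag3 s t (s * t), T_le_I (Dn_two_le_T (Dn_two_eq.2 ⟨s, t, s * t, ?_, rfl⟩)), ?_⟩
    · rw [← sq]
      exact Int.units_sq _
    · rw [diag3_smul]
      ext i
      fin_cases i
      exacts [hs1, ht1, by simp [hw2]]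
  have hcyc : ∀ w ∈ icosahedron,
      (∃ g ∈ I, g • (![1, gold, 0] : Fin 3 → ℝ) = (aO * bO) • w) →
        ∃ g ∈ I, g • (![1, gold, 0] : Fin 3 → ℝ) = w := by
    rintro w - ⟨g, hg, hgw⟩
    exact ⟨(aO * bO)⁻¹ * g, mul_mem (inv_mem hab) hg, by rw [mul_smul, hgw, inv_smul_smul]⟩
  have hmem : ∀ w ∈ icosahedron, (aO * bO) • w ∈ icosahedron := fun w => (hab.1 w).2
  rcases mem_icosahedron.1 hv with h | h | h
  · refine hcyc _ hv (hcyc _ (hmem _ hv) (key _ (hmem _ (hmem _ hv)) ?_))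
    simp [aO_mul_bO_smul, h.1]
  · refine hcyc _ hv (key _ (hmem _ hv) ?_)
    simp [aO_mul_bO_smul, h.1]
  · exact key v hv h.1

theorem orbit_eq_icosahedron : MulAction.orbit I (![1, gold, 0] : Fin 3 → ℝ) = icosahedron := by
  ext v
  constructor
  · rintro ⟨g, rfl⟩
    refine (g.2.1 _).2 ?_
    rw [mem_icosahedron]
    simp
  · intro hv
    obtain ⟨g, hg, h⟩ := exists_smul_vertex hv
    exact ⟨⟨g, hg⟩, h⟩

/-- The stabilizer of a vertex has order divisible by 5. If the orbit length were too, then 25 would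
divide 60. -/
theorem not_five_dvd_ncard : ¬ 5 ∣ icosahedron.ncard := by
  have h := card_stabilizer_mul_ncard_orbit I (![1, gold, 0] : Fin 3 → ℝ)
  rw [orbit_eq_icosahedron, card_I] at h
  have h2 : 5 ∣ Nat.card (MulAction.stabilizer I (![1, gold, 0] : Fin 3 → ℝ)) := by
    have := orderOf_dvd_natCard
      (⟨⟨rotI, rotI_mem_I⟩, rotI_smul_fixed⟩ : MulAction.stabilizer I (![1, gold, 0] : Fin 3 → ℝ))
    rwa [← Subgroup.orderOf_coe, ← Subgroup.orderOf_coe, orderOf_rotI] at this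
  intro h3
  have := mul_dvd_mul h2 h3
  rw [h] at this
  norm_num at this

/-- Rotations of the icosahedron of order five fix a vertex. -/
theorem exists_fixed_vertex {g : O3} (hg : g ∈ Ih) (h5 : g ^ 5 = 1) :
    ∃ v ∈ icosahedron, g • v = v := by
  classical
  have : Fact (Nat.Prime 5) := ⟨by norm_num⟩
  have := finite_icosahedron.fintype
  have hinj : Function.Injective fun v : icosahedron => (⟨g • v.1, (hg v).2 v.2⟩ : icosahedron) :=
    fun v w h => Subtype.ext (smul_left_cancel g (Subtype.ext_iff.1 h))
  set σ : Equiv.Perm icosahedron := Equiv.ofBijective _ (Finite.injective_iff_bijective.1 hinj)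
    with hσ
  have hpow : ∀ (n : ℕ) v, ((σ ^ n) v : Fin 3 → ℝ) = g ^ n • v.1 := by
    intro n
    induction n with
    | zero => intro v; simp
    | succ n ih =>
      intro v
      rw [pow_succ, Equiv.Perm.mul_apply, ih, pow_succ, mul_smul]
      rfl
  obtain ⟨a, ha⟩ := Equiv.Perm.exists_fixed_point_of_prime (p := 5) (n := 1) (σ := σ)
    (by
      rw [← Nat.card_eq_fintype_card, Nat.card_coe_set_eq]
      exact not_five_dvd_ncard)
    (by
      ext1 v
      apply Subtype.ext
      rw [pow_one, hpow, h5, one_smul]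
      rfl)
  exact ⟨a, a.2, Subtype.ext_iff.1 ha⟩

theorem dot_self_of_mem_icosahedron {v : Fin 3 → ℝ} (hv : v ∈ icosahedron) :
    v ⬝ᵥ v = 1 + gold ^ 2 := by
  rw [dotProduct, Fin.sum_univ_three]
  rcases mem_icosahedron.1 hv with ⟨h0, h1, h2⟩ | ⟨h0, h1, h2⟩ | ⟨h0, h1, h2⟩ <;>
    rw [h0] <;> linarith

/-- Every vertex lies on the axis of a conjugate of `rotI`. An element of the normalizer maps that
axis to the axis of another element of order five of I, which also passes through a vertex. Since
all vertices have the same length, the image of the vertex is a vertex up to sign. -/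
theorem normalizer_I_le : Subgroup.normalizer (I : Set O3) ≤ Ih := by
  intro g hg
  refine mem_Ih_of_forall fun v hv => ?_
  obtain ⟨k, hk, rfl⟩ := exists_smul_vertex hv
  have hr : g * (k * rotI * k⁻¹) * g⁻¹ ∈ I :=
    conj_mem_of_mem_normalizer hg (mul_mem (mul_mem hk rotI_mem_I) (inv_mem hk))
  have heq : g * (k * rotI * k⁻¹) * g⁻¹ = (g * k) * rotI * (g * k)⁻¹ := by group
  rw [heq] at hr
  have h5 : ((g * k) * rotI * (g * k)⁻¹) ^ 5 = 1 := by
    rw [conj_pow, rotI_pow_five, mul_one, mul_inv_cancel]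
  have h1 : (g * k) * rotI * (g * k)⁻¹ ≠ 1 := by
    rw [Ne, conj_eq_one_iff]
    exact rotI_ne_one
  have hfix : ((g * k) * rotI * (g * k)⁻¹) • (g • k • (![1, gold, 0] : Fin 3 → ℝ)) =
      g • k • ![1, gold, 0] := by
    rw [← mul_smul g k, mul_smul, inv_smul_smul, mul_smul, rotI_smul_fixed]
  obtain ⟨w, hw, hrw⟩ := exists_fixed_vertex hr.1 h5
  have hpos : (0 : ℝ) < 1 + gold ^ 2 := by positivity
  have hsq : (Real.sqrt (1 + gold ^ 2))⁻¹ * (Real.sqrt (1 + gold ^ 2))⁻¹ * (1 + gold ^ 2) = 1 := by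
    have := Real.mul_self_sqrt hpos.le
    have h0 := (Real.sqrt_pos.2 hpos).ne'
    field_simp
    nlinarith
  have hne := inv_ne_zero (Real.sqrt_pos.2 hpos).ne'
  set d := (Real.sqrt (1 + gold ^ 2))⁻¹
  have hunit : ∀ x : Fin 3 → ℝ, x ⬝ᵥ x = 1 + gold ^ 2 → (d • x) ⬝ᵥ (d • x) = 1 := by
    intro x hx
    rw [smul_dotProduct, dotProduct_smul, hx, smul_eq_mul, smul_eq_mul, ← mul_assoc, hsq]
  have hgv : (g • k • (![1, gold, 0] : Fin 3 → ℝ)) ⬝ᵥ (g • k • (![1, gold, 0] : Fin 3 → ℝ)) =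
      1 + gold ^ 2 := by
    rw [dot_vec_smul, dot_self_of_mem_icosahedron hv]
  rcases eq_or_eq_neg_of_fixed hr.2 h1 (hunit w (dot_self_of_mem_icosahedron hw)) (hunit _ hgv)
    (by rw [vec_smul_smul, hrw]) (by rw [vec_smul_smul, hfix]) with h | h
  · rw [smul_right_injective _ hne h]
    exact hw
  · rw [← smul_neg] at h
    rw [smul_right_injective _ hne h, ← inversion_smul]
    exact (inversion_mem_Ih w).2 hw

theorem normalizer_Ih : Subgroup.normalizer (Ih : Set O3) = Ih :=
  le_antisymm ((normalizer_le_normalizer_inf_SO3 Ih).trans normalizer_I_le) Subgroup.le_normalizer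

theorem normalizer_I : Subgroup.normalizer (I : Set O3) = Ih :=
  le_antisymm normalizer_I_le (normalizer_Ih.ge.trans (normalizer_le_normalizer_inf_SO3 Ih))

end PointGroup

namespace PointGroup

/-! ### Classification of the point groups -/

theorem inf_SO3_le_sup_Ci (S : Subgroup O3) : S ⊓ SO3 ≤ (S ⊔ Ci) ⊓ SO3 :=
  inf_le_inf_right _ le_sup_left

theorem inversion_mul_inversion_mul (x : O3) : inversion * (inversion * x) = x := by
  rw [← mul_assoc, inversion_mul_inversion, one_mul]

/-- S ∩ SO(3) has index at most two in (S ⊔ C_i) ∩ SO(3): for rotations x, y outside S, both ix and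
iy lie in S, and their product is xy. -/
theorem mul_mem_of_notMem {S : Subgroup O3} {x y : O3} (hx : x ∈ (S ⊔ Ci) ⊓ SO3) (hxS : x ∉ S)
    (hy : y ∈ (S ⊔ Ci) ⊓ SO3) (hyS : y ∉ S) : x * y ∈ S := by
  rw [← inversion_mul_mul]
  exact mul_mem ((mem_sup_Ci.1 hx.1).resolve_left hxS) ((mem_sup_Ci.1 hy.1).resolve_left hyS)

theorem conj_sup_Ci_inf (k : O3) (S : Subgroup O3) :
    conj k ((S ⊔ Ci) ⊓ SO3) = (conj k S ⊔ Ci) ⊓ SO3 := by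
  ext x
  have h1 : k⁻¹ * (inversion * x) * k = inversion * (k⁻¹ * x * k) := by
    rw [← mul_assoc, ← inversion_comm]
    simp only [mul_assoc]
  have h2 : k⁻¹ * x * k ∈ SO3 ↔ x ∈ SO3 := by
    rw [← conj_mem_SO3 (g := k⁻¹) (x := x), inv_inv]
  rw [mem_conj, Subgroup.mem_inf, Subgroup.mem_inf, mem_sup_Ci, mem_sup_Ci, mem_conj, mem_conj,
    h1, h2]

/-- A point group with the same rotations as `S × C_i` is a rotation group or contains the
inversion. -/
theorem eq_or_eq_sup_Ci {S : Subgroup O3} (h : (S ⊔ Ci) ⊓ SO3 ≤ S) :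
    S = (S ⊔ Ci) ⊓ SO3 ∨ S = (S ⊔ Ci) ⊓ SO3 ⊔ Ci := by
  have hmem : ∀ x ∈ S, x ∉ SO3 → inversion * x ∈ S := fun x hx hx' =>
    h ⟨mem_sup_Ci.2 (Or.inr (by rwa [inversion_mul_inversion_mul])), inversion_mul_mem_SO3 hx'⟩
  by_cases hi : inversion ∈ S
  · right
    apply le_antisymm
    · intro x hx
      rw [mem_sup_Ci]
      by_cases hx' : x ∈ SO3
      · exact Or.inl ⟨Subgroup.mem_sup_left hx, hx'⟩
      · exact Or.inr ⟨Subgroup.mem_sup_left (hmem x hx hx'), inversion_mul_mem_SO3 hx'⟩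
    · refine sup_le h fun x hx => ?_
      rcases mem_Ci.1 hx with rfl | rfl
      exacts [one_mem _, hi]
  · left
    refine le_antisymm (fun x hx => ⟨Subgroup.mem_sup_left hx, ?_⟩) h
    by_contra hx'
    exact hi ((Subgroup.mul_mem_cancel_right _ hx).1 (hmem x hx hx'))

/-- T is generated by elements of order three, which cannot lie outside a subgroup of index at most
two. -/
theorem T_le_of_le_sup_Ci_inf {S : Subgroup O3} (hT : T ≤ (S ⊔ Ci) ⊓ SO3) : T ≤ S := by
  have key : ∀ x ∈ T, x * x * x = 1 → x ∈ S := by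
    intro x hx h3
    by_contra hxS
    have h2 := mul_mem_of_notMem (hT hx) hxS (hT hx) hxS
    rw [eq_inv_of_mul_eq_one_right h3] at hxS
    exact hxS (inv_mem h2)
  rw [← closure_T, Subgroup.closure_le]
  rintro _ (rfl | rfl)
  exacts [key _ aO_mul_bO_mem_T aO_mul_bO_cube, key _ bO_mul_aO_mem_T bO_mul_aO_cube]

theorem listed_of_eq_T {S : Subgroup O3} (h : (S ⊔ Ci) ⊓ SO3 = T) : Listed S := by
  have hS := eq_or_eq_sup_Ci (h.le.trans (T_le_of_le_sup_Ci_inf h.ge))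
  rw [h] at hS
  rcases hS with rfl | rfl
  · rw [← closure_T]
    exact Listed.of_table .row_T
  · change Listed Th
    rw [← closure_Th]
    exact Listed.of_table .row_Th

theorem sup_Ci_eq {S : Subgroup O3} (h : inversion ∈ S) : S ⊓ SO3 ⊔ Ci = S := by
  ext x
  rw [mem_sup_Ci, Subgroup.mem_inf, Subgroup.mem_inf, Subgroup.mul_mem_cancel_left _ h]
  constructor
  · rintro (h | h) <;> exact h.1
  · intro hx
    by_cases hx' : x ∈ SO3
    exacts [Or.inl ⟨hx, hx'⟩, Or.inr ⟨hx, inversion_mul_mem_SO3 hx'⟩]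

/-- Either S contains all of O, and S is O or O_h. Or S ∩ SO(3) is a proper subgroup containing T,
hence equal to T, and the improper elements of S are i times rotations of O outside T, so S = T_d.
-/
theorem listed_of_eq_O {S : Subgroup O3} (h : (S ⊔ Ci) ⊓ SO3 = O) : Listed S := by
  by_cases hle : (S ⊔ Ci) ⊓ SO3 ≤ S
  · have hS := eq_or_eq_sup_Ci hle
    rw [h] at hS
    rcases hS with rfl | rfl
    · rw [← closure_O]
      exact Listed.of_table .row_O
    · rw [O, sup_Ci_eq inversion_mem_Oh, ← closure_Oh]
      exact Listed.of_table .row_Oh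
  · have hT : T ≤ S := T_le_of_le_sup_Ci_inf (T_le_O.trans h.ge)
    obtain ⟨y, hy, hyS⟩ := SetLike.not_le_iff_exists.1 hle
    have hyT : y ∉ T := fun h => hyS (hT h)
    have hST : ∀ x ∈ S, x ∈ SO3 → x ∈ T := by
      intro x hx hx'
      by_contra hxT
      have hxO : x ∈ O := h ▸ ⟨Subgroup.mem_sup_left hx, hx'⟩
      exact hyS ((Subgroup.mul_mem_cancel_left _ hx).1 (hT (mul_mem_T hxO hxT (h ▸ hy) hyT)))
    have hSTd : S = Td := by
      ext x
      by_cases hx' : x ∈ SO3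
      · exact ⟨fun hx => (hST x hx hx').1, fun hx => hT ⟨hx, hx'⟩⟩
      · have hix := inversion_mul_mem_SO3 hx'
        constructor
        · intro hx
          have hO : inversion * x ∈ O := by
            rw [← h]
            exact ⟨mem_sup_Ci.2 (Or.inr (by rwa [inversion_mul_inversion_mul])), hix⟩
          rcases mem_Td_or hO.1 with h1 | h1
          -- Otherwise `inversion * x` lies in `T`, so `S` contains the inversion and therefore all
          -- of `S ⊔ Ci`, including `y`.
          · have h2 := (Subgroup.mul_mem_cancel_right _ hx).1 (hT ⟨h1, hix⟩)
            refine absurd ?_ hyS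
            exact (mem_sup_Ci.1 hy.1).resolve_right fun h3 =>
              hyS ((Subgroup.mul_mem_cancel_left _ h2).1 h3)
          · rwa [inversion_mul_inversion_mul] at h1
        · intro hx
          have hO : inversion * x ∈ O := ⟨mul_mem inversion_mem_Oh (Td_le_Oh hx), hix⟩
          rw [← h] at hO
          rcases mem_sup_Ci.1 hO.1 with h1 | h1
          · exact absurd ((Subgroup.mul_mem_cancel_right _ hx).1 (hST _ h1 hix).1)
              inversion_notMem_Td
          · rwa [inversion_mul_inversion_mul] at h1
    rw [hSTd, ← closure_Td]
    exact Listed.of_table .row_Td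

/-- The elements of order three generating T, and `rotI` of order five, lie in S because their
orders are odd. A subgroup of I containing them has no axis and order divisible by 5, so it is I. -/
theorem listed_of_eq_I {S : Subgroup O3} (h : (S ⊔ Ci) ⊓ SO3 = I) : Listed S := by
  have hT : T ≤ S := T_le_of_le_sup_Ci_inf (T_le_I.trans h.ge)
  have hr : rotI ∈ S := by
    by_contra hr
    have hrI : rotI ∈ (S ⊔ Ci) ⊓ SO3 := h ▸ rotI_mem_I
    have h2 := mul_mem_of_notMem hrI hr hrI hr
    have h4 := mul_mem h2 h2
    have h5 : rotI * rotI * (rotI * rotI) * rotI = 1 := by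
      rw [← rotI_pow_five]
      simp only [pow_succ, pow_zero, one_mul, mul_assoc]
    rw [eq_inv_of_mul_eq_one_right h5] at hr
    exact hr (inv_mem h4)
  have hle : S ⊓ SO3 ≤ I := (inf_SO3_le_sup_Ci S).trans h.le
  have : Finite (S ⊓ SO3 : Subgroup O3) := finite_of_le hle
  have hcard : Nat.card (S ⊓ SO3 : Subgroup O3) = 60 :=
    card_eq_sixty inf_le_right (fun h => not_hasAxis_T (h.mono (le_inf hT inf_le_right)))
      ⟨hr, rotI_mem_SO3⟩
  have heq : S ⊓ SO3 = I := by
    refine Subgroup.eq_of_le_of_card_ge hle ?_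
    rw [hcard, card_I]
  have hS := eq_or_eq_sup_Ci (h.le.trans (heq.ge.trans inf_le_left))
  rw [h] at hS
  rcases hS with rfl | rfl
  · exact Listed.of_table .row_I
  · rw [I, sup_Ci_eq inversion_mem_Ih]
    exact Listed.of_table .row_Ih

/-- The inversion preserves every line, so an axis of the associated rotation group is preserved by
S itself and can be moved to the z-axis. -/
theorem listed_of_hasAxis {S : Subgroup O3} [Finite S] (h : HasAxis ((S ⊔ Ci) ⊓ SO3)) :
    Listed S := by
  obtain ⟨u, hu, h⟩ := h
  obtain ⟨f, hf, huf⟩ := exists_unit_perp u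
  obtain ⟨k, hk, -⟩ := exists_frame hu hf huf
  have hS : ∀ g ∈ S, g • u = u ∨ g • u = -u := by
    intro g hg
    by_cases hg' : g ∈ SO3
    · exact h g ⟨Subgroup.mem_sup_left hg, hg'⟩
    · have h1 := h (inversion * g) ⟨mem_sup_Ci.2 (Or.inr (by rwa [inversion_mul_inversion_mul])),
        inversion_mul_mem_SO3 hg'⟩
      rw [mul_smul, inversion_smul, neg_inj, neg_eq_iff_eq_neg] at h1
      exact h1.symm
  have hle : conj k S ≤ Dinfh := by
    intro x hx
    rw [mem_Dinfh_iff_smul]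
    have h1 := hS _ (mem_conj.1 hx)
    rw [mul_smul, mul_smul, hk, ← hk, inv_smul_eq_iff, inv_smul_eq_iff, vec_smul_neg] at h1
    rwa [← hk]
  have hconj : AreConj S (conj k S) := ⟨k, rfl⟩
  have := hconj.finite
  exact (listed_of_le_Dinfh hle).of_areConj hconj.symm

/-- Every point group is conjugate to one of the list. -/
theorem listed_of_finite (S : Subgroup O3) [Finite S] : Listed S := by
  by_cases hax : HasAxis ((S ⊔ Ci) ⊓ SO3)
  · exact listed_of_hasAxis hax
  have hfin : Finite ((S ⊔ Ci) ⊓ SO3 : Subgroup O3) := by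
    refine Set.Finite.subset (s := (S : Set O3) ∪ (fun x => inversion * x) '' (S : Set O3))
      ((Set.toFinite _).union ((Set.toFinite _).image _)) ?_
    rintro x ⟨hx, -⟩
    rcases mem_sup_Ci.1 hx with h | h
    · exact Or.inl h
    · exact Or.inr ⟨_, h, inversion_mul_inversion_mul x⟩
  have key : ∀ X : Subgroup O3, X ≤ SO3 → Finite X → ¬ HasAxis X →
      Nat.card ((S ⊔ Ci) ⊓ SO3 : Subgroup O3) = Nat.card X →
      ∃ k, (conj k S ⊔ Ci) ⊓ SO3 = X := by
    intro X hX _ hX' hc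
    obtain ⟨k, rfl⟩ := areConj_of_card_eq inf_le_right hX hax hX' hc
    exact ⟨k, (conj_sup_Ci_inf k S).symm⟩
  rcases card_of_not_hasAxis inf_le_right hax with h | h | h
  · obtain ⟨k, hk⟩ := key T inf_le_right inferInstance not_hasAxis_T (by rw [h, card_T])
    exact (listed_of_eq_T hk).of_areConj (AreConj.symm ⟨k, rfl⟩)
  · obtain ⟨k, hk⟩ := key O inf_le_right inferInstance not_hasAxis_O (by rw [h, card_O])
    exact (listed_of_eq_O hk).of_areConj (AreConj.symm ⟨k, rfl⟩)
  · obtain ⟨k, hk⟩ := key I inf_le_right inferInstance not_hasAxis_I (by rw [h, card_I])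
    exact (listed_of_eq_I hk).of_areConj (AreConj.symm ⟨k, rfl⟩)

/-! ### The rows of the tables -/

theorem IsComplementIn.symm {G : Type*} [Group G] {N S H : Subgroup G}
    (h : IsComplementIn N S H) : IsComplementIn N H S :=
  ⟨h.2.1, h.1, h.2.2.symm⟩

theorem ComplementTable.correct {N S₀ S H₀ H : Subgroup O3} (h : ComplementTable N S₀ S H₀ H) :
    AreConj S₀ S ∧ AreConj H₀ H ∧ Subgroup.normalizer (S : Set O3) = N ∧
      IsComplementIn N S H := by
  cases h with
  | row_one =>
    refine ⟨by rw [Cn_one]; exact AreConj.refl _, AreConj.refl _, ?_, ?_⟩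
    · rw [eq_top_iff]
      refine le_normalizer_of_conj_mem fun g _ x hx => ?_
      rw [Subgroup.mem_bot.1 hx]
      simp
    · exact (isComplementIn_self_bot ⊤).symm
  | row_Ci =>
    refine ⟨AreConj.refl _, AreConj.refl _, ?_, ?_⟩
    · rw [eq_top_iff]
      refine le_normalizer_of_conj_mem fun g _ x hx => ?_
      rcases mem_Ci.1 hx with rfl | rfl
      · simp
      · rwa [inversion_conj]
    · have := isComplementIn_inversion (S := ⊤) trivial
      rw [top_inf_eq] at this
      exact this.symm
  | row_Cnv n hn =>
    refine ⟨areConj_Cnv n, areConj_Cnv_two n, ?_, ?_⟩ <;> rw [closure_Cnv (by omega)]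
    exacts [normalizer_Cnv hn, isComplementIn_Cnv (by omega)]
  | row_Dnd n hn =>
    refine ⟨areConj_Dnd (by omega), areConj_Cs_bD_mul_mD, ?_, ?_⟩ <;>
      rw [closure_Dnd (by omega)]
    exacts [normalizer_Dnd hn, isComplementIn_Dnd (by omega)]
  | row_Dnh n hn =>
    rw [closure_Dnh (by omega), Dnh_eq (n := n) (by omega)]
    exact ⟨AreConj.refl _, areConj_Cs_aD_mul_mD n, normalizer_Dnh hn,
      isComplementIn_Dnh (by omega)⟩
  | row_Dn n hn =>
    rw [closure_Dn (by omega), Dn_eq (by omega)]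
    exact ⟨AreConj.refl _, areConj_Cnv_two n, normalizer_Dn hn, isComplementIn_Dn (by omega)⟩
  | row_I =>
    exact ⟨AreConj.refl _, AreConj.refl _, normalizer_I, isComplementIn_inversion inversion_mem_Ih⟩
  | row_Ih =>
    exact ⟨AreConj.refl _, by rw [Cn_one]; exact AreConj.refl _, normalizer_Ih,
      isComplementIn_self_bot _⟩
  | row_D2 =>
    rw [closure_D2]
    exact ⟨AreConj.refl _, areConj_D3d_closure, normalizer_Dn_two, isComplementIn_D2⟩
  | row_D2h =>
    rw [closure_D2h]
    exact ⟨AreConj.refl _, areConj_D3_closure, normalizer_Dnh_two, isComplementIn_D2h⟩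
  | row_T =>
    rw [closure_T]
    exact ⟨AreConj.refl _, areConj_C2h_closure, normalizer_T, isComplementIn_T⟩
  | row_Td =>
    rw [closure_Td]
    exact ⟨AreConj.refl _, areConj_C2_closure, normalizer_Td, isComplementIn_Td⟩
  | row_Th =>
    rw [closure_Th]
    exact ⟨AreConj.refl _, areConj_C2_closure, normalizer_Th, isComplementIn_Th⟩
  | row_O =>
    rw [closure_O]
    exact ⟨AreConj.refl _, AreConj.refl _, normalizer_O, isComplementIn_inversion inversion_mem_Oh⟩
  | row_Oh =>
    rw [closure_Oh, Subgroup.closure_empty]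
    exact ⟨AreConj.refl _, by rw [Cn_one]; exact AreConj.refl _, normalizer_Oh,
      isComplementIn_self_bot _⟩

theorem ComplementTable.normalizer_cases {N S₀ S H₀ H : Subgroup O3}
    (h : ComplementTable N S₀ S H₀ H) :
    N = ⊤ ∨ (∃ n : ℕ, 2 ≤ n ∧ N = Dnh (2 * n)) ∨ N = Ih ∨ N = Oh := by
  cases h with
  | row_Cnv n hn => exact Or.inr (Or.inl ⟨n, hn, rfl⟩)
  | row_Dnd n hn => exact Or.inr (Or.inl ⟨n, hn, rfl⟩)
  | row_Dnh n hn => exact Or.inr (Or.inl ⟨n, by omega, rfl⟩)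
  | row_Dn n hn => exact Or.inr (Or.inl ⟨n, by omega, rfl⟩)
  | row_one => exact Or.inl rfl
  | row_Ci => exact Or.inl rfl
  | row_I => exact Or.inr (Or.inr (Or.inl rfl))
  | row_Ih => exact Or.inr (Or.inr (Or.inl rfl))
  | _ => exact Or.inr (Or.inr (Or.inr rfl))

/-! ### The normalizers are pairwise not conjugate -/

theorem hasAxis_Dinfh : HasAxis Dinfh :=
  ⟨e3, e3_dot_e3, fun _ hg => mem_Dinfh_iff_smul.1 hg⟩

theorem Dnh_le_Dinfh {n : ℕ} (hn : n ≠ 0) : Dnh n ≤ Dinfh := by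
  rw [Dnh_eq hn]
  exact axial_le_Dinfh _ _ _

theorem T_le_Ih : T ≤ Ih := T_le_I.trans inf_le_left

/-- The exponent 2n is even, so it also kills the elements of order two with s = -1. Annihilating
exponents are conjugacy invariants and distinguish the D_{(2n)h} from one another and from D_{∞h}.
-/
theorem pow_eq_one_of_mem_Dnh {n : ℕ} (hn : n ≠ 0) {g : O3} (hg : g ∈ Dnh (2 * n)) :
    g ^ (2 * n) = 1 := by
  rw [Dnh_eq (by omega)] at hg
  obtain ⟨z, s, t, rfl, -, hz⟩ := hg
  have hz' : z ^ (2 * n) = 1 := by simpa using hz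
  rcases Int.units_eq_one_or s with rfl | rfl
  · rw [pow_mul, sq, dih_rot_mul_self, dih_rot_pow, ← pow_mul, hz', dih_one]
  · rw [pow_mul, sq, dih_refl_mul_self, one_pow]

theorem pow_eq_one_of_areConj {P Q : Subgroup O3} (h : AreConj P Q) {m : ℕ}
    (hQ : ∀ g ∈ Q, g ^ m = 1) {g : O3} (hg : g ∈ P) : g ^ m = 1 := by
  obtain ⟨k, rfl⟩ := h
  have := hQ _ (conj_mem_conj (g := k) hg)
  rwa [conj_pow, conj_eq_one_iff] at this

theorem exp_pow_eq_one_iff {n m : ℕ} (hn : n ≠ 0) :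
    Circle.exp (2 * Real.pi / n) ^ m = 1 ↔ n ∣ m := by
  rw [← (Complex.isPrimitiveRoot_exp n hn).pow_eq_one_iff_dvd, Circle.ext_iff, Circle.coe_pow,
    Circle.coe_exp, Circle.coe_one]
  push_cast
  rw [show (2 * (Real.pi : ℂ) / n * Complex.I) = 2 * Real.pi * Complex.I / n by ring]

theorem dvd_of_areConj_Dnh {n m : ℕ} (hn : n ≠ 0) (hm : m ≠ 0)
    (h : AreConj (Dnh (2 * n)) (Dnh (2 * m))) : 2 * n ∣ 2 * m := by
  have h1 : rotZ (2 * Real.pi / (2 * n : ℕ)) ∈ Dnh (2 * n) :=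
    Subgroup.subset_closure (Or.inl rfl)
  have h2 := pow_eq_one_of_areConj h (fun g => pow_eq_one_of_mem_Dnh hm) h1
  rw [rotZ_eq, dih_rot_pow, ← dih_one] at h2
  exact (exp_pow_eq_one_iff (by omega)).1 (dih_inj h2).1

/-- D_{∞h} contains a rotation of order 2n + 1, which does not divide 2n. -/
theorem not_areConj_Dinfh_Dnh {n : ℕ} (hn : n ≠ 0) : ¬ AreConj Dinfh (Dnh (2 * n)) := by
  intro h
  have h1 : rotZ (2 * Real.pi / (2 * n + 1 : ℕ)) ∈ Dinfh :=
    Subgroup.subset_closure (Or.inl ⟨_, rfl⟩)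
  have h2 := pow_eq_one_of_areConj h (fun g => pow_eq_one_of_mem_Dnh hn) h1
  rw [rotZ_eq, dih_rot_pow, ← dih_one] at h2
  have h3 := (exp_pow_eq_one_iff (by omega)).1 (dih_inj h2).1
  have := Nat.le_of_dvd (by omega) h3
  omega

/-- A conjugate of `rotI` in O_h would be a rotation of order 5 in O, a group of order 24. -/
theorem not_areConj_of_rotI_mem {P : Subgroup O3} (hr : rotI ∈ P) : ¬ AreConj P Oh := by
  rintro ⟨k, hk⟩
  have h1 : k * rotI * k⁻¹ ∈ O := ⟨hk ▸ conj_mem_conj hr, conj_mem_SO3.2 rotI_mem_SO3⟩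
  have h2 : orderOf (k * rotI * k⁻¹) = 5 :=
    orderOf_eq_prime (p := 5) (hp := ⟨by norm_num⟩)
      (by rw [conj_pow, rotI_pow_five, mul_one, mul_inv_cancel])
      (by rw [Ne, conj_eq_one_iff]; exact rotI_ne_one)
  have h3 := orderOf_dvd_natCard (⟨_, h1⟩ : O)
  rw [Subgroup.orderOf_mk, h2, card_O] at h3
  norm_num at h3

/-- The normalizers in the tables are pairwise not conjugate. -/
theorem eq_of_areConj_normalizers {N N' : Subgroup O3}
    (hN : N = ⊤ ∨ (∃ n : ℕ, 1 ≤ n ∧ N = Dnh (2 * n)) ∨ N = Ih ∨ N = Oh ∨ N = Dinfh)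
    (hN' : N' = ⊤ ∨ (∃ n : ℕ, 1 ≤ n ∧ N' = Dnh (2 * n)) ∨ N' = Ih ∨ N' = Oh ∨ N' = Dinfh)
    (h : AreConj N N') : N = N' := by
  -- Having an invariant line is a conjugacy invariant, and no group containing `T` has one.
  have hax : ∀ {P Q}, T ≤ P → HasAxis Q → ¬ AreConj P Q := fun hP hQ h =>
    not_hasAxis_T ((hQ.of_areConj h).mono hP)
  have hD : ∀ {n : ℕ}, 1 ≤ n → HasAxis (Dnh (2 * n)) := fun hn =>
    hasAxis_Dinfh.mono (Dnh_le_Dinfh (by omega))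
  have htop : ∀ {Q : Subgroup O3}, AreConj ⊤ Q → ⊤ = Q := by
    rintro Q ⟨k, rfl⟩
    exact (conj_top k).symm
  have hT : T ≤ ⊤ := le_top
  have hr : rotI ∈ (⊤ : Subgroup O3) := trivial
  rcases hN with rfl | ⟨n, hn, rfl⟩ | rfl | rfl | rfl
  · exact htop h
  · rcases hN' with rfl | ⟨m, hm, rfl⟩ | rfl | rfl | rfl
    · exact (htop h.symm).symm
    · rw [Nat.dvd_antisymm (dvd_of_areConj_Dnh (by omega) (by omega) h)
        (dvd_of_areConj_Dnh (by omega) (by omega) h.symm)]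
    · exact absurd h.symm (hax T_le_Ih (hD hn))
    · exact absurd h.symm (hax T_le_Oh (hD hn))
    · exact absurd h.symm (not_areConj_Dinfh_Dnh (by omega))
  · rcases hN' with rfl | ⟨m, hm, rfl⟩ | rfl | rfl | rfl
    · exact (htop h.symm).symm
    · exact absurd h (hax T_le_Ih (hD hm))
    · rfl
    · exact absurd h (not_areConj_of_rotI_mem rotI_mem_Ih)
    · exact absurd h (hax T_le_Ih hasAxis_Dinfh)
  · rcases hN' with rfl | ⟨m, hm, rfl⟩ | rfl | rfl | rfl
    · exact (htop h.symm).symm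
    · exact absurd h (hax T_le_Oh (hD hm))
    · exact absurd h.symm (not_areConj_of_rotI_mem rotI_mem_Ih)
    · rfl
    · exact absurd h (hax T_le_Oh hasAxis_Dinfh)
  · rcases hN' with rfl | ⟨m, hm, rfl⟩ | rfl | rfl | rfl
    · exact (htop h.symm).symm
    · exact absurd h (not_areConj_Dinfh_Dnh (by omega))
    · exact absurd h.symm (hax T_le_Ih hasAxis_Dinfh)
    · exact absurd h.symm (hax T_le_Oh hasAxis_Dinfh)
    · rfl

theorem Dinfh_ne {N : Subgroup O3}
    (hN : N = ⊤ ∨ (∃ n : ℕ, 1 ≤ n ∧ N = Dnh (2 * n)) ∨ N = Ih ∨ N = Oh) : N ≠ Dinfh := by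
  rintro rfl
  rcases hN with h | ⟨n, hn, h⟩ | h | h
  · exact not_hasAxis_T (hasAxis_Dinfh.mono (h ▸ le_top))
  · exact not_areConj_Dinfh_Dnh (n := n) (by omega) (h ▸ AreConj.refl _)
  · exact not_hasAxis_T (hasAxis_Dinfh.mono (h ▸ T_le_Ih))
  · exact not_hasAxis_T (hasAxis_Dinfh.mono (h ▸ T_le_Oh))

/-- A complement in the normalizer is carried along by conjugation. -/
theorem exists_isComplementIn_of_areConj {S S' : Subgroup O3} (h : AreConj S S')
    (hS : ∃ H, IsComplementIn (Subgroup.normalizer (S : Set O3)) S H) :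
    ∃ H, IsComplementIn (Subgroup.normalizer (S' : Set O3)) S' H := by
  obtain ⟨g, rfl⟩ := h
  obtain ⟨H, hH⟩ := hS
  rw [normalizer_conj]
  exact ⟨_, hH.conj g⟩

theorem areConj_cyclic {S : Subgroup O3} {n : ℕ}
    (h : AreConj (Cn n) S ∨ AreConj (S2n n) S ∨ AreConj (Cnh n) S) :
    ∃ S' : Subgroup O3, (S' = Cn n ∨ S' = S2n n ∨ S' = Cnh n) ∧ AreConj S' S := by
  rcases h with h | h | h
  exacts [⟨_, Or.inl rfl, h⟩, ⟨_, Or.inr (Or.inl rfl), h⟩, ⟨_, Or.inr (Or.inr rfl), h⟩]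

/-! ### Normalizers and complements of the listed groups after conjugation. -/

theorem Listed.normalizer_cases {S : Subgroup O3} (h : Listed S) :
    (∃ (g : O3) (N S₀ S₁ H₀ H₁ : Subgroup O3), ComplementTable N S₀ S₁ H₀ H₁ ∧ S = conj g S₁ ∧
      Subgroup.normalizer (S : Set O3) = conj g N ∧
      IsComplementIn (Subgroup.normalizer (S : Set O3)) S (conj g H₁)) ∨
    AreConj Dinfh (Subgroup.normalizer (S : Set O3)) ∧ (AreConj Cs S ∨
      ∃ n : ℕ, 2 ≤ n ∧ (AreConj (Cn n) S ∨ AreConj (S2n n) S ∨ AreConj (Cnh n) S)) := by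
  rcases h with ⟨g, N, S₀, S₁, H₀, H₁, ht, rfl⟩ | h | ⟨n, hn, h⟩
  · left
    have hN := ht.correct.2.2.1
    have heq : Subgroup.normalizer (conj g S₁ : Set O3) = conj g N := by
      rw [normalizer_conj, hN]
    refine ⟨g, N, S₀, S₁, H₀, H₁, ht, rfl, heq, ?_⟩
    rw [heq]
    exact ht.correct.2.2.2.conj g
  · right
    refine ⟨?_, Or.inl h⟩
    rw [← normalizer_Cs]
    exact h.normalizer
  · right
    refine ⟨?_, Or.inr ⟨n, hn, h⟩⟩
    obtain ⟨S', hS', h⟩ := areConj_cyclic h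
    rw [← normalizer_cyclic hn hS']
    exact h.normalizer

end PointGroup

/-! ### The main theorem. -/

theorem mainTheorem6 :
    -- `D_{(2n)h}` and `O_h` in terms of the generators used in the tables
    (∀ n : ℕ, 1 ≤ n → Subgroup.closure {aD n, bD, mD} = Dnh (2 * n)) ∧
    Subgroup.closure {aO, bO, inversion} = Oh ∧
    -- every row of the tables is correct
    (∀ N S₀ S H₀ H : Subgroup O3, ComplementTable N S₀ S H₀ H →
      AreConj S₀ S ∧ AreConj H₀ H ∧ Subgroup.normalizer (S : Set O3) = N ∧
        IsComplementIn N S H) ∧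
    -- the tables contain every point group with normalizer `K_h`, `D_{(2n)h}`, `I_h` or `O_h`
    (∀ S : Subgroup O3, Finite S → ∀ N : Subgroup O3,
      (N = ⊤ ∨ (∃ n : ℕ, 1 ≤ n ∧ N = Dnh (2 * n)) ∨ N = Ih ∨ N = Oh) →
      AreConj N (Subgroup.normalizer (S : Set O3)) →
      ∃ (g : O3) (S₀ S₁ H₀ H₁ : Subgroup O3), ComplementTable N S₀ S₁ H₀ H₁ ∧
        S = conj g S₁ ∧ Subgroup.normalizer (S : Set O3) = conj g N ∧
        IsComplementIn (Subgroup.normalizer (S : Set O3)) S (conj g H₁)) ∧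
    -- the only other normalizer of a point group is `D_{∞h}`
    (∀ S : Subgroup O3, Finite S →
      (∃ N : Subgroup O3,
        (N = ⊤ ∨ (∃ n : ℕ, 2 ≤ n ∧ N = Dnh (2 * n)) ∨ N = Ih ∨ N = Oh ∨ N = Dinfh) ∧
        AreConj N (Subgroup.normalizer (S : Set O3)))) ∧
    -- the groups with normalizer `D_{∞h}`
    (Subgroup.normalizer (Cs : Set O3) = Dinfh ∧
      IsComplementIn Dinfh Cs Cinfv ∧ IsComplementIn Dinfh Cs Dinf) ∧
    (∀ n : ℕ, 2 ≤ n → ∀ S : Subgroup O3, S = Cn n ∨ S = S2n n ∨ S = Cnh n →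
      Subgroup.normalizer (S : Set O3) = Dinfh ∧ ¬ ∃ H : Subgroup O3, IsComplementIn Dinfh S H) ∧
    (∀ S : Subgroup O3, Finite S → AreConj Dinfh (Subgroup.normalizer (S : Set O3)) →
      AreConj Cs S ∨
        ∃ n : ℕ, 2 ≤ n ∧ (AreConj (Cn n) S ∨ AreConj (S2n n) S ∨ AreConj (Cnh n) S)) ∧
    -- classification of the point groups that admit an ideal equivariant symmetry breaking set
    (∀ S : Subgroup O3, Finite S →
      (AdmitsIdealSBS S ↔
        ¬ ∃ n : ℕ, 2 ≤ n ∧ (AreConj (Cn n) S ∨ AreConj (S2n n) S ∨ AreConj (Cnh n) S))) := by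
  have weaken : ∀ {N : Subgroup O3},
      (N = ⊤ ∨ (∃ n : ℕ, 2 ≤ n ∧ N = Dnh (2 * n)) ∨ N = Ih ∨ N = Oh) →
      N = ⊤ ∨ (∃ n : ℕ, 1 ≤ n ∧ N = Dnh (2 * n)) ∨ N = Ih ∨ N = Oh := by
    rintro N (h | ⟨n, hn, h⟩ | h)
    exacts [Or.inl h, Or.inr (Or.inl ⟨n, by omega, h⟩), Or.inr (Or.inr h)]
  have extend : ∀ {N : Subgroup O3},
      (N = ⊤ ∨ (∃ n : ℕ, 1 ≤ n ∧ N = Dnh (2 * n)) ∨ N = Ih ∨ N = Oh) →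
      N = ⊤ ∨ (∃ n : ℕ, 1 ≤ n ∧ N = Dnh (2 * n)) ∨ N = Ih ∨ N = Oh ∨ N = Dinfh := by
    rintro N (h | h | h | h)
    exacts [Or.inl h, Or.inr (Or.inl h), Or.inr (Or.inr (Or.inl h)),
      Or.inr (Or.inr (Or.inr (Or.inl h)))]
  refine ⟨fun n hn => closure_aD_bD_mD hn, closure_Oh, fun N S₀ S H₀ H h => h.correct,
    fun S _ N hN h => ?_, fun S _ => ?_,
    ⟨normalizer_Cs, isComplementIn_Cs_Cinfv, isComplementIn_Cs_Dinf⟩,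
    fun n hn S hS => ⟨normalizer_cyclic hn hS, fun ⟨H, hH⟩ => not_isComplementIn_cyclic hn hS H hH⟩,
    fun S _ h => ?_, fun S _ => ?_⟩
  · rcases (listed_of_finite S).normalizer_cases with
      ⟨g, N', S₀, S₁, H₀, H₁, ht, hS, hnorm, hc⟩ | ⟨h', -⟩
    -- Both `N` and the normalizer `N'` heading the row of `S` are conjugate to the normalizer of
    -- `S`, so the row stands under `N`.
    · obtain rfl : N = N' := eq_of_areConj_normalizers (extend hN)
        (extend (weaken ht.normalizer_cases))
        (h.trans (AreConj.symm ⟨g, hnorm⟩))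
      exact ⟨g, S₀, S₁, H₀, H₁, ht, hS, hnorm, hc⟩
    · exact absurd (eq_of_areConj_normalizers (extend hN)
        (Or.inr (Or.inr (Or.inr (Or.inr rfl)))) (h.trans h'.symm)) (Dinfh_ne hN)
  · rcases (listed_of_finite S).normalizer_cases with
      ⟨g, N', S₀, S₁, H₀, H₁, ht, -, hnorm, -⟩ | ⟨h', -⟩
    · refine ⟨N', ?_, g, hnorm⟩
      rcases ht.normalizer_cases with h | h | h | h
      exacts [Or.inl h, Or.inr (Or.inl h), Or.inr (Or.inr (Or.inl h)),
        Or.inr (Or.inr (Or.inr (Or.inl h)))]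
    · exact ⟨Dinfh, by simp, h'⟩
  · rcases (listed_of_finite S).normalizer_cases with
      ⟨g, N', S₀, S₁, H₀, H₁, ht, -, hnorm, -⟩ | ⟨-, h'⟩
    · exact absurd (eq_of_areConj_normalizers (Or.inr (Or.inr (Or.inr (Or.inr rfl))))
        (extend (weaken ht.normalizer_cases)) (h.trans (AreConj.symm ⟨g, hnorm⟩))).symm
        (Dinfh_ne (weaken ht.normalizer_cases))
    · exact h'
  · rw [admitsIdealSBS_iff]
    constructor
    · rintro hc ⟨n, hn, h⟩
      obtain ⟨S', hS', h⟩ := areConj_cyclic h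
      obtain ⟨H, hH⟩ := exists_isComplementIn_of_areConj h.symm hc
      rw [normalizer_cyclic hn hS'] at hH
      exact not_isComplementIn_cyclic hn hS' H hH
    · intro hnot
      rcases (listed_of_finite S).normalizer_cases with
        ⟨g, N', S₀, S₁, H₀, H₁, -, -, -, hc⟩ | ⟨-, h | h⟩
      · exact ⟨_, hc⟩
      · refine exists_isComplementIn_of_areConj h ⟨Cinfv, ?_⟩
        rw [normalizer_Cs]
        exact isComplementIn_Cs_Cinfv
      · exact absurd h hnot
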